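/- **Setting.** Let $M^{2m}$ be a smooth (Hausdorff) manifold with an atlas of distinguished coordinates $(x^i,\tilde x_j)$, $1\le i,j\le m$, whose coordinate changes are locally $x=\alpha x'+a$, $\tilde x=\beta\tilde x'+b$ with constant $\alpha,\beta,a,b$ and $\alpha^T\beta=\mathrm{Id}$ (a flat para-Kähler, or flat bi-Lagrangian, manifold). It carries the Lagrangian foliations $L=\mathrm{span}(\partial/\partial x^i)$ and $\tilde L=\mathrm{span}(\partial/\partial\tilde x_j)$, so that $TM=L\oplus\tilde L$, the neutral metric $\gamma$ for which $L,\tilde L$ are isotropic and $\gamma(\partial/\partial x^i,\partial/\partial\tilde x_j)=\delta_i^j$, and the flat connection $\nabla^0$ for which all $\partial/\partial x^i,\partial/\partial\tilde x_j$ are parallel. $L^*$ is identified with the annihilator of $\tilde L$. $X,Y,Z$ denote smooth vector fields on $M$ and connections are smooth linear connections on $TM$. For a connection $\nabla$ define $X\wedge_\nabla Y$ by $\gamma(Z,X\wedge_\nabla Y)=\frac12[\gamma(X,\nabla_ZY)-\gamma(Y,\nabla_ZX)]$, and put $$[X,Y]_{\nabla^0}=\nabla^0_XY-\nabla^0_YX-X\wedge_{\nabla^0}Y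 .$$ The Gualtieri torsion of $\nabla$ is $$\mathcal T^\nabla(X,Y,Z)=\gamma\big(\nabla_XY-\nabla_YX-[X,Y]_{\nabla^0}-X\wedge_\nabla Y,\;Z\big).$$ A *field* $(g,B)$ consists of a non degenerate (not necessarily definite) metric $g$ on the bundle $L$ and a $2$-form $B\in\Gamma\wedge^2L^*$, both smooth on $M$. Put $\iota_\pm X=X+\sharp_\gamma\flat_{B\pm g}X$ for $X\in L$ (where $\flat_{B\pm g}X=(B\pm g)(X,\cdot)$) and $S_\pm=\iota_\pm(L)$; then $TM=S_+\oplus S_-$, and the generalized metric $\mathcal H$ is defined by $\mathcal H=\pm\gamma$ on $S_\pm$ and $S_+\perp_{\mathcal H}S_-$. A *double-metric connection* is a connection $\nabla$ that preserves $\gamma$ and $\mathcal H$. It determines connections $D^\pm$ on $L$ by $\nabla_Z(\iota_\pm Y)=\iota_\pm(D^\pm_ZY)$, $Y\in\Gamma L$. A *CWT connection* of $(g,B)$ is a double-metric connection $\nabla^1$ with vanishing mixed torsion, i.e. $\mathcal T^{\nabla^1}(X,Y,Z)=0$ whenever $X\in\Gamma S_\mp$ and $Y,Z\in\Gamma S_\pm$,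 and such that the two partial connections $(X,Y)\mapsto D^{1,\pm}_XY$, $X,Y\in\Gamma L$, are the Levi-Civita connection of the metric $g$ along the leaves of $L$. **Proposition 5.4.** Let $(g,B)$ be a field. (a) If $g+B$ is non degenerate on $L$ at every point (this is automatic if $g$ is definite), then $(g,B)$ has exactly one CWT connection. (b) A double-metric connection $\nabla$ has zero Gualtieri torsion iff for all $X,Y,Z$ $$\gamma(\nabla_XY,Z)+\gamma(\nabla_YZ,X)+\gamma(\nabla_ZX,Y)=K(X,Y,Z),$$ where $$K(X,Y,Z)=\gamma([X,Y]_{\nabla^0},Z)+\gamma([Y,Z]_{\nabla^0},X)+\gamma([X,Z]_{\nabla^0},Y)-\tfrac12\big[X(\gamma(Y,Z))-Y(\gamma(Z,X))-3Z(\gamma(X,Y))\big].$$ (c) Let $\nabla^1$ be a CWT connection of $(g,B)$. There is a unique double-metric connection $\nabla$ (the *VTC connection*) with zero Gualtieri torsion and such that the covariant deformation $\Psi(X,Y,Z)=\gamma(\nabla_XY-\nabla^1_XY,Z)$ is totally skew symmetric. Moreover, $\Psi$ satisfies $$3\,\mathrm{Alt}(\Psi)(X,Y,Z)=K(X,Y,Z)-\big[\gamma(\nabla^1_XY,Z)+\gamma(\nabla^1_YZ,X)+\gamma(\nabla^1_ZX,Y)\big],\tag{1}$$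 where $\mathrm{Alt}$ is the alternation with the factor $1/3!$. (d) With $\nabla^1$ as in (c), for any double-metric connection $\nabla$ such that $\Psi$, defined as in (c), is totally skew symmetric, equation (1) is equivalent to the following pair of equations, for all $X,Y,Z\in\Gamma L$, where $\psi^\pm(X,Y,Z)=\frac12\Psi(\iota_\pm X,\iota_\pm Y,\iota_\pm Z)$: $$\begin{aligned}3\,\mathrm{Alt}(\psi^\pm)(X,Y,Z)=&\pm g(pr_Lpr_{S_\pm}[\iota_\pm X,\iota_\pm Y]_{\nabla^0},Z)\pm g(pr_Lpr_{S_\pm}[\iota_\pm Y,\iota_\pm Z]_{\nabla^0},X)\pm g(pr_Lpr_{S_\pm}[\iota_\pm X,\iota_\pm Z]_{\nabla^0},Y)\\&\mp\tfrac12\big[(\iota_\pm X)(g(Y,Z))-(\iota_\pm Y)(g(Z,X))-3(\iota_\pm Z)(g(X,Y))\big]\\&\mp\big[g(D^{1,\pm}_{\iota_\pm X}Y,Z)+g(D^{1,\pm}_{\iota_\pm Y}Z,X)+g(D^{1,\pm}_{\iota_\pm Z}X,Y)\big].\end{aligned}$$ Here $pr_{S_\pm}$ and $pr_L$ are the projections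 of $TM=S_+\oplus S_-$ and $TM=L\oplus\tilde L$. -/

import Mathlib

open scoped Manifold ContDiff Topology

noncomputable section

/-- The coordinate space `ℝ^m × ℝ^m` of the distinguished coordinates `(xⁱ, x̃ⱼ)` of a double
manifold. -/
abbrev DoubleModel (m : ℕ) : Type := (Fin m → ℝ) × (Fin m → ℝ)

/-- A manifold `M` modelled on `ℝ^m × ℝ^m` is a *double manifold* (a flat para-Kähler, or flat
bi-Lagrangian, manifold) if the changes of the distinguished coordinates given by its atlas are
locally of the form `x = α x' + a`, `x̃ = β x̃' + b` with constant `α, β, a, b` and `αᵀ β = 1`. -/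
class DoubleManifold (m : ℕ) (M : Type*) [TopologicalSpace M] [ChartedSpace (DoubleModel m) M] :
    Prop where
  transition : ∀ e ∈ atlas (DoubleModel m) M, ∀ e' ∈ atlas (DoubleModel m) M,
    ∀ z ∈ (e.symm.trans e').source,
      ∃ (α β : Matrix (Fin m) (Fin m) ℝ) (a b : Fin m → ℝ), α.transpose * β = 1 ∧
        ∀ᶠ y in 𝓝 z, (e.symm.trans e') y = (α.mulVec y.1 + a, β.mulVec y.2 + b)

namespace DoubleManifold

/-! In Mathlib the tangent space of `M` at `x` is a copy of the coordinate space, the vector with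
coordinates `v` standing for `vⁱ ∂/∂xⁱ + ṽᵢ ∂/∂x̃ᵢ` in the distinguished chart `chartAt _ x`
(`v.1 = (vⁱ)`, `v.2 = (ṽᵢ)`). The objects below are given by their expressions in these
coordinates; these do not depend on the choice of the distinguished chart. -/

section Canonical

variable {m : ℕ} {M : Type*} [TopologicalSpace M] [ChartedSpace (DoubleModel m) M]

/-- The components `(vⁱ, ṽᵢ)` of a tangent vector at `x`. -/
def comps {x : M} (v : TangentSpace 𝓘(ℝ, DoubleModel m) x) : DoubleModel m := v

/-- The tangent vector at `x` with given components. -/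
def ofComps (x : M) (v : DoubleModel m) : TangentSpace 𝓘(ℝ, DoubleModel m) x := v

/-- The neutral metric `γ`, with `γ(∂/∂xⁱ, ∂/∂x̃ⱼ) = δ_{ij}` and `L`, `L̃` isotropic. -/
def gam {x : M} (v w : TangentSpace 𝓘(ℝ, DoubleModel m) x) : ℝ :=
  (comps v).1 ⬝ᵥ (comps w).2 + (comps v).2 ⬝ᵥ (comps w).1

/-- The Lagrangian foliation `L` (leaves `x̃ = const`), spanned by the `∂/∂xⁱ`. -/
def leafL (x : M) : Set (TangentSpace 𝓘(ℝ, DoubleModel m) x) := {v | (comps v).2 = 0}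

/-- The Lagrangian foliation `L̃` (leaves `x = const`), spanned by the `∂/∂x̃ᵢ`. -/
def leafLt (x : M) : Set (TangentSpace 𝓘(ℝ, DoubleModel m) x) := {v | (comps v).1 = 0}

/-- The projection of `TM = L ⊕ L̃` onto `L`. -/
def prL {x : M} (v : TangentSpace 𝓘(ℝ, DoubleModel m) x) :
    TangentSpace 𝓘(ℝ, DoubleModel m) x := ofComps x ((comps v).1, 0)

/-- The vectors `∂/∂xⁱ`. -/
def dX (x : M) (i : Fin m) : TangentSpace 𝓘(ℝ, DoubleModel m) x := ofComps x (Pi.single i 1, 0)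

/-- The vectors `∂/∂x̃ᵢ`. -/
def dXt (x : M) (i : Fin m) : TangentSpace 𝓘(ℝ, DoubleModel m) x := ofComps x (0, Pi.single i 1)

/-- `♯_γ`: for a (linear) covector `α` at `x`, the vector with `γ(♯_γ α, v) = α v` for all `v`. -/
def sharpGam {x : M} (α : TangentSpace 𝓘(ℝ, DoubleModel m) x → ℝ) :
    TangentSpace 𝓘(ℝ, DoubleModel m) x :=
  ofComps x (fun i => α (dXt x i), fun i => α (dX x i))

/-- A (not necessarily smooth) vector field on `M`. -/
abbrev VField (m : ℕ) (M : Type*) [TopologicalSpace M] [ChartedSpace (DoubleModel m) M] :=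
  Π x : M, TangentSpace 𝓘(ℝ, DoubleModel m) x

/-- `v(f)`, the derivative of the function `f` along the tangent vector `v` at `x`. -/
def dirDeriv (f : M → ℝ) (x : M) (v : TangentSpace 𝓘(ℝ, DoubleModel m) x) : ℝ :=
  mvfderiv 𝓘(ℝ, DoubleModel m) f x v

variable [IsManifold 𝓘(ℝ, DoubleModel m) ∞ M]

/-- Smooth vector fields on `M`. -/
def IsSmoothVF (X : VField m M) : Prop :=
  ContMDiff 𝓘(ℝ, DoubleModel m) 𝓘(ℝ, DoubleModel m).tangent ∞
    (fun x => (⟨x, X x⟩ : TangentBundle 𝓘(ℝ, DoubleModel m) M))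

/-- A linear connection on `TM`; `∇ Y x v` is `∇_v Y` for `v` tangent to `M` at `x`. -/
abbrev Conn (m : ℕ) (M : Type*) [TopologicalSpace M] [ChartedSpace (DoubleModel m) M]
    [IsManifold 𝓘(ℝ, DoubleModel m) ∞ M] :=
  CovariantDerivative 𝓘(ℝ, DoubleModel m) (DoubleModel m)
    (TangentSpace 𝓘(ℝ, DoubleModel m) : M → Type)

/-- Two connections are the same if they give the same covariant derivatives of the smooth vector
fields (the values of a `CovariantDerivative` on non-differentiable fields carry no meaning). -/
def Conn.Same (D D' : Conn m M) : Prop := ∀ Y : VField m M, IsSmoothVF Y → ∀ x, D Y x = D' Y x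

/-- The canonical flat connection `∇⁰`, for which the `∂/∂xⁱ`, `∂/∂x̃ᵢ` of the distinguished
charts are parallel: `flatD Y x v` is the derivative along `v` of the components of `Y` in the
distinguished chart at `x`. -/
def flatD (Y : VField m M) (x : M) (v : TangentSpace 𝓘(ℝ, DoubleModel m) x) :
    TangentSpace 𝓘(ℝ, DoubleModel m) x :=
  ofComps x (mvfderiv 𝓘(ℝ, DoubleModel m)
    (fun y => (trivializationAt (DoubleModel m)
      (TangentSpace 𝓘(ℝ, DoubleModel m) : M → Type) x ⟨y, Y y⟩).2) x v)

/-- The product `X ∧_D Y` of a connection: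
`γ(Z, X ∧_D Y) = ½ [γ(X, D_Z Y) - γ(Y, D_Z X)]` for all `Z`. -/
def wedge (D : VField m M → Π x : M, TangentSpace 𝓘(ℝ, DoubleModel m) x →
    TangentSpace 𝓘(ℝ, DoubleModel m) x) (X Y : VField m M) : VField m M :=
  fun x => sharpGam fun v => (1 / 2) * (gam (X x) (D Y x v) - gam (Y x) (D X x v))

/-- The metric `∇⁰`-bracket (C-bracket) `[X, Y]_{∇⁰} = ∇⁰_X Y - ∇⁰_Y X - X ∧_{∇⁰} Y`. -/
def cbr (X Y : VField m M) : VField m M :=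
  fun x => flatD Y x (X x) - flatD X x (Y x) - wedge flatD X Y x

/-- The modified bracket `[X, Y]_{∇⁰}^∇ = [X, Y]_{∇⁰} + X ∧_∇ Y`. -/
def modBr (D : Conn m M) (X Y : VField m M) : VField m M :=
  fun x => cbr X Y x + wedge (fun Y x v => D Y x v) X Y x

/-- The modified torsion `T^∇(X, Y) = ∇_X Y - ∇_Y X - [X, Y]_{∇⁰}^∇`. -/
def modTorsion (D : Conn m M) (X Y : VField m M) : VField m M :=
  fun x => D Y x (X x) - D X x (Y x) - modBr D X Y x

/-- The Gualtieri torsion `γ(T^∇(X, Y), Z)`, as a function on `M`. -/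
def gTorsion (D : Conn m M) (X Y Z : VField m M) (x : M) : ℝ := gam (modTorsion D X Y x) (Z x)

/-- The Gualtieri torsion of `D` is zero. -/
def ZeroGTorsion (D : Conn m M) : Prop :=
  ∀ X Y Z : VField m M, IsSmoothVF X → IsSmoothVF Y → IsSmoothVF Z → ∀ x, gTorsion D X Y Z x = 0

/-- `γ(D_X Y, Z) + γ(D_Y Z, X) + γ(D_Z X, Y)`. -/
def cycSum (D : Conn m M) (X Y Z : VField m M) (x : M) : ℝ :=
  gam (D Y x (X x)) (Z x) + gam (D Z x (Y x)) (X x) + gam (D X x (Z x)) (Y x)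

/-- `γ([X,Y]_{∇⁰}, Z) + γ([Y,Z]_{∇⁰}, X) + γ([X,Z]_{∇⁰}, Y)
  - ½ [X(γ(Y,Z)) - Y(γ(Z,X)) - 3 Z(γ(X,Y))]`. -/
def cycBracket (X Y Z : VField m M) (x : M) : ℝ :=
  gam (cbr X Y x) (Z x) + gam (cbr Y Z x) (X x) + gam (cbr X Z x) (Y x)
    - (1 / 2) * (dirDeriv (fun y => gam (Y y) (Z y)) x (X x)
      - dirDeriv (fun y => gam (Z y) (X y)) x (Y x)
      - 3 * dirDeriv (fun y => gam (X y) (Y y)) x (Z x))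

/-- The covariant deformation `Ψ(X, Y, Z) = γ(Θ(X, Y), Z)`, where `Θ(X, Y) = D_X Y - D'_X Y`. -/
def covDef (D D' : Conn m M) (X Y Z : VField m M) (x : M) : ℝ :=
  gam (D Y x (X x) - D' Y x (X x)) (Z x)

/-- `A` is totally skew symmetric (in its smooth vector field arguments). -/
def TotallySkew (A : VField m M → VField m M → VField m M → M → ℝ) : Prop :=
  ∀ X Y Z : VField m M, IsSmoothVF X → IsSmoothVF Y → IsSmoothVF Z → ∀ x,
    A Y X Z x = -A X Y Z x ∧ A X Z Y x = -A X Y Z x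

/-- The alternation of a three-covariant tensor. -/
def alt3 (A : VField m M → VField m M → VField m M → M → ℝ) (X Y Z : VField m M) (x : M) : ℝ :=
  (1 / 6) * (A X Y Z x + A Y Z X x + A Z X Y x - A Y X Z x - A X Z Y x - A Z Y X x)

/-- The equation
`3 Alt Ψ (X,Y,Z) = γ([X,Y]_{∇⁰},Z) + γ([Y,Z]_{∇⁰},X) + γ([X,Z]_{∇⁰},Y)
  - ½ [X(γ(Y,Z)) - Y(γ(Z,X)) - 3 Z(γ(X,Y))] - [γ(D'_X Y,Z) + γ(D'_Y Z,X) + γ(D'_Z X,Y)]`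
for the covariant deformation `Ψ` of `D - D'`. -/
def DeformationEq (D D' : Conn m M) : Prop :=
  ∀ X Y Z : VField m M, IsSmoothVF X → IsSmoothVF Y → IsSmoothVF Z → ∀ x,
    3 * alt3 (covDef D D') X Y Z x = cycBracket X Y Z x - cycSum D' X Y Z x

end Canonical

/-- A field `(g, B)`: a non degenerate metric `g` and a `2`-form `B` on `L`, both seen as tensor
fields on `M` which vanish if one of the arguments is in `L̃`. -/
structure DoubleField (m : ℕ) (M : Type*) [TopologicalSpace M] [ChartedSpace (DoubleModel m) M]
    [IsManifold 𝓘(ℝ, DoubleModel m) ∞ M] where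
  g : Π x : M, TangentSpace 𝓘(ℝ, DoubleModel m) x →L[ℝ]
    TangentSpace 𝓘(ℝ, DoubleModel m) x →L[ℝ] ℝ
  B : Π x : M, TangentSpace 𝓘(ℝ, DoubleModel m) x →L[ℝ]
    TangentSpace 𝓘(ℝ, DoubleModel m) x →L[ℝ] ℝ
  smooth_g : ContMDiff 𝓘(ℝ, DoubleModel m)
    (𝓘(ℝ, DoubleModel m).prod 𝓘(ℝ, DoubleModel m →L[ℝ] DoubleModel m →L[ℝ] ℝ)) ∞
    (fun x => Bundle.TotalSpace.mk' (DoubleModel m →L[ℝ] DoubleModel m →L[ℝ] ℝ) x (g x))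
  smooth_B : ContMDiff 𝓘(ℝ, DoubleModel m)
    (𝓘(ℝ, DoubleModel m).prod 𝓘(ℝ, DoubleModel m →L[ℝ] DoubleModel m →L[ℝ] ℝ)) ∞
    (fun x => Bundle.TotalSpace.mk' (DoubleModel m →L[ℝ] DoubleModel m →L[ℝ] ℝ) x (B x))
  symm_g : ∀ x v w, g x v w = g x w v
  skew_B : ∀ x v w, B x v w = -B x w v
  g_leafLt : ∀ x, ∀ v ∈ leafLt x, ∀ w, g x v w = 0
  B_leafLt : ∀ x, ∀ v ∈ leafLt x, ∀ w, B x v w = 0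
  nondeg_g : ∀ x, ∀ v ∈ leafL x, (∀ w ∈ leafL x, g x v w = 0) → v = 0

namespace DoubleField

variable {m : ℕ} {M : Type*} [TopologicalSpace M] [ChartedSpace (DoubleModel m) M]
  [IsManifold 𝓘(ℝ, DoubleModel m) ∞ M] (φ : DoubleField m M)

/-- The sum `g + B` is a non degenerate bilinear form on `L` (equivalently, so is `g - B`). -/
def SumNondegenerate : Prop :=
  ∀ x, ∀ v ∈ leafL x, (∀ w ∈ leafL x, φ.g x v w + φ.B x v w = 0) → v = 0

/-- The injections `ι_± : L → TM`, `ι_± v = v + ♯_γ ♭_{B ± g} v` (with `ε = ±1`), where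
`♭_{B ± g} v = (B ± g)(v, ·)`. -/
def iota (ε : ℝ) {x : M} (v : TangentSpace 𝓘(ℝ, DoubleModel m) x) :
    TangentSpace 𝓘(ℝ, DoubleModel m) x :=
  v + sharpGam fun w => φ.B x v w + ε * φ.g x v w

/-- The bundles `S_±`, the images of `ι_±` (with `ε = ±1`). -/
def bundleS (ε : ℝ) (x : M) : Set (TangentSpace 𝓘(ℝ, DoubleModel m) x) :=
  φ.iota ε '' leafL x

/-- The matrix `g(∂/∂xⁱ, ∂/∂xʲ)` of `g` on `L`. -/
def gMat (x : M) : Matrix (Fin m) (Fin m) ℝ := Matrix.of fun i j => φ.g x (dX x i) (dX x j)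

/-- `♯_g : L* → L`, the inverse of `♭_g`. -/
def sharpG {x : M} (α : TangentSpace 𝓘(ℝ, DoubleModel m) x → ℝ) :
    TangentSpace 𝓘(ℝ, DoubleModel m) x :=
  ofComps x (((φ.gMat x)⁻¹).mulVec fun i => α (dX x i), 0)

/-- The projection of `TM = S_+ ⊕ S_-` onto `S_±` (with `ε = ±1`): for `v = X + ♯_γ α` with
`X ∈ L` and `α ∈ L*`, it is `ι_± (½ [X ∓ ♯_g (♭_B X - α)])`. -/
def prS (ε : ℝ) {x : M} (v : TangentSpace 𝓘(ℝ, DoubleModel m) x) :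
    TangentSpace 𝓘(ℝ, DoubleModel m) x :=
  φ.iota ε ((1 / 2 : ℝ) • (prL v - ε • φ.sharpG fun w => φ.B x (prL v) w - gam v w))

/-- The generalized metric `ℋ` of the field: `ℋ = ±γ` on `S_±` and `S_+ ⊥ S_-`. -/
def genMetric {x : M} (v w : TangentSpace 𝓘(ℝ, DoubleModel m) x) : ℝ :=
  gam (φ.prS 1 v) (φ.prS 1 w) - gam (φ.prS (-1) v) (φ.prS (-1) w)

/-- A double-metric connection: a smooth connection on `TM` which preserves `γ` and `ℋ`. -/
structure IsDoubleMetric (D : Conn m M) : Prop where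
  smooth : CovariantDerivative.ContMDiffCovariantDerivative D ∞
  preserves_gam : ∀ X Y Z : VField m M, IsSmoothVF X → IsSmoothVF Y → IsSmoothVF Z → ∀ x,
    dirDeriv (fun y => gam (X y) (Y y)) x (Z x)
      = gam (D X x (Z x)) (Y x) + gam (X x) (D Y x (Z x))
  preserves_genMetric :
    ∀ X Y Z : VField m M, IsSmoothVF X → IsSmoothVF Y → IsSmoothVF Z → ∀ x,
    dirDeriv (fun y => φ.genMetric (X y) (Y y)) x (Z x)
      = φ.genMetric (D X x (Z x)) (Y x) + φ.genMetric (X x) (D Y x (Z x))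

/-- The connections `D^±` on `L` determined by a double-metric connection `D`
(with `ε = ±1`): `D_Z (ι_± Y) = ι_± (D^±_Z Y)` for `Y` in `L`. -/
def restr (ε : ℝ) (D : Conn m M) (Y : VField m M) (x : M)
    (v : TangentSpace 𝓘(ℝ, DoubleModel m) x) : TangentSpace 𝓘(ℝ, DoubleModel m) x :=
  prL (D (fun y => φ.iota ε (Y y)) x v)

/-- A smooth section of `L`. -/
def IsSectionL (Y : VField m M) : Prop := IsSmoothVF Y ∧ ∀ x, Y x ∈ leafL x

/-- A smooth section of `S_±` (with `ε = ±1`). -/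
def IsSectionS (ε : ℝ) (Y : VField m M) : Prop := IsSmoothVF Y ∧ ∀ x, Y x ∈ φ.bundleS ε x

/-- The partial connection `D` on `L` along the leaves of `L` is the Levi-Civita connection of the
metric `g` of the leaves: it preserves `g` and its torsion is zero. -/
def IsLeviCivitaL (D : VField m M → Π x : M, TangentSpace 𝓘(ℝ, DoubleModel m) x →
    TangentSpace 𝓘(ℝ, DoubleModel m) x) : Prop :=
  (∀ X Y Z : VField m M, IsSectionL X → IsSectionL Y → IsSectionL Z → ∀ x,
    dirDeriv (fun y => φ.g y (X y) (Y y)) x (Z x)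
      = φ.g x (D X x (Z x)) (Y x) + φ.g x (X x) (D Y x (Z x))) ∧
  (∀ X Y : VField m M, IsSectionL X → IsSectionL Y → ∀ x,
    D Y x (X x) - D X x (Y x) = VectorField.mlieBracket 𝓘(ℝ, DoubleModel m) X Y x)

/-- A CWT (canonical with torsion) connection of the field: a double-metric connection with zero
mixed Gualtieri torsion such that each of the two connections `D^±` on `L`, restricted to the
arguments in `L`, is the Levi-Civita connection of `g`. -/
structure IsCWT (D : Conn m M) : Prop where
  doubleMetric : φ.IsDoubleMetric D
  mixed_plus : ∀ X Y Z : VField m M,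
    φ.IsSectionS (-1) X → φ.IsSectionS 1 Y → φ.IsSectionS 1 Z → ∀ x, gTorsion D X Y Z x = 0
  mixed_minus : ∀ X Y Z : VField m M,
    φ.IsSectionS 1 X → φ.IsSectionS (-1) Y → φ.IsSectionS (-1) Z → ∀ x, gTorsion D X Y Z x = 0
  leviCivita_plus : φ.IsLeviCivitaL (φ.restr 1 D)
  leviCivita_minus : φ.IsLeviCivitaL (φ.restr (-1) D)

/-- The expression, for sections `X, Y, Z` of `L` and `ε = ±1`,
`± g(pr_L pr_{S_±} [ι_± X, ι_± Y]_{∇⁰}, Z) ± g(pr_L pr_{S_±} [ι_± Y, ι_± Z]_{∇⁰}, X)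
  ± g(pr_L pr_{S_±} [ι_± X, ι_± Z]_{∇⁰}, Y)
  ∓ ½ [(ι_± X)(g(Y,Z)) - (ι_± Y)(g(Z,X)) - 3 (ι_± Z)(g(X,Y))]
  ∓ [g(D^±_{ι_± X} Y, Z) + g(D^±_{ι_± Y} Z, X) + g(D^±_{ι_± Z} X, Y)]`. -/
def leafExpr (ε : ℝ) (D : Conn m M) (X Y Z : VField m M) (x : M) : ℝ :=
  let i : VField m M → VField m M := fun W y => φ.iota ε (W y)
  let br : VField m M → VField m M → TangentSpace 𝓘(ℝ, DoubleModel m) x :=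
    fun U V => prL (φ.prS ε (cbr (i U) (i V) x))
  ε * (φ.g x (br X Y) (Z x) + φ.g x (br Y Z) (X x) + φ.g x (br X Z) (Y x))
    - ε * (1 / 2) * (dirDeriv (fun y => φ.g y (Y y) (Z y)) x (i X x)
      - dirDeriv (fun y => φ.g y (Z y) (X y)) x (i Y x)
      - 3 * dirDeriv (fun y => φ.g y (X y) (Y y)) x (i Z x))
    - ε * (φ.g x (φ.restr ε D Y x (i X x)) (Z x) + φ.g x (φ.restr ε D Z x (i Y x)) (X x)
      + φ.g x (φ.restr ε D X x (i Z x)) (Y x))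

/-- The deformation equations on `L`: `3 Alt ψ^±(X,Y,Z)` is the expression `leafExpr`, where
`ψ^±(X,Y,Z) = ½ Ψ(ι_± X, ι_± Y, ι_± Z)` for the covariant deformation `Ψ` of `D - D'`. -/
def LeafDeformationEq (D D' : Conn m M) : Prop :=
  ∀ ε : ℝ, ε = 1 ∨ ε = -1 → ∀ X Y Z : VField m M,
    IsSectionL X → IsSectionL Y → IsSectionL Z → ∀ x,
    3 * alt3 (fun X Y Z x => (1 / 2) * covDef D D' (fun y => φ.iota ε (X y))
      (fun y => φ.iota ε (Y y)) (fun y => φ.iota ε (Z y)) x) X Y Z x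
      = φ.leafExpr ε D' X Y Z x

end DoubleField

end DoubleManifold

end

open scoped Manifold ContDiff Topology

noncomputable section

/-! Everything is compared with `∇⁰`. Distinguished coordinate changes have locally constant block
matrices preserving the pairing `γ`, so near each point there is a `∇⁰`-parallel frame in which `γ`
is constant; hence `∇⁰` preserves `γ`, `L` and `L̃`. For a connection `D` preserving `γ`, metric
compatibility turns the Gualtieri torsion into `cycSum D - cycBracket`
(`gTorsion_eq_cycSum_sub_cycBracket`), which is the characterization of zero torsion. As `∇⁰` has
zero torsion by the very definition of the bracket, `cycBracket` is the cyclic sum of `∇⁰`. So the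
torsion is the cyclic sum of the tensor `γ((D - ∇⁰)_u v, w)`, and it is totally skew because that
tensor is skew in `v, w` (`gTorsion_eq_torsionTensor`, `torsionTensor_skew`).

VTC connection. For a totally skew deformation `Ψ`, `3 Alt Ψ = 3Ψ` is the difference of the two
cyclic sums (`three_mul_alt3_covDef`), so zero torsion determines `Ψ` and is equivalent to
`DeformationEq`. The solution is `Ψ = -T₁/3`, with `T₁` the torsion of the CWT connection. Adding it
keeps the connection double-metric: that requires `T₁(·, S_+, S_-) = 0`, and this is the vanishing
of the mixed torsion.

Equations on `L`. Of three vectors in `S_+ ∪ S_-` two lie in the same bundle. On a mixed triple the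
torsions of `D` and of the CWT connection agree, so vanish; only the triples inside `S_+` or inside
`S_-` remain, and there `γ = ±2g` through `ι_±` (`deformationEq_iff_leaf`).

CWT connection. Non degeneracy of `g + B` means that `L` is a complement of both `S_+` and `S_-`.
The `S_±` block of a double-metric connection is therefore known once it is known in the directions
of `S_∓`, where the mixed torsion fixes it, and in those of `L`, where the Levi-Civita condition
fixes it. Existence corrects a projected flat connection by `cwtTensor` (`exists_isCWT`); uniqueness
runs through the same splitting (`same_of_isCWT`). -/

namespace DoubleManifold

set_option linter.unusedSectionVars false

open Bundle Filter

/-! ### Linear algebra of `γ`, `L` and `L̃` on one tangent space. -/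

section Pointwise

variable {m : ℕ} {M : Type*} [TopologicalSpace M] [ChartedSpace (DoubleModel m) M] {x : M}

/-- Together with the Hausdorff instance below, this lets `LinearMap.toContinuousLinearMap` be
applied on tangent spaces. -/
instance (x : M) : FiniteDimensional ℝ (TangentSpace 𝓘(ℝ, DoubleModel m) x) :=
  inferInstanceAs (FiniteDimensional ℝ (DoubleModel m))

instance (x : M) : T2Space (TangentSpace 𝓘(ℝ, DoubleModel m) x) :=
  inferInstanceAs (T2Space (DoubleModel m))

/-- The model of the neutral metric `γ`, as a continuous bilinear form. -/
def modelGam (m : ℕ) : DoubleModel m →L[ℝ] DoubleModel m →L[ℝ] ℝ :=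
  LinearMap.toContinuousLinearMap <| LinearMap.toContinuousLinearMap.toLinearMap ∘ₗ
    LinearMap.mk₂ ℝ (fun v w => v.1 ⬝ᵥ w.2 + v.2 ⬝ᵥ w.1)
      (fun _ _ _ => by simp [add_dotProduct]; ring) (fun _ _ _ => by simp [smul_dotProduct]; ring)
      (fun _ _ _ => by simp [dotProduct_add]; ring) (fun _ _ _ => by simp [dotProduct_smul]; ring)

lemma modelGam_apply (v w : DoubleModel m) : modelGam m v w = v.1 ⬝ᵥ w.2 + v.2 ⬝ᵥ w.1 := rfl

lemma gam_comm (v w : TangentSpace 𝓘(ℝ, DoubleModel m) x) : gam v w = gam w v := by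
  simp only [gam, dotProduct_comm, add_comm]

variable (u v w : TangentSpace 𝓘(ℝ, DoubleModel m) x) (c : ℝ)

/-- `γ` as a bilinear form. -/
def gamBilin (x : M) : TangentSpace 𝓘(ℝ, DoubleModel m) x →ₗ[ℝ]
    TangentSpace 𝓘(ℝ, DoubleModel m) x →ₗ[ℝ] ℝ :=
  LinearMap.mk₂ ℝ gam
    (fun _ _ w => DFunLike.congr_fun (map_add (modelGam m) _ _) (comps w))
    (fun _ _ w => DFunLike.congr_fun (map_smul (modelGam m) _ _) (comps w))
    (fun _ _ _ => map_add (modelGam m _) _ _)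
    (fun _ _ _ => map_smul (modelGam m _) _ _)

lemma gamBilin_apply : gamBilin x v w = gam v w := rfl

@[simp] lemma gam_add_left : gam (u + v) w = gam u w + gam v w := by
  simp [← gamBilin_apply]
@[simp] lemma gam_add_right : gam u (v + w) = gam u v + gam u w := by
  simp [← gamBilin_apply]
@[simp] lemma gam_sub_left : gam (u - v) w = gam u w - gam v w := by
  simp [← gamBilin_apply]
@[simp] lemma gam_sub_right : gam u (v - w) = gam u v - gam u w := by
  simp [← gamBilin_apply]
@[simp] lemma gam_neg_right : gam v (-w) = -gam v w := by
  simp [← gamBilin_apply]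
@[simp] lemma gam_smul_left : gam (c • v) w = c * gam v w := by
  simp [← gamBilin_apply]
@[simp] lemma gam_smul_right : gam v (c • w) = c * gam v w := by
  simp [← gamBilin_apply]
@[simp] lemma gam_zero_left : gam 0 w = 0 := by
  simp [← gamBilin_apply]
@[simp] lemma gam_zero_right : gam w 0 = 0 := by
  simp [← gamBilin_apply]
lemma gam_sum_left {ι : Type*} (s : Finset ι) (f : ι → TangentSpace 𝓘(ℝ, DoubleModel m) x) :
    gam (∑ i ∈ s, f i) w = ∑ i ∈ s, gam (f i) w := by
  simp [← gamBilin_apply]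
variable {u v w}

lemma gam_dXt (v : TangentSpace 𝓘(ℝ, DoubleModel m) x) (i : Fin m) :
    gam v (dXt x i) = (comps v).1 i := by
  simp [gam, dXt, comps, ofComps]

lemma gam_dX (v : TangentSpace 𝓘(ℝ, DoubleModel m) x) (i : Fin m) :
    gam v (dX x i) = (comps v).2 i := by
  simp [gam, dX, comps, ofComps]

lemma eq_of_forall_gam (h : ∀ z, gam v z = gam w z) : v = w := by
  refine Prod.ext (funext fun i => ?_) (funext fun i => ?_)
  · exact (gam_dXt v i).symm.trans ((h _).trans (gam_dXt w i))
  · exact (gam_dX v i).symm.trans ((h _).trans (gam_dX w i))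

lemma eq_sum_dX_add_sum_dXt (v : TangentSpace 𝓘(ℝ, DoubleModel m) x) :
    v = ∑ i, (comps v).1 i • dX x i + ∑ i, (comps v).2 i • dXt x i := by
  refine eq_of_forall_gam fun z => ?_
  rw [gam_add_left, gam_sum_left, gam_sum_left]
  simp only [gam_smul_left, gam_comm (dX x _) z, gam_comm (dXt x _) z, gam_dX, gam_dXt]
  simp only [gam, dotProduct]

lemma eq_sum_dX_of_mem_leafL (hv : v ∈ leafL x) : v = ∑ i, (comps v).1 i • dX x i := by
  conv_lhs => rw [eq_sum_dX_add_sum_dXt v]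
  have : (comps v).2 = 0 := hv
  simp [this]

lemma gam_sharpGam {α : TangentSpace 𝓘(ℝ, DoubleModel m) x → ℝ} (hα : IsLinearMap ℝ α)
    (v : TangentSpace 𝓘(ℝ, DoubleModel m) x) : gam (sharpGam α) v = α v := by
  have : α v = hα.mk' α v := rfl
  rw [this]
  conv_rhs => rw [eq_sum_dX_add_sum_dXt v]
  rw [map_add, map_sum, map_sum]
  simp only [map_smul, IsLinearMap.mk'_apply, smul_eq_mul]
  simp [sharpGam, gam, comps, ofComps, dotProduct, mul_comm, add_comm]

lemma dXt_mem_leafLt (i : Fin m) : dXt x i ∈ leafLt x := rfl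

lemma prL_mem (v : TangentSpace 𝓘(ℝ, DoubleModel m) x) : prL v ∈ leafL x := rfl

lemma prL_eq_self (hv : v ∈ leafL x) : prL v = v :=
  Prod.ext rfl (Eq.symm hv)

lemma prL_eq_zero (hv : v ∈ leafLt x) : prL v = 0 :=
  Prod.ext hv rfl

lemma sub_prL_mem (v : TangentSpace 𝓘(ℝ, DoubleModel m) x) : v - prL v ∈ leafLt x :=
  sub_self (comps v).1

/-- `leafL x` as a submodule. -/
def leafLSub (x : M) : Submodule ℝ (TangentSpace 𝓘(ℝ, DoubleModel m) x) where
  carrier := leafL x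
  add_mem' {a b} ha hb := by
    change (comps a).2 + (comps b).2 = 0
    rw [show (comps a).2 = 0 from ha, show (comps b).2 = 0 from hb, add_zero]
  zero_mem' := rfl
  smul_mem' c a ha := by
    change c • (comps a).2 = 0
    rw [show (comps a).2 = 0 from ha, smul_zero]

lemma add_mem_leafL (hu : u ∈ leafL x) (hv : v ∈ leafL x) : u + v ∈ leafL x :=
  (leafLSub x).add_mem hu hv
lemma sub_mem_leafL (hu : u ∈ leafL x) (hv : v ∈ leafL x) : u - v ∈ leafL x :=
  (leafLSub x).sub_mem hu hv
lemma smul_mem_leafL (hu : u ∈ leafL x) : c • u ∈ leafL x :=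
  (leafLSub x).smul_mem c hu

lemma gam_leafL_leafL (hu : u ∈ leafL x) (hv : v ∈ leafL x) : gam u v = 0 := by
  have h1 : (comps u).2 = 0 := hu
  have h2 : (comps v).2 = 0 := hv
  simp [gam, h1, h2]

lemma gam_leafLt_leafLt (hu : u ∈ leafLt x) (hv : v ∈ leafLt x) : gam u v = 0 := by
  have h1 : (comps u).1 = 0 := hu
  have h2 : (comps v).1 = 0 := hv
  simp [gam, h1, h2]

lemma isLinearMap_prL : IsLinearMap ℝ (prL : TangentSpace 𝓘(ℝ, DoubleModel m) x → _) where
  map_add _ _ := Prod.ext rfl (add_zero _).symm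
  map_smul c _ := Prod.ext rfl (smul_zero c).symm

/-- Both foliations are isotropic, so the `γ`-adjoint of the projection onto `L` is the projection
onto `L̃`. -/
lemma gam_prL_left (v w : TangentSpace 𝓘(ℝ, DoubleModel m) x) :
    gam (prL v) w = gam v (w - prL w) := by
  have h1 : (comps (w - prL w)).1 = 0 := sub_self (comps w).1
  have h2 : (comps (w - prL w)).2 = (comps w).2 := sub_zero (comps w).2
  have h3 : (comps (prL v)).2 = 0 := rfl
  have h4 : (comps (prL v)).1 = (comps v).1 := rfl
  simp [gam, h1, h2, h3, h4]

end Pointwise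

/-! ### Changes of distinguished coordinates. -/

section CoordChange

variable {m : ℕ} {M : Type*} [TopologicalSpace M] [ChartedSpace (DoubleModel m) M]
  [IsManifold 𝓘(ℝ, DoubleModel m) ∞ M]

/-- The linear map with diagonal blocks `α`, `β`. -/
def blockDiag (α β : Matrix (Fin m) (Fin m) ℝ) : DoubleModel m →L[ℝ] DoubleModel m :=
  (LinearMap.toContinuousLinearMap α.mulVecLin).prodMap
    (LinearMap.toContinuousLinearMap β.mulVecLin)

lemma blockDiag_apply (α β : Matrix (Fin m) (Fin m) ℝ) (v : DoubleModel m) :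
    blockDiag α β v = (α.mulVec v.1, β.mulVec v.2) := rfl

/-- The condition `αᵀ β = 1` says precisely that the pairing of the two factors is preserved. -/
lemma modelGam_blockDiag {α β : Matrix (Fin m) (Fin m) ℝ} (h : α.transpose * β = 1)
    (v w : DoubleModel m) : modelGam m (blockDiag α β v) (blockDiag α β w) = modelGam m v w := by
  have key (a b : Fin m → ℝ) : α.mulVec a ⬝ᵥ β.mulVec b = a ⬝ᵥ b := by
    rw [Matrix.dotProduct_mulVec, ← Matrix.mulVec_transpose, Matrix.mulVec_mulVec]
    have : β.transpose * α = 1 := by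
      rw [← Matrix.transpose_one, ← h, Matrix.transpose_mul, Matrix.transpose_transpose]
    rw [this, Matrix.one_mulVec]
  simp only [modelGam_apply, blockDiag_apply, key]
  rw [dotProduct_comm (β.mulVec _), key, dotProduct_comm w.1]

variable [DoubleManifold m M]

lemma exists_tangentCoordChange_eq_blockDiag {x y z : M}
    (hx : z ∈ (chartAt (DoubleModel m) x).source) (hy : z ∈ (chartAt (DoubleModel m) y).source) :
    ∃ α β : Matrix (Fin m) (Fin m) ℝ, α.transpose * β = 1 ∧
      ∀ᶠ z' in 𝓝 z, tangentCoordChange 𝓘(ℝ, DoubleModel m) x y z' = blockDiag α β := by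
  set e := chartAt (DoubleModel m) x
  set e' := chartAt (DoubleModel m) y
  obtain ⟨α, β, a, b, hαβ, h⟩ := DoubleManifold.transition e (chart_mem_atlas _ x) e'
    (chart_mem_atlas _ y) (e z) (by simp [e.map_source hx, e.left_inv hx, hy])
  refine ⟨α, β, hαβ, ?_⟩
  -- The affine formula is needed on a whole neighbourhood of each nearby point, since it is
  -- differentiated there.
  have h' := (e.continuousAt hx).eventually h.eventually_nhds
  filter_upwards [h'] with z' hz'
  rw [tangentCoordChange_def]
  simp only [modelWithCornersSelf_coe, Set.range_id, fderivWithin_univ]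
  have : HasFDerivAt (fun v => blockDiag α β v + (a, b)) (blockDiag α β) (e z') :=
    (blockDiag α β).hasFDerivAt.add_const _
  refine (this.congr_of_eventuallyEq ?_).fderiv
  filter_upwards [hz'] with v hv
  simpa [blockDiag_apply] using hv

end CoordChange

/-! ### Fields with constant coefficients and flat frames. -/

section Frame

variable {m : ℕ} {M : Type*} [TopologicalSpace M] [ChartedSpace (DoubleModel m) M]
  [IsManifold 𝓘(ℝ, DoubleModel m) ∞ M]

/-- The components of a vector field in the distinguished chart at `x₀`. -/
def locComps (x₀ : M) (X : VField m M) (y : M) : DoubleModel m :=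
  (trivializationAt (DoubleModel m)
    (TangentSpace 𝓘(ℝ, DoubleModel m) : M → Type) x₀ ⟨y, X y⟩).2

/-- The vector field with constant components `c` in the distinguished chart at `x₀`. -/
def constField (x₀ : M) (c : DoubleModel m) : VField m M := fun y =>
  (trivializationAt (DoubleModel m)
    (TangentSpace 𝓘(ℝ, DoubleModel m) : M → Type) x₀).symmL ℝ y c

lemma locComps_eq_tangentCoordChange (x₀ y : M) (X : VField m M) :
    locComps x₀ X y = tangentCoordChange 𝓘(ℝ, DoubleModel m) y x₀ y (comps (X y)) := rfl

lemma constField_eq_tangentCoordChange {x₀ y : M}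
    (hy : y ∈ (chartAt (DoubleModel m) x₀).source) (c : DoubleModel m) :
    constField x₀ c y = tangentCoordChange 𝓘(ℝ, DoubleModel m) x₀ y y c := by
  rw [constField, TangentBundle.symmL_trivializationAt_eq_core hy]
  rfl

lemma locComps_self (x : M) (X : VField m M) : locComps x X x = comps (X x) :=
  tangentCoordChange_self (mem_extChartAt_source x)

lemma flatD_eq (X : VField m M) (x : M) (v : TangentSpace 𝓘(ℝ, DoubleModel m) x) :
    flatD X x v = ofComps x (mvfderiv 𝓘(ℝ, DoubleModel m) (locComps x X) x v) := rfl

lemma locComps_constField {x₀ y z : M} (hx : z ∈ (chartAt (DoubleModel m) x₀).source)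
    (hy : z ∈ (chartAt (DoubleModel m) y).source) (c : DoubleModel m) :
    locComps y (constField x₀ c) z = tangentCoordChange 𝓘(ℝ, DoubleModel m) x₀ y z c := by
  rw [locComps_eq_tangentCoordChange, constField_eq_tangentCoordChange hx]
  exact tangentCoordChange_comp (by simp [hx, hy])

lemma mvfderiv_congr {E : Type*} [NormedAddCommGroup E] [NormedSpace ℝ E] {f g : M → E} {x : M}
    (h : f =ᶠ[𝓝 x] g) :
    mvfderiv 𝓘(ℝ, DoubleModel m) f x = mvfderiv 𝓘(ℝ, DoubleModel m) g x := by
  rw [mvfderiv, mvfderiv, h.mfderiv_eq, h.self_of_nhds]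

variable [DoubleManifold m M]

/-- `gam` at `y` reads components in the preferred chart at `y`, which varies with `y`. Here one
chart serves a whole neighbourhood, so that `γ` becomes a constant bilinear form that can be
differentiated. -/
lemma gam_eq_locComps {x₀ y : M} (hy : y ∈ (chartAt (DoubleModel m) x₀).source)
    (X Y : VField m M) : gam (X y) (Y y) = modelGam m (locComps x₀ X y) (locComps x₀ Y y) := by
  obtain ⟨α, β, h, h'⟩ := exists_tangentCoordChange_eq_blockDiag
    (mem_chart_source (DoubleModel m) y) hy
  rw [locComps_eq_tangentCoordChange, locComps_eq_tangentCoordChange, h'.self_of_nhds,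
    modelGam_blockDiag h]
  rfl

lemma gam_constField {x₀ y : M} (hy : y ∈ (chartAt (DoubleModel m) x₀).source)
    (c d : DoubleModel m) :
    gam (constField x₀ c y) (constField x₀ d y) = modelGam m c d := by
  obtain ⟨α, β, h, h'⟩ := exists_tangentCoordChange_eq_blockDiag hy
    (mem_chart_source (DoubleModel m) y)
  rw [constField_eq_tangentCoordChange hy, constField_eq_tangentCoordChange hy, h'.self_of_nhds,
    ← modelGam_blockDiag h]
  rfl

lemma constField_mem_leafL {x₀ y : M} (hy : y ∈ (chartAt (DoubleModel m) x₀).source)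
    (c : Fin m → ℝ) : constField x₀ (c, 0) y ∈ leafL y := by
  obtain ⟨α, β, h, h'⟩ := exists_tangentCoordChange_eq_blockDiag hy
    (mem_chart_source (DoubleModel m) y)
  rw [constField_eq_tangentCoordChange hy, h'.self_of_nhds]
  exact β.mulVec_zero

lemma constField_mem_leafLt {x₀ y : M} (hy : y ∈ (chartAt (DoubleModel m) x₀).source)
    (c : Fin m → ℝ) : constField x₀ (0, c) y ∈ leafLt y := by
  obtain ⟨α, β, h, h'⟩ := exists_tangentCoordChange_eq_blockDiag hy
    (mem_chart_source (DoubleModel m) y)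
  rw [constField_eq_tangentCoordChange hy, h'.self_of_nhds]
  exact α.mulVec_zero

/-- `flatD` at `y` uses the chart at `y`, not the one at `x₀`; in that chart the components of the
field are still locally constant, because the block matrix of the coordinate change is. -/
lemma flatD_constField {x₀ y : M} (hy : y ∈ (chartAt (DoubleModel m) x₀).source)
    (c : DoubleModel m) (v : TangentSpace 𝓘(ℝ, DoubleModel m) y) :
    flatD (constField x₀ c) y v = 0 := by
  obtain ⟨α, β, h, h'⟩ := exists_tangentCoordChange_eq_blockDiag hy
    (mem_chart_source (DoubleModel m) y)
  have : locComps y (constField x₀ c) =ᶠ[𝓝 y] fun _ => blockDiag α β c := by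
    filter_upwards [h', (chartAt (DoubleModel m) x₀).open_source.mem_nhds hy,
      (chartAt (DoubleModel m) y).open_source.mem_nhds (mem_chart_source _ y)] with z hz h1 h2
    rw [locComps_constField h1 h2, hz]
  rw [flatD_eq, mvfderiv_congr this, mvfderiv_const]
  rfl

lemma locComps_eventuallyEq {X Y : VField m M} {x₀ y : M} (h : ∀ᶠ z in 𝓝 y, X z = Y z) :
    locComps x₀ X =ᶠ[𝓝 y] locComps x₀ Y := by
  filter_upwards [h] with z hz
  rw [locComps, locComps, hz]

lemma flatD_congr {X Y : VField m M} {x : M} (h : ∀ᶠ y in 𝓝 x, X y = Y y) :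
    flatD X x = flatD Y x := by
  funext v
  rw [flatD_eq, flatD_eq, mvfderiv_congr (locComps_eventuallyEq h)]

/-- The standard basis of the coordinate space. -/
def modelBasis : Fin m ⊕ Fin m → DoubleModel m :=
  Sum.elim (fun i => (Pi.single i 1, 0)) (fun i => (0, Pi.single i 1))

lemma modelGam_modelBasis (k l : Fin m ⊕ Fin m) :
    modelGam m (modelBasis k) (modelBasis l) = if l = k.swap then 1 else 0 := by
  rcases k with k | k <;> rcases l with l | l <;>
    simp [modelGam_apply, modelBasis, Pi.single_apply, eq_comm]

/-- The basis vector `γ`-dual to the one of index `k` has index `k.swap`. -/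
lemma modelBasis_expand (v : DoubleModel m) :
    v = ∑ k, modelGam m v (modelBasis k.swap) • modelBasis k := by
  rw [Fintype.sum_sum_type]
  have h1 : ∀ i : Fin m, modelGam m v (modelBasis (Sum.inl i).swap) = v.1 i := by
    intro i; simp [modelGam_apply, modelBasis]
  have h2 : ∀ i : Fin m, modelGam m v (modelBasis (Sum.inr i).swap) = v.2 i := by
    intro i; simp [modelGam_apply, modelBasis]
  simp only [h1, h2]
  ext i <;> simp [modelBasis, Prod.fst_sum, Prod.snd_sum, Finset.sum_apply, Pi.single_apply]

/-- A family of smooth vector fields which, near `x₀`, is the frame `∂/∂xⁱ, ∂/∂x̃ᵢ` of the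
distinguished chart at `x₀`. -/
structure IsFlatFrame (b : Fin m ⊕ Fin m → VField m M) (x₀ : M) : Prop where
  smooth : ∀ k, IsSmoothVF (b k)
  inl_mem : ∀ i x, b (Sum.inl i) x ∈ leafL x
  inr_mem : ∀ i x, b (Sum.inr i) x ∈ leafLt x
  eq_constField : ∀ᶠ y in 𝓝 x₀, ∀ k, b k y = constField x₀ (modelBasis k) y

/-- The field `X` is smooth near `x`. -/
abbrev SmoothVFAt (X : VField m M) (x : M) : Prop :=
  ContMDiffAt 𝓘(ℝ, DoubleModel m) 𝓘(ℝ, DoubleModel m).tangent ∞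
    (fun x => (⟨x, X x⟩ : TangentBundle 𝓘(ℝ, DoubleModel m) M)) x

/-- The field `X` is differentiable at `x`. -/
abbrev DiffVFAt (X : VField m M) (x : M) : Prop :=
  MDifferentiableAt 𝓘(ℝ, DoubleModel m) 𝓘(ℝ, DoubleModel m).tangent
    (fun x => (⟨x, X x⟩ : TangentBundle 𝓘(ℝ, DoubleModel m) M)) x

lemma SmoothVFAt.diff {X : VField m M} {x : M} (h : SmoothVFAt X x) : DiffVFAt X x :=
  h.mdifferentiableAt (by simp)

lemma IsSmoothVF.smoothAt {X : VField m M} (h : IsSmoothVF X) (x : M) : SmoothVFAt X x := h x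

lemma IsSmoothVF.diff {X : VField m M} (h : IsSmoothVF X) (x : M) : DiffVFAt X x :=
  (h.smoothAt x).diff

lemma smoothVFAt_constField (x₀ : M) (c : DoubleModel m) {y : M}
    (hy : y ∈ (chartAt (DoubleModel m) x₀).source) : SmoothVFAt (constField x₀ c) y := by
  rw [SmoothVFAt]
  have hb : y ∈ (trivializationAt (DoubleModel m)
    (TangentSpace 𝓘(ℝ, DoubleModel m) : M → Type) x₀).baseSet := by simpa using hy
  have := (trivializationAt (DoubleModel m)
    (TangentSpace 𝓘(ℝ, DoubleModel m) : M → Type) x₀).contMDiffAt_section_iff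
      (IB := 𝓘(ℝ, DoubleModel m)) (n := ∞) (s := constField x₀ c) hb
  rw [this]
  refine contMDiffAt_const (c := c) |>.congr_of_eventuallyEq ?_
  filter_upwards [(chartAt (DoubleModel m) x₀).open_source.mem_nhds hy] with z hz
  exact (locComps_constField hz hz c).trans (tangentCoordChange_self (by simpa))

variable [T2Space M]

variable (m) in
-- The coordinate frame is cut off by a bump function to become globally defined; the Hausdorff
-- property makes the extension by zero smooth. Multiplying by a function keeps the fields in `L` or
-- `L̃` everywhere.
lemma exists_isFlatFrame (x₀ : M) : ∃ b : Fin m ⊕ Fin m → VField m M, IsFlatFrame b x₀ := by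
  obtain ⟨ρ⟩ : Nonempty (SmoothBumpFunction 𝓘(ℝ, DoubleModel m) x₀) := inferInstance
  refine ⟨fun k y => ρ y • constField x₀ (modelBasis k) y, ?_, ?_, ?_, ?_⟩
  · intro k y
    by_cases hy : y ∈ (chartAt (DoubleModel m) x₀).source
    · exact (ρ.contMDiff y).smul_section (smoothVFAt_constField x₀ _ hy)
    · have : y ∉ tsupport ρ := fun h => hy (ρ.tsupport_subset_chartAt_source h)
      have h0 : SmoothVFAt (fun z => (0 : TangentSpace 𝓘(ℝ, DoubleModel m) z)) y :=
        contMDiff_zeroSection ℝ _ y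
      refine h0.congr_of_eventuallyEq ?_
      filter_upwards [(isClosed_tsupport ρ).isOpen_compl.mem_nhds this] with z hz
      simp [image_eq_zero_of_notMem_tsupport hz]
  · intro i y
    by_cases hy : y ∈ (chartAt (DoubleModel m) x₀).source
    · exact smul_mem_leafL _ (constField_mem_leafL hy _)
    · have : ρ y = 0 := by
        by_contra h
        exact hy (ρ.support_subset_source h)
      simp only [this, zero_smul]
      rfl
  · intro i y
    by_cases hy : y ∈ (chartAt (DoubleModel m) x₀).source
    · have : (comps (constField x₀ (0, Pi.single i 1) y)).1 = 0 := constField_mem_leafLt hy _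
      change ρ y • (comps (constField x₀ (0, Pi.single i 1) y)).1 = 0
      rw [this, smul_zero]
    · have : ρ y = 0 := by
        by_contra h
        exact hy (ρ.support_subset_source h)
      simp only [this, zero_smul]
      rfl
  · filter_upwards [ρ.eventuallyEq_one] with y hy k
    simp [hy]

omit [T2Space M] in
lemma gam_contMDiffAt {X Y : VField m M} {x : M} (hX : SmoothVFAt X x) (hY : SmoothVFAt Y x) :
    ContMDiffAt 𝓘(ℝ, DoubleModel m) 𝓘(ℝ, ℝ) ∞ (fun y => gam (X y) (Y y)) x := by
  rw [SmoothVFAt, contMDiffAt_section] at hX hY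
  have h := (contMDiffAt_const (c := modelGam m)).clm_apply hX |>.clm_apply hY
  refine h.congr_of_eventuallyEq ?_
  filter_upwards [(chartAt (DoubleModel m) x).open_source.mem_nhds (mem_chart_source _ x)] with z hz
  exact gam_eq_locComps hz X Y

lemma IsFlatFrame.expand {b : Fin m ⊕ Fin m → VField m M} {x₀ : M} (hb : IsFlatFrame b x₀) :
    ∀ᶠ y in 𝓝 x₀, ∀ v : TangentSpace 𝓘(ℝ, DoubleModel m) y,
      v = ∑ k, gam v (b k.swap y) • b k y := by
  filter_upwards [hb.eq_constField,
    (chartAt (DoubleModel m) x₀).open_source.mem_nhds (mem_chart_source _ x₀)] with y hy hs v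
  -- Every vector at `y` has constant components `c` in the chart at `x₀`, so the expansion reduces
  -- to the model space.
  obtain ⟨c, rfl⟩ : ∃ c, constField x₀ c y = v := by
    refine ⟨tangentCoordChange 𝓘(ℝ, DoubleModel m) y x₀ y (comps v), ?_⟩
    rw [constField_eq_tangentCoordChange hs]
    have h1 := tangentCoordChange_comp (I := 𝓘(ℝ, DoubleModel m)) (w := y) (x := x₀) (y := y)
      (z := y) (v := comps v) (by simp [hs])
    exact h1.trans (tangentCoordChange_self (by simp))
  conv_lhs => rw [modelBasis_expand c]
  simp only [hy, gam_constField hs]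
  simp only [constField, map_sum, map_smul]

lemma IsFlatFrame.flat {b : Fin m ⊕ Fin m → VField m M} {x₀ : M} (hb : IsFlatFrame b x₀) :
    ∀ᶠ y in 𝓝 x₀, ∀ k v, flatD (b k) y v = 0 := by
  filter_upwards [hb.eq_constField.eventually_nhds,
    (chartAt (DoubleModel m) x₀).open_source.mem_nhds (mem_chart_source _ x₀)] with y hy hs k v
  rw [flatD_congr (hy.mono fun z hz => hz k), flatD_constField hs]

end Frame

/-! ### The flat connection, smoothness criteria and extension of vectors. -/

section Smoothness

variable {m : ℕ} {M : Type*} [TopologicalSpace M] [ChartedSpace (DoubleModel m) M]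
  [IsManifold 𝓘(ℝ, DoubleModel m) ∞ M]

lemma mvfderiv_bilin {E F G : Type*} [NormedAddCommGroup E] [NormedSpace ℝ E]
    [NormedAddCommGroup F] [NormedSpace ℝ F] [NormedAddCommGroup G] [NormedSpace ℝ G]
    (B : E →L[ℝ] F →L[ℝ] G) {f : M → E} {g : M → F} {x : M}
    (hf : MDifferentiableAt 𝓘(ℝ, DoubleModel m) 𝓘(ℝ, E) f x)
    (hg : MDifferentiableAt 𝓘(ℝ, DoubleModel m) 𝓘(ℝ, F) g x)
    (v : TangentSpace 𝓘(ℝ, DoubleModel m) x) :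
    mvfderiv 𝓘(ℝ, DoubleModel m) (fun y => B (f y) (g y)) x v =
      B (mvfderiv 𝓘(ℝ, DoubleModel m) f x v) (g x) +
        B (f x) (mvfderiv 𝓘(ℝ, DoubleModel m) g x v) := by
  have h := HasMFDerivAt.mfderiv (I := 𝓘(ℝ, DoubleModel m)) (I' := 𝓘(ℝ, G))
    (f := fun y => B (f y) (g y)) (x := x)
    ⟨(B.continuous.continuousAt.comp hf.continuousAt).clm_apply hg.continuousAt,
      B.hasFDerivWithinAt_of_bilinear hf.hasMFDerivAt.2 hg.hasMFDerivAt.2⟩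
  have h' := congrArg (fun L => L v) h
  refine h'.trans ?_
  rw [add_comm]
  change B _ _ + B _ _ = _
  simp [mvfderiv]
  rfl

lemma diffVFAt_iff_locComps {X : VField m M} {x : M} : DiffVFAt X x ↔
    MDifferentiableAt 𝓘(ℝ, DoubleModel m) 𝓘(ℝ, DoubleModel m) (locComps x X) x :=
  mdifferentiableAt_section _ _

lemma SmoothVFAt.add {X Y : VField m M} {x : M} (hX : SmoothVFAt X x) (hY : SmoothVFAt Y x) :
    SmoothVFAt (fun y => X y + Y y) x := ContMDiffAt.add_section hX hY

lemma SmoothVFAt.smul {X : VField m M} {f : M → ℝ} {x : M}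
    (hf : ContMDiffAt 𝓘(ℝ, DoubleModel m) 𝓘(ℝ, ℝ) ∞ f x) (hX : SmoothVFAt X x) :
    SmoothVFAt (fun y => f y • X y) x := ContMDiffAt.smul_section hf hX

lemma SmoothVFAt.sum {ι : Type*} {s : Finset ι} {X : ι → VField m M} {x : M}
    (hX : ∀ i ∈ s, SmoothVFAt (X i) x) : SmoothVFAt (fun y => ∑ i ∈ s, X i y) x :=
  ContMDiffAt.sum_section hX

lemma IsSmoothVF.add {X Y : VField m M} (hX : IsSmoothVF X) (hY : IsSmoothVF Y) :
    IsSmoothVF fun y => X y + Y y := fun x => SmoothVFAt.add (hX x) (hY x)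

lemma IsSmoothVF.sub {X Y : VField m M} (hX : IsSmoothVF X) (hY : IsSmoothVF Y) :
    IsSmoothVF fun y => X y - Y y := fun x => ContMDiffAt.sub_section (hX x) (hY x)

lemma IsSmoothVF.smul {X : VField m M} {f : M → ℝ}
    (hf : ContMDiff 𝓘(ℝ, DoubleModel m) 𝓘(ℝ, ℝ) ∞ f) (hX : IsSmoothVF X) :
    IsSmoothVF fun y => f y • X y := fun x => SmoothVFAt.smul (hf x) (hX x)

lemma IsSmoothVF.const_smul {X : VField m M} (c : ℝ) (hX : IsSmoothVF X) :
    IsSmoothVF fun y => c • X y := hX.smul contMDiff_const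

lemma IsSmoothVF.sum {ι : Type*} {s : Finset ι} {X : ι → VField m M}
    (hX : ∀ i ∈ s, IsSmoothVF (X i)) : IsSmoothVF fun y => ∑ i ∈ s, X i y :=
  fun x => SmoothVFAt.sum fun i hi => hX i hi x

variable [DoubleManifold m M]

lemma dirDeriv_gam {X Y : VField m M} {x : M} (hX : DiffVFAt X x) (hY : DiffVFAt Y x)
    (v : TangentSpace 𝓘(ℝ, DoubleModel m) x) :
    dirDeriv (fun y => gam (X y) (Y y)) x v =
      gam (flatD X x v) (Y x) + gam (X x) (flatD Y x v) := by
  have h : (fun y => gam (X y) (Y y)) =ᶠ[𝓝 x]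
      fun y => modelGam m (locComps x X y) (locComps x Y y) := by
    filter_upwards [(chartAt (DoubleModel m) x).open_source.mem_nhds (mem_chart_source _ x)]
      with z hz using gam_eq_locComps hz X Y
  rw [dirDeriv, mvfderiv_congr h, mvfderiv_bilin _ (diffVFAt_iff_locComps.1 hX)
    (diffVFAt_iff_locComps.1 hY), locComps_self, locComps_self]
  rfl

lemma gam_mdifferentiableAt {X Y : VField m M} {x : M} (hX : DiffVFAt X x) (hY : DiffVFAt Y x) :
    MDifferentiableAt 𝓘(ℝ, DoubleModel m) 𝓘(ℝ, ℝ) (fun y => gam (X y) (Y y)) x := by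
  rw [diffVFAt_iff_locComps] at hX hY
  have h := ((modelGam m).mdifferentiableAt.comp x hX).clm_apply hY
  refine h.congr_of_eventuallyEq ?_
  filter_upwards [(chartAt (DoubleModel m) x).open_source.mem_nhds (mem_chart_source _ x)] with z hz
  exact gam_eq_locComps hz X Y

lemma gam_contMDiff {X Y : VField m M} (hX : IsSmoothVF X) (hY : IsSmoothVF Y) :
    ContMDiff 𝓘(ℝ, DoubleModel m) 𝓘(ℝ, ℝ) ∞ (fun y => gam (X y) (Y y)) :=
  fun x => gam_contMDiffAt (hX x) (hY x)

/-- The canonical flat connection. -/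
def flatConn (m : ℕ) (M : Type*) [TopologicalSpace M] [ChartedSpace (DoubleModel m) M]
    [IsManifold 𝓘(ℝ, DoubleModel m) ∞ M] : Conn m M where
  toFun Y x := mvfderiv 𝓘(ℝ, DoubleModel m) (locComps x Y) x
  isCovariantDerivativeOnUniv :=
    { add := by
        intro Y Y' x hY hY' _
        have h : locComps x (Y + Y') =ᶠ[𝓝 x] locComps x Y + locComps x Y' := by
          filter_upwards [(chartAt (DoubleModel m) x).open_source.mem_nhds
            (mem_chart_source _ x)] with z hz
          exact map_add (tangentCoordChange 𝓘(ℝ, DoubleModel m) z x z) (comps (Y z)) (comps (Y' z))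
        rw [mvfderiv_congr h]
        exact mvfderiv_add (diffVFAt_iff_locComps.1 hY) (diffVFAt_iff_locComps.1 hY')
      leibniz := by
        intro Y f x hY hf _
        have h : locComps x (f • Y) =ᶠ[𝓝 x] f • locComps x Y := by
          filter_upwards [(chartAt (DoubleModel m) x).open_source.mem_nhds
            (mem_chart_source _ x)] with z hz
          exact map_smul (tangentCoordChange 𝓘(ℝ, DoubleModel m) z x z) (f z) (comps (Y z))
        rw [mvfderiv_congr h]
        refine (mvfderiv_smul hf (diffVFAt_iff_locComps.1 hY)).trans ?_
        rw [locComps_self]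
        rfl }

lemma flatConn_apply (Y : VField m M) (x : M) (v : TangentSpace 𝓘(ℝ, DoubleModel m) x) :
    flatConn m M Y x v = flatD Y x v := rfl

variable [T2Space M]

/-- The `γ`-products with the frame are, up to `Sum.swap`, the coefficients in the frame. -/
lemma smoothVFAt_of_gam_frame {b : Fin m ⊕ Fin m → VField m M} {x : M} (hb : IsFlatFrame b x)
    {U : VField m M}
    (h : ∀ k, ContMDiffAt 𝓘(ℝ, DoubleModel m) 𝓘(ℝ, ℝ) ∞ (fun y => gam (U y) (b k y)) x) :
    SmoothVFAt U x := by
  have : SmoothVFAt (fun y => ∑ k, gam (U y) (b k.swap y) • b k y) x :=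
    SmoothVFAt.sum fun k _ => SmoothVFAt.smul (h k.swap) (hb.smooth k x)
  refine this.congr_of_eventuallyEq ?_
  filter_upwards [hb.expand] with y hy
  rw [← hy (U y)]

lemma isSmoothVF_of_gam {U : VField m M}
    (h : ∀ W : VField m M, IsSmoothVF W →
      ContMDiff 𝓘(ℝ, DoubleModel m) 𝓘(ℝ, ℝ) ∞ (fun y => gam (U y) (W y))) : IsSmoothVF U := by
  intro x
  obtain ⟨b, hb⟩ := exists_isFlatFrame m x
  exact smoothVFAt_of_gam_frame hb fun k => h _ (hb.smooth k) x

/-- Lets identities stated for smooth fields be read off as identities of tensors at a point. -/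
lemma exists_extend {x : M} (v : TangentSpace 𝓘(ℝ, DoubleModel m) x) :
    ∃ V : VField m M, IsSmoothVF V ∧ V x = v := by
  obtain ⟨b, hb⟩ := exists_isFlatFrame m x
  exact ⟨fun y => ∑ k, gam v (b k.swap x) • b k y,
    IsSmoothVF.sum fun k _ => (hb.smooth k).const_smul _, (hb.expand.self_of_nhds v).symm⟩

lemma IsFlatFrame.expand_leafL {b : Fin m ⊕ Fin m → VField m M} {x₀ : M}
    (hb : IsFlatFrame b x₀) : ∀ᶠ y in 𝓝 x₀, ∀ v ∈ leafL y,
      v = ∑ i, gam v (b (Sum.inr i) y) • b (Sum.inl i) y := by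
  filter_upwards [hb.expand] with y hy v hv
  conv_lhs => rw [hy v, Fintype.sum_sum_type]
  simp [gam_leafL_leafL hv (hb.inl_mem _ y)]

lemma DoubleField.exists_extend_leafL {x : M} {v : TangentSpace 𝓘(ℝ, DoubleModel m) x}
    (hv : v ∈ leafL x) : ∃ V : VField m M, DoubleField.IsSectionL V ∧ V x = v := by
  obtain ⟨b, hb⟩ := exists_isFlatFrame m x
  refine ⟨fun y => ∑ i, gam v (b (Sum.inr i) x) • b (Sum.inl i) y,
    ⟨IsSmoothVF.sum fun k _ => (hb.smooth _).const_smul _, fun y => ?_⟩,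
    (hb.expand_leafL.self_of_nhds v hv).symm⟩
  exact (leafLSub y).sum_mem fun i _ => smul_mem_leafL _ (hb.inl_mem i y)

lemma dirDeriv_contMDiff {f : M → ℝ} (hf : ContMDiff 𝓘(ℝ, DoubleModel m) 𝓘(ℝ, ℝ) ∞ f)
    {V : VField m M} (hV : IsSmoothVF V) :
    ContMDiff 𝓘(ℝ, DoubleModel m) 𝓘(ℝ, ℝ) ∞ (fun y => dirDeriv f y (V y)) := by
  have h : ContMDiff 𝓘(ℝ, DoubleModel m).tangent 𝓘(ℝ, ℝ).tangent ∞
      (tangentMap 𝓘(ℝ, DoubleModel m) 𝓘(ℝ, ℝ) f) := hf.contMDiff_tangentMap (by simp)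
  exact (contMDiff_snd_tangentBundle_modelSpace ℝ 𝓘(ℝ, ℝ)).comp (h.comp hV)

/-- Since the frame fields `b k` are parallel near `x`, `γ(∇⁰_V X, b k)` is the derivative `V(γ(X, b
k))`. -/
lemma flatD_smooth {X V : VField m M} (hX : IsSmoothVF X) (hV : IsSmoothVF V) :
    IsSmoothVF fun y => flatD X y (V y) := by
  intro x
  obtain ⟨b, hb⟩ := exists_isFlatFrame m x
  refine smoothVFAt_of_gam_frame hb fun k => ?_
  refine (dirDeriv_contMDiff (gam_contMDiff hX (hb.smooth k)) hV x).congr_of_eventuallyEq ?_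
  filter_upwards [hb.flat] with y hy
  rw [dirDeriv_gam (hX.diff y) ((hb.smooth k).diff y), hy, gam_zero_right, add_zero]

/-- Reduces smoothness of `D Y`, a section of a bundle of homomorphisms, to that of the fields `D_V
Y`, which can be tested with `γ`. -/
lemma conn_smooth_of_apply {D : Conn m M}
    (h : ∀ Y V : VField m M, IsSmoothVF Y → IsSmoothVF V → IsSmoothVF fun y => D Y y (V y)) :
    CovariantDerivative.ContMDiffCovariantDerivative D ∞ := by
  refine ⟨⟨fun {Y} hY => ?_⟩⟩
  have hY : IsSmoothVF Y := contMDiffOn_univ.1 hY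
  rw [contMDiffOn_univ]
  intro x
  rw [contMDiffAt_hom_bundle]
  refine ⟨contMDiffAt_id, ?_⟩
  obtain ⟨b, hb⟩ := exists_isFlatFrame m x
  -- In coordinates `D Y` is the sum over the frame of (dual covector of `b k`) ⊗ (components of
  -- `D_{b k} Y`).
  have hsum : ContMDiffAt 𝓘(ℝ, DoubleModel m) 𝓘(ℝ, DoubleModel m →L[ℝ] DoubleModel m) ∞
      (fun y => ∑ k, ((modelGam m).flip (modelBasis k.swap)).smulRight
        (locComps x (fun z => D Y z (b k z)) y)) x := by
    refine contMDiffAt_finsetSum fun k _ => ?_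
    have h1 := (contMDiffAt_section _).1 (h Y (b k) hY (hb.smooth k) x)
    exact ((ContinuousLinearMap.smulRightL ℝ (DoubleModel m) (DoubleModel m)
      ((modelGam m).flip (modelBasis k.swap))).contMDiff.contMDiffAt).comp x h1
  refine hsum.congr_of_eventuallyEq ?_
  filter_upwards [hb.eq_constField,
    (chartAt (DoubleModel m) x).open_source.mem_nhds (mem_chart_source _ x)] with y hy hs
  refine ContinuousLinearMap.ext fun c => ?_
  conv_lhs => rw [modelBasis_expand c]
  rw [map_sum, sum_apply]
  refine Finset.sum_congr rfl fun k _ => ?_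
  rw [map_smul]
  simp only [ContinuousLinearMap.smulRight_apply, ContinuousLinearMap.flip_apply]
  congr 1
  rw [locComps, hy k, ContinuousLinearMap.inCoordinates, ContinuousLinearMap.comp_apply,
    TangentBundle.continuousLinearMapAt_trivializationAt_eq_core hs]
  rfl

lemma conn_apply_smooth {D : Conn m M} (hD : CovariantDerivative.ContMDiffCovariantDerivative D ∞)
    {Y V : VField m M} (hY : IsSmoothVF Y) (hV : IsSmoothVF V) :
    IsSmoothVF fun y => D Y y (V y) := by
  have h := contMDiffOn_univ.1 (hD.contMDiff.contMDiff (contMDiffOn_univ.2 hY))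
  exact ContMDiff.clm_bundle_apply h hV

end Smoothness

namespace DoubleField

variable {m : ℕ} {M : Type*} [TopologicalSpace M] [ChartedSpace (DoubleModel m) M]
  [IsManifold 𝓘(ℝ, DoubleModel m) ∞ M] (φ : DoubleField m M)

lemma g_contMDiff {X Y : VField m M} (hX : IsSmoothVF X) (hY : IsSmoothVF Y) :
    ContMDiff 𝓘(ℝ, DoubleModel m) 𝓘(ℝ, ℝ) ∞ (fun y => φ.g y (X y) (Y y)) := by
  intro x
  have h := ContMDiffAt.clm_bundle_apply₂ (F₃ := ℝ) (E₃ := Bundle.Trivial M ℝ)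
    (φ.smooth_g x) (hX x) (hY x)
  exact (contMDiffAt_section _).1 h

lemma B_contMDiff {X Y : VField m M} (hX : IsSmoothVF X) (hY : IsSmoothVF Y) :
    ContMDiff 𝓘(ℝ, DoubleModel m) 𝓘(ℝ, ℝ) ∞ (fun y => φ.B y (X y) (Y y)) := by
  intro x
  have h := ContMDiffAt.clm_bundle_apply₂ (F₃ := ℝ) (E₃ := Bundle.Trivial M ℝ)
    (φ.smooth_B x) (hX x) (hY x)
  exact (contMDiffAt_section _).1 h

end DoubleField

/-! ### Linear algebra of `ι_±`, `S_±` and their projections. -/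

namespace DoubleField

section Algebra

variable {m : ℕ} {M : Type*} [TopologicalSpace M] [ChartedSpace (DoubleModel m) M]
  [IsManifold 𝓘(ℝ, DoubleModel m) ∞ M] (φ : DoubleField m M) {x : M} {ε : ℝ}

lemma g_leafLt_right (v : TangentSpace 𝓘(ℝ, DoubleModel m) x)
    {w : TangentSpace 𝓘(ℝ, DoubleModel m) x} (hw : w ∈ leafLt x) : φ.g x v w = 0 := by
  rw [φ.symm_g, φ.g_leafLt x w hw]

lemma B_leafLt_right (v : TangentSpace 𝓘(ℝ, DoubleModel m) x)
    {w : TangentSpace 𝓘(ℝ, DoubleModel m) x} (hw : w ∈ leafLt x) : φ.B x v w = 0 := by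
  rw [φ.skew_B, φ.B_leafLt x w hw, neg_zero]

@[simp] lemma g_prL_left (v w : TangentSpace 𝓘(ℝ, DoubleModel m) x) :
    φ.g x (prL v) w = φ.g x v w := by
  have := φ.g_leafLt x _ (sub_prL_mem v) w
  rw [map_sub, sub_apply, sub_eq_zero] at this
  exact this.symm

@[simp] lemma g_prL_right (v w : TangentSpace 𝓘(ℝ, DoubleModel m) x) :
    φ.g x v (prL w) = φ.g x v w := by
  rw [φ.symm_g, g_prL_left, φ.symm_g]

@[simp] lemma B_prL_left (v w : TangentSpace 𝓘(ℝ, DoubleModel m) x) :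
    φ.B x (prL v) w = φ.B x v w := by
  have := φ.B_leafLt x _ (sub_prL_mem v) w
  rw [map_sub, sub_apply, sub_eq_zero] at this
  exact this.symm

@[simp] lemma B_prL_right (v w : TangentSpace 𝓘(ℝ, DoubleModel m) x) :
    φ.B x v (prL w) = φ.B x v w := by
  rw [φ.skew_B, B_prL_left, ← φ.skew_B]

lemma gam_iota_left (ε : ℝ) (v w : TangentSpace 𝓘(ℝ, DoubleModel m) x) :
    gam (φ.iota ε v) w = gam v w + φ.B x v w + ε * φ.g x v w := by
  rw [iota, gam_add_left, gam_sharpGam, add_assoc]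
  exact ⟨fun _ _ => by simp; ring, fun _ _ => by simp; ring⟩

lemma isLinearMap_iota (ε : ℝ) :
    IsLinearMap ℝ (φ.iota ε : TangentSpace 𝓘(ℝ, DoubleModel m) x → _) where
  map_add _ _ := eq_of_forall_gam fun z => by
    simp only [gam_add_left, gam_iota_left, map_add, add_apply]; ring
  map_smul _ _ := eq_of_forall_gam fun z => by
    simp only [gam_smul_left, gam_iota_left, map_smul, smul_apply, smul_eq_mul]; ring

/-- Pairing with `L` sees exactly the `L̃`-component. -/
lemma eq_of_prL_of_gam {v w : TangentSpace 𝓘(ℝ, DoubleModel m) x} (h : prL v = prL w)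
    (h' : ∀ z ∈ leafL x, gam v z = gam w z) : v = w := by
  refine eq_of_forall_gam fun z => ?_
  have hz : z = prL z + (z - prL z) := by abel
  rw [hz, gam_add_right, gam_add_right, h' _ (prL_mem z), ← gam_prL_left, ← gam_prL_left, h]

lemma iota_sub_mem (ε : ℝ) (v : TangentSpace 𝓘(ℝ, DoubleModel m) x) :
    φ.iota ε v - v ∈ leafLt x := by
  rw [iota, add_sub_cancel_left]
  refine funext fun i => ?_
  simp [comps, ofComps, sharpGam, φ.g_leafLt_right v (dXt_mem_leafLt i),
    φ.B_leafLt_right v (dXt_mem_leafLt i)]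

@[simp] lemma prL_iota (ε : ℝ) (v : TangentSpace 𝓘(ℝ, DoubleModel m) x) :
    prL (φ.iota ε v) = prL v := by
  have := prL_eq_zero (φ.iota_sub_mem ε v)
  rwa [isLinearMap_prL.map_sub, sub_eq_zero] at this

@[simp] lemma g_iota_right (v w : TangentSpace 𝓘(ℝ, DoubleModel m) x) :
    φ.g x v (φ.iota ε w) = φ.g x v w := by
  rw [← g_prL_right, prL_iota, g_prL_right]

@[simp] lemma B_iota_right (v w : TangentSpace 𝓘(ℝ, DoubleModel m) x) :
    φ.B x v (φ.iota ε w) = φ.B x v w := by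
  rw [← B_prL_right, prL_iota, B_prL_right]

lemma gam_iota_iota (ε δ : ℝ) (v w : TangentSpace 𝓘(ℝ, DoubleModel m) x) :
    gam (φ.iota ε v) (φ.iota δ w) = gam v w + (ε + δ) * φ.g x v w := by
  rw [gam_iota_left, gam_comm, gam_iota_left, g_iota_right, B_iota_right, gam_comm w v,
    φ.symm_g x w v, φ.skew_B x w v]
  ring

lemma gam_iota_iota_same {v w : TangentSpace 𝓘(ℝ, DoubleModel m) x} (hv : v ∈ leafL x)
    (hw : w ∈ leafL x) : gam (φ.iota ε v) (φ.iota ε w) = 2 * ε * φ.g x v w := by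
  rw [gam_iota_iota, gam_leafL_leafL hv hw]
  ring

lemma gam_iota_iota_opp {v w : TangentSpace 𝓘(ℝ, DoubleModel m) x} (hv : v ∈ leafL x)
    (hw : w ∈ leafL x) : gam (φ.iota ε v) (φ.iota (-ε) w) = 0 := by
  rw [gam_iota_iota, gam_leafL_leafL hv hw]
  ring

lemma eq_of_forall_g {v w : TangentSpace 𝓘(ℝ, DoubleModel m) x} (hv : v ∈ leafL x)
    (hw : w ∈ leafL x) (h : ∀ z ∈ leafL x, φ.g x v z = φ.g x w z) : v = w := by
  refine sub_eq_zero.1 (φ.nondeg_g x _ (sub_mem_leafL hv hw) fun z hz => ?_)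
  rw [map_sub, sub_apply, h z hz, sub_self]

lemma sharpG_mem (α : TangentSpace 𝓘(ℝ, DoubleModel m) x → ℝ) : φ.sharpG α ∈ leafL x := rfl

lemma g_sum_dX_dX (c : Fin m → ℝ) (j : Fin m) :
    φ.g x (∑ i, c i • dX x i) (dX x j) = (φ.gMat x).mulVec c j := by
  simp only [map_sum, map_smul, sum_apply, smul_apply, Matrix.mulVec,
    dotProduct, gMat, Matrix.of_apply, smul_eq_mul]
  exact Finset.sum_congr rfl fun i _ => by rw [φ.symm_g, mul_comm]

lemma eq_of_forall_dX {α β : TangentSpace 𝓘(ℝ, DoubleModel m) x → ℝ} (hα : IsLinearMap ℝ α)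
    (hβ : IsLinearMap ℝ β) (h : ∀ i, α (dX x i) = β (dX x i))
    {w : TangentSpace 𝓘(ℝ, DoubleModel m) x} (hw : w ∈ leafL x) : α w = β w := by
  change hα.mk' α w = hβ.mk' β w
  rw [eq_sum_dX_of_mem_leafL hw, map_sum, map_sum]
  exact Finset.sum_congr rfl fun i _ => by simp [h]

/-- Makes the nonsingular inverse in `sharpG` a genuine inverse rather than its default value. -/
lemma isUnit_gMat (x : M) : IsUnit (φ.gMat x) := by
  rw [← Matrix.mulVec_injective_iff_isUnit, ← Matrix.coe_mulVecLin, ← LinearMap.ker_eq_bot,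
    LinearMap.ker_eq_bot']
  intro c hc
  have h0 : (ofComps x (c, 0) : TangentSpace 𝓘(ℝ, DoubleModel m) x) = ∑ i, c i • dX x i :=
    eq_sum_dX_of_mem_leafL (v := ofComps x (c, 0)) rfl
  have h1 : (ofComps x (c, 0) : TangentSpace 𝓘(ℝ, DoubleModel m) x) = 0 := by
    refine φ.nondeg_g x _ rfl fun w hw => ?_
    refine eq_of_forall_dX (α := φ.g x (ofComps x (c, 0))) (β := fun _ => 0)
      ⟨map_add _, map_smul _⟩ ⟨by simp, by simp⟩ (fun j => ?_) hw
    rw [h0, g_sum_dX_dX]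
    exact congrFun hc j
  exact congrArg Prod.fst h1

lemma g_sharpG {α : TangentSpace 𝓘(ℝ, DoubleModel m) x → ℝ} (hα : IsLinearMap ℝ α)
    {w : TangentSpace 𝓘(ℝ, DoubleModel m) x} (hw : w ∈ leafL x) :
    φ.g x (φ.sharpG α) w = α w := by
  refine eq_of_forall_dX (α := φ.g x (φ.sharpG α)) ⟨map_add _, map_smul _⟩ hα (fun j => ?_) hw
  rw [eq_sum_dX_of_mem_leafL (φ.sharpG_mem α), g_sum_dX_dX]
  change (φ.gMat x).mulVec ((φ.gMat x)⁻¹.mulVec _) j = _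
  rw [Matrix.mulVec_mulVec, Matrix.mul_nonsing_inv _
    ((Matrix.isUnit_iff_isUnit_det _).1 (φ.isUnit_gMat x)), Matrix.one_mulVec]

/-- The component in `L` of the projection onto `S_±`. -/
def pS (ε : ℝ) (v : TangentSpace 𝓘(ℝ, DoubleModel m) x) : TangentSpace 𝓘(ℝ, DoubleModel m) x :=
  (1 / 2 : ℝ) • (prL v - ε • φ.sharpG fun w => φ.B x (prL v) w - gam v w)

lemma prS_eq (ε : ℝ) (v : TangentSpace 𝓘(ℝ, DoubleModel m) x) :
    φ.prS ε v = φ.iota ε (φ.pS ε v) := rfl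

lemma pS_mem (ε : ℝ) (v : TangentSpace 𝓘(ℝ, DoubleModel m) x) : φ.pS ε v ∈ leafL x :=
  smul_mem_leafL _ (sub_mem_leafL (prL_mem v) (smul_mem_leafL _ (φ.sharpG_mem _)))

lemma prL_prS (ε : ℝ) (v : TangentSpace 𝓘(ℝ, DoubleModel m) x) :
    prL (φ.prS ε v) = φ.pS ε v := by
  rw [prS_eq, prL_iota, prL_eq_self (φ.pS_mem ε v)]

lemma g_pS (ε : ℝ) (v : TangentSpace 𝓘(ℝ, DoubleModel m) x)
    {w : TangentSpace 𝓘(ℝ, DoubleModel m) x} (hw : w ∈ leafL x) :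
    φ.g x (φ.pS ε v) w = (1 / 2) * (φ.g x v w - ε * (φ.B x v w - gam v w)) := by
  rw [pS, map_smul, map_sub, map_smul, smul_apply, sub_apply, smul_apply, g_sharpG φ _ hw]
  · simp
  · exact ⟨fun _ _ => by simp; ring, fun _ _ => by simp; ring⟩

/-- Through `ι_ε` the form `γ` is `2 ε g` on `S_ε`, so this characterizes `prS ε` as the
`γ`-orthogonal projection. The formula with `sharpG` is no longer needed where this applies. -/
lemma two_mul_g_pS (hε : ε = 1 ∨ ε = -1) (v : TangentSpace 𝓘(ℝ, DoubleModel m) x)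
    {w : TangentSpace 𝓘(ℝ, DoubleModel m) x} (hw : w ∈ leafL x) :
    2 * ε * φ.g x (φ.pS ε v) w = gam v (φ.iota ε w) := by
  rw [φ.g_pS ε v hw, gam_comm v (φ.iota ε w), gam_iota_left, φ.symm_g x w v, φ.skew_B x w v, gam_comm w v]
  rcases hε with rfl | rfl <;> ring

lemma isLinearMap_pS (ε : ℝ) :
    IsLinearMap ℝ (φ.pS ε : TangentSpace 𝓘(ℝ, DoubleModel m) x → _) where
  map_add v w := φ.eq_of_forall_g (φ.pS_mem _ _) (add_mem_leafL (φ.pS_mem _ _) (φ.pS_mem _ _))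
    fun z hz => by
      simp only [map_add, add_apply, φ.g_pS _ _ hz, gam_add_left]; ring
  map_smul c v := φ.eq_of_forall_g (φ.pS_mem _ _) (smul_mem_leafL _ (φ.pS_mem _ _))
    fun z hz => by
      simp only [map_smul, smul_apply, φ.g_pS _ _ hz, gam_smul_left, smul_eq_mul]; ring

lemma isLinearMap_prS (ε : ℝ) :
    IsLinearMap ℝ (φ.prS ε : TangentSpace 𝓘(ℝ, DoubleModel m) x → _) where
  map_add v w := by
    simp only [prS_eq, (φ.isLinearMap_pS ε).map_add, (φ.isLinearMap_iota ε).map_add]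
  map_smul v w := by
    simp only [prS_eq, (φ.isLinearMap_pS ε).map_smul, (φ.isLinearMap_iota ε).map_smul]

lemma pS_iota (hε : ε = 1 ∨ ε = -1) {v : TangentSpace 𝓘(ℝ, DoubleModel m) x}
    (hv : v ∈ leafL x) : φ.pS ε (φ.iota ε v) = v := by
  refine φ.eq_of_forall_g (φ.pS_mem _ _) hv fun z hz => ?_
  have h := φ.two_mul_g_pS hε (φ.iota ε v) hz
  rw [φ.gam_iota_iota_same hv hz] at h
  refine mul_left_cancel₀ ?_ h
  rcases hε with rfl | rfl <;> norm_num

lemma pS_iota_opp (hε : ε = 1 ∨ ε = -1) {v : TangentSpace 𝓘(ℝ, DoubleModel m) x}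
    (hv : v ∈ leafL x) : φ.pS (-ε) (φ.iota ε v) = 0 := by
  have hε' : -ε = 1 ∨ -ε = -1 := by rcases hε with rfl | rfl <;> norm_num
  refine φ.nondeg_g x _ (φ.pS_mem _ _) fun z hz => ?_
  have h := φ.two_mul_g_pS hε' (φ.iota ε v) hz
  rw [φ.gam_iota_iota_opp hv hz] at h
  refine (mul_eq_zero.1 h).resolve_left ?_
  rcases hε with rfl | rfl <;> norm_num

lemma prS_add_prS (v : TangentSpace 𝓘(ℝ, DoubleModel m) x) :
    φ.prS 1 v + φ.prS (-1) v = v := by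
  have hp : φ.pS 1 v + φ.pS (-1) v = prL v := by
    rw [pS, pS, ← smul_add, one_smul, neg_one_smul]
    module
  refine eq_of_prL_of_gam ?_ fun z hz => ?_
  · rw [isLinearMap_prL.map_add, prL_prS, prL_prS, hp]
  · rw [gam_add_left, prS_eq, prS_eq, gam_iota_left, gam_iota_left,
      gam_leafL_leafL (φ.pS_mem _ _) hz, gam_leafL_leafL (φ.pS_mem _ _) hz, φ.g_pS _ _ hz,
      φ.g_pS _ _ hz]
    have : φ.B x (φ.pS 1 v) z + φ.B x (φ.pS (-1) v) z = φ.B x v z := by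
      rw [← add_apply, ← map_add, hp, B_prL_left]
    linear_combination this

lemma prS_add_prS_neg (hε : ε = 1 ∨ ε = -1) (v : TangentSpace 𝓘(ℝ, DoubleModel m) x) :
    φ.prS ε v + φ.prS (-ε) v = v := by
  rcases hε with rfl | rfl
  · exact φ.prS_add_prS v
  · rw [neg_neg, add_comm, φ.prS_add_prS]

lemma prS_mem (ε : ℝ) (v : TangentSpace 𝓘(ℝ, DoubleModel m) x) : φ.prS ε v ∈ φ.bundleS ε x :=
  ⟨_, φ.pS_mem ε v, rfl⟩

lemma iota_mem (ε : ℝ) {v : TangentSpace 𝓘(ℝ, DoubleModel m) x} (hv : v ∈ leafL x) :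
    φ.iota ε v ∈ φ.bundleS ε x := ⟨v, hv, rfl⟩

lemma prS_eq_self (hε : ε = 1 ∨ ε = -1) {v : TangentSpace 𝓘(ℝ, DoubleModel m) x}
    (hv : v ∈ φ.bundleS ε x) : φ.prS ε v = v := by
  obtain ⟨w, hw, rfl⟩ := hv
  rw [prS_eq, φ.pS_iota hε hw]

lemma prS_opp_eq_zero (hε : ε = 1 ∨ ε = -1) {v : TangentSpace 𝓘(ℝ, DoubleModel m) x}
    (hv : v ∈ φ.bundleS ε x) : φ.prS (-ε) v = 0 := by
  obtain ⟨w, hw, rfl⟩ := hv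
  rw [prS_eq, φ.pS_iota_opp hε hw, (φ.isLinearMap_iota _).map_zero]

lemma gam_bundleS_opp {v w : TangentSpace 𝓘(ℝ, DoubleModel m) x} (hv : v ∈ φ.bundleS ε x)
    (hw : w ∈ φ.bundleS (-ε) x) : gam v w = 0 := by
  obtain ⟨v, hv, rfl⟩ := hv
  obtain ⟨w, hw, rfl⟩ := hw
  exact φ.gam_iota_iota_opp hv hw

/-- `S_ε` is the whole `γ`-orthogonal of `S_{-ε}`: the `S_{-ε}`-component of such a `v` is
`g`-orthogonal to `L`, hence zero. -/
lemma mem_bundleS_of_gam (hε : ε = 1 ∨ ε = -1) {v : TangentSpace 𝓘(ℝ, DoubleModel m) x}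
    (h : ∀ w ∈ φ.bundleS (-ε) x, gam v w = 0) : v ∈ φ.bundleS ε x := by
  have hε' : -ε = 1 ∨ -ε = -1 := by rcases hε with rfl | rfl <;> norm_num
  have h0 : φ.pS (-ε) v = 0 := by
    refine φ.nondeg_g x _ (φ.pS_mem _ _) fun z hz => ?_
    have h1 := φ.two_mul_g_pS hε' v hz
    rw [h _ (φ.iota_mem _ hz)] at h1
    refine (mul_eq_zero.1 h1).resolve_left ?_
    rcases hε with rfl | rfl <;> norm_num
  have h1 := φ.prS_add_prS_neg hε v
  rw [φ.prS_eq (-ε), h0, (φ.isLinearMap_iota _).map_zero, add_zero] at h1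
  rw [← h1]
  exact φ.prS_mem ε v

/-- `γ(v, w)` splits along `S_+ ⊕ S_-`. -/
lemma gam_prS_left (hε : ε = 1 ∨ ε = -1) (v w : TangentSpace 𝓘(ℝ, DoubleModel m) x) :
    gam (φ.prS ε v) w = gam v (φ.prS ε w) := by
  conv_lhs => rw [← φ.prS_add_prS_neg hε w]
  conv_rhs => rw [← φ.prS_add_prS_neg hε v]
  rw [gam_add_left, gam_add_right, φ.gam_bundleS_opp (φ.prS_mem ε v) (φ.prS_mem _ w),
    gam_comm (φ.prS (-ε) v), φ.gam_bundleS_opp (φ.prS_mem ε w) (φ.prS_mem _ v)]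

end Algebra

section Smooth

variable {m : ℕ} {M : Type*} [TopologicalSpace M] [ChartedSpace (DoubleModel m) M]
  [IsManifold 𝓘(ℝ, DoubleModel m) ∞ M] [DoubleManifold m M] [T2Space M] (φ : DoubleField m M)

lemma isSmoothVF_iota (ε : ℝ) {X : VField m M} (hX : IsSmoothVF X) :
    IsSmoothVF fun y => φ.iota ε (X y) := by
  refine isSmoothVF_of_gam fun W hW => ?_
  simp only [gam_iota_left]
  exact ((gam_contMDiff hX hW).add (φ.B_contMDiff hX hW)).add
    (contMDiff_const.mul (φ.g_contMDiff hX hW))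

lemma isSectionS_iota (ε : ℝ) {X : VField m M} (hX : IsSectionL X) :
    φ.IsSectionS ε fun y => φ.iota ε (X y) :=
  ⟨φ.isSmoothVF_iota ε hX.1, fun y => φ.iota_mem ε (hX.2 y)⟩

end Smooth

end DoubleField

/-! ### Smoothness of sections of `L` defined by a non degenerate form. -/

section LeafForm

variable {m : ℕ} {M : Type*} [TopologicalSpace M] [ChartedSpace (DoubleModel m) M]
  [IsManifold 𝓘(ℝ, DoubleModel m) ∞ M]

lemma contMDiffAt_det {n : Type*} [Fintype n] [DecidableEq n] {A : M → Matrix n n ℝ} {x : M}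
    (hA : ∀ i j, ContMDiffAt 𝓘(ℝ, DoubleModel m) 𝓘(ℝ, ℝ) ∞ (fun y => A y i j) x) :
    ContMDiffAt 𝓘(ℝ, DoubleModel m) 𝓘(ℝ, ℝ) ∞ (fun y => (A y).det) x := by
  simp only [Matrix.det_apply']
  refine contMDiffAt_finsetSum fun σ _ => contMDiffAt_const.mul ?_
  exact contMDiffAt_finsetProd fun i _ => hA _ _

/-- Cramer's rule: near `x` the solution is `adj(A) (A c) / det A`, a quotient of smooth functions.
-/
lemma contMDiffAt_of_mulVec {n : Type*} [Fintype n] [DecidableEq n] {A : M → Matrix n n ℝ}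
    {c : M → n → ℝ} {x : M}
    (hA : ∀ i j, ContMDiffAt 𝓘(ℝ, DoubleModel m) 𝓘(ℝ, ℝ) ∞ (fun y => A y i j) x)
    (hAc : ∀ i, ContMDiffAt 𝓘(ℝ, DoubleModel m) 𝓘(ℝ, ℝ) ∞ (fun y => (A y).mulVec (c y) i) x)
    (hdet : (A x).det ≠ 0) (i : n) :
    ContMDiffAt 𝓘(ℝ, DoubleModel m) 𝓘(ℝ, ℝ) ∞ (fun y => c y i) x := by
  have hd := contMDiffAt_det hA
  have hadj : ContMDiffAt 𝓘(ℝ, DoubleModel m) 𝓘(ℝ, ℝ) ∞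
      (fun y => ((A y).adjugate.mulVec ((A y).mulVec (c y)) i) / (A y).det) x := by
    refine ContMDiffAt.div₀ ?_ hd hdet
    change ContMDiffAt _ _ _ (fun y => ∑ j, (A y).adjugate i j * (A y).mulVec (c y) j) x
    refine contMDiffAt_finsetSum fun j _ => ContMDiffAt.mul ?_ (hAc j)
    simp only [Matrix.adjugate_apply]
    refine contMDiffAt_det fun k l => ?_
    by_cases h : k = j
    · subst h
      simpa using contMDiffAt_const
    · simpa [Matrix.updateRow_ne h] using hA k l
  refine hadj.congr_of_eventuallyEq ?_
  filter_upwards [hd.continuousAt.eventually_ne hdet] with y hy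
  rw [Matrix.mulVec_mulVec, Matrix.adjugate_mul, Matrix.smul_mulVec, Matrix.one_mulVec,
    Pi.smul_apply, smul_eq_mul, mul_div_cancel_left₀ _ hy]

variable [DoubleManifold m M] [T2Space M]

lemma IsFlatFrame.dual {b : Fin m ⊕ Fin m → VField m M} {x₀ : M} (hb : IsFlatFrame b x₀) :
    ∀ᶠ y in 𝓝 x₀, ∀ k l, gam (b k y) (b l y) = if l = k.swap then 1 else 0 := by
  filter_upwards [hb.eq_constField,
    (chartAt (DoubleModel m) x₀).open_source.mem_nhds (mem_chart_source _ x₀)] with y hy hs k l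
  rw [hy, hy, gam_constField hs, modelGam_modelBasis]

/-- Sections of `L` that have smooth products with the smooth sections of `L`, for a smooth
bilinear form which is non degenerate on `L`, are smooth. -/
lemma isSmoothVF_of_leafForm
    {β : Π x : M, TangentSpace 𝓘(ℝ, DoubleModel m) x → TangentSpace 𝓘(ℝ, DoubleModel m) x → ℝ}
    (hl : ∀ x w, IsLinearMap ℝ fun v => β x v w) (hr : ∀ x v, IsLinearMap ℝ (β x v))
    (hs : ∀ X Y : VField m M, DoubleField.IsSectionL X → DoubleField.IsSectionL Y →
      ContMDiff 𝓘(ℝ, DoubleModel m) 𝓘(ℝ, ℝ) ∞ fun y => β y (X y) (Y y))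
    (hn : ∀ x, ∀ v ∈ leafL x, (∀ w ∈ leafL x, β x v w = 0) → v = 0)
    {Y : VField m M} (hY : ∀ x, Y x ∈ leafL x)
    (h : ∀ Z : VField m M, DoubleField.IsSectionL Z →
      ContMDiff 𝓘(ℝ, DoubleModel m) 𝓘(ℝ, ℝ) ∞ fun y => β y (Y y) (Z y)) : IsSmoothVF Y := by
  intro x
  obtain ⟨b, hb⟩ := exists_isFlatFrame m x
  have hbL : ∀ i, DoubleField.IsSectionL (b (Sum.inl i)) :=
    fun i => ⟨hb.smooth _, hb.inl_mem i⟩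
  -- The components of `Y` in the frame of `L` solve a linear system with this matrix; its
  -- right-hand side is smooth by `h`, and it is invertible at `x` by non degeneracy.
  let A : M → Matrix (Fin m) (Fin m) ℝ :=
    fun y => Matrix.of fun j i => β y (b (Sum.inl i) y) (b (Sum.inl j) y)
  have hA : ∀ y (c : Fin m → ℝ) j, (A y).mulVec c j =
      β y (∑ i, c i • b (Sum.inl i) y) (b (Sum.inl j) y) := by
    intro y c j
    change _ = (hl y (b (Sum.inl j) y)).mk' _ _
    simp [Matrix.mulVec, dotProduct, A, mul_comm]
  have hdet : (A x).det ≠ 0 := by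
    rw [← isUnit_iff_ne_zero, ← Matrix.isUnit_iff_isUnit_det,
      ← Matrix.mulVec_injective_iff_isUnit, ← Matrix.coe_mulVecLin, ← LinearMap.ker_eq_bot,
      LinearMap.ker_eq_bot']
    intro c hc
    have hv : ∑ i, c i • b (Sum.inl i) x = 0 := by
      refine hn x _ ((leafLSub x).sum_mem fun i _ => smul_mem_leafL _ (hb.inl_mem i x))
        fun w hw => ?_
      change (hr x _).mk' _ w = 0
      rw [hb.expand_leafL.self_of_nhds w hw, map_sum]
      refine Finset.sum_eq_zero fun j _ => ?_
      rw [map_smul, IsLinearMap.mk'_apply, ← hA x c j]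
      have := congrFun hc j
      simp only [Matrix.mulVecLin_apply, Pi.zero_apply] at this
      rw [this, smul_zero]
    funext i
    have h1 : gam (∑ k, c k • b (Sum.inl k) x) (b (Sum.inr i) x) = c i := by
      simp [gam_sum_left, hb.dual.self_of_nhds]
    rw [← h1, hv, gam_zero_left, Pi.zero_apply]
  -- Products with frame fields in `L` vanish by isotropy; those with frame fields in `L̃` are the
  -- unknowns of the linear system.
  refine smoothVFAt_of_gam_frame hb fun k => ?_
  rcases k with k | k
  · simp only [gam_leafL_leafL (hY _) (hb.inl_mem _ _)]
    exact contMDiffAt_const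
  · refine contMDiffAt_of_mulVec (A := A) (c := fun y i => gam (Y y) (b (Sum.inr i) y))
      (fun i j => hs _ _ (hbL j) (hbL i) x) (fun j => ?_) hdet k
    refine (h _ (hbL j) x).congr_of_eventuallyEq ?_
    filter_upwards [hb.expand_leafL] with y hy
    rw [hA, ← hy _ (hY y)]

namespace DoubleField

variable (φ : DoubleField m M)

lemma isSectionL_pS (ε : ℝ) {X : VField m M} (hX : IsSmoothVF X) :
    IsSectionL fun y => φ.pS ε (X y) := by
  refine ⟨isSmoothVF_of_leafForm (β := fun x v w => φ.g x v w)
    (fun x w => ⟨fun _ _ => by simp, fun _ _ => by simp⟩)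
    (fun x w => ⟨fun _ _ => by simp, fun _ _ => by simp⟩)
    (fun X Y hX hY => φ.g_contMDiff hX.1 hY.1) φ.nondeg_g (fun y => φ.pS_mem _ _)
    fun Z hZ => ?_, fun y => φ.pS_mem _ _⟩
  simp only [φ.g_pS _ _ (hZ.2 _)]
  exact contMDiff_const.mul ((φ.g_contMDiff hX hZ.1).sub (contMDiff_const.mul
    ((φ.B_contMDiff hX hZ.1).sub (gam_contMDiff hX hZ.1))))

lemma isSectionS_prS (ε : ℝ) {X : VField m M} (hX : IsSmoothVF X) :
    φ.IsSectionS ε fun y => φ.prS ε (X y) :=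
  φ.isSectionS_iota ε (φ.isSectionL_pS ε hX)

lemma exists_extend_bundleS {ε : ℝ} {x : M} {v : TangentSpace 𝓘(ℝ, DoubleModel m) x}
    (hv : v ∈ φ.bundleS ε x) : ∃ V : VField m M, φ.IsSectionS ε V ∧ V x = v := by
  obtain ⟨w, hw, rfl⟩ := hv
  obtain ⟨W, hW, rfl⟩ := exists_extend_leafL hw
  exact ⟨_, φ.isSectionS_iota ε hW, rfl⟩

end DoubleField

end LeafForm

/-- Trilinear functions. -/
structure IsTrilinear {E : Type*} [AddCommGroup E] [Module ℝ E] (A : E → E → E → ℝ) : Prop where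
  fst : ∀ v w, IsLinearMap ℝ fun u => A u v w
  snd : ∀ u w, IsLinearMap ℝ fun v => A u v w
  thd : ∀ u v, IsLinearMap ℝ fun w => A u v w

/-! ### The Gualtieri torsion as a totally skew tensor. -/

section Torsion

variable {m : ℕ} {M : Type*} [TopologicalSpace M] [ChartedSpace (DoubleModel m) M]
  [IsManifold 𝓘(ℝ, DoubleModel m) ∞ M] {x : M}

lemma gam_wedge {D : VField m M → Π x : M, TangentSpace 𝓘(ℝ, DoubleModel m) x →
    TangentSpace 𝓘(ℝ, DoubleModel m) x} (hD : ∀ X, IsLinearMap ℝ (D X x)) (X Y : VField m M)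
    (z : TangentSpace 𝓘(ℝ, DoubleModel m) x) : gam (wedge D X Y x) z =
      (1 / 2) * (gam (X x) (D Y x z) - gam (Y x) (D X x z)) := by
  rw [wedge, gam_sharpGam]
  exact ⟨fun _ _ => by simp only [(hD _).map_add, gam_add_right]; ring,
    fun _ _ => by simp only [(hD _).map_smul, gam_smul_right, smul_eq_mul]; ring⟩

/-- The connection preserves `γ`. -/
def PreservesGam (D : Conn m M) : Prop :=
  ∀ X Y Z : VField m M, IsSmoothVF X → IsSmoothVF Y → IsSmoothVF Z → ∀ x,
    dirDeriv (fun y => gam (X y) (Y y)) x (Z x)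
      = gam (D X x (Z x)) (Y x) + gam (X x) (D Y x (Z x))

lemma isLinearMap_flatD (X : VField m M) (x : M) : IsLinearMap ℝ (flatD X x) :=
  ⟨map_add (flatConn m M X x), map_smul (flatConn m M X x)⟩

lemma gam_cbr (X Y : VField m M) (z : TangentSpace 𝓘(ℝ, DoubleModel m) x) :
    gam (cbr X Y x) z = gam (flatD Y x (X x)) z - gam (flatD X x (Y x)) z
      - (1 / 2) * (gam (X x) (flatD Y x z) - gam (Y x) (flatD X x z)) := by
  rw [cbr, gam_sub_left, gam_sub_left, gam_wedge (fun X => isLinearMap_flatD X x)]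

lemma gTorsion_eq (D : Conn m M) (X Y Z : VField m M) (x : M) :
    gTorsion D X Y Z x = gam (D Y x (X x)) (Z x) - gam (D X x (Y x)) (Z x)
      - gam (cbr X Y x) (Z x)
      - (1 / 2) * (gam (X x) (D Y x (Z x)) - gam (Y x) (D X x (Z x))) := by
  rw [gTorsion, modTorsion, modBr, gam_sub_left, gam_sub_left, gam_add_left,
    gam_wedge (D := fun Y x v => D Y x v) (fun X => ⟨map_add (D X x), map_smul (D X x)⟩)]
  ring

variable [DoubleManifold m M]

lemma preservesGam_flatConn : PreservesGam (flatConn m M) :=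
  fun _ _ _ hX hY _ x => dirDeriv_gam (hX.diff x) (hY.diff x) _

/-- Using that `D` preserves `γ` to make the first three `D`-terms cyclic leaves the derivatives
`-Y(γ(Z,X)) - ½ Z(γ(X,Y))`. Since `∇⁰` preserves `γ` too, the last two brackets and the derivative
terms of `cycBracket` add up to `Y(γ(Z,X)) + ½ Z(γ(X,Y))`, which accounts for them. -/
lemma gTorsion_eq_cycSum_sub_cycBracket {D : Conn m M} (hD : PreservesGam D) {X Y Z : VField m M}
    (hX : IsSmoothVF X) (hY : IsSmoothVF Y) (hZ : IsSmoothVF Z) (x : M) :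
    gTorsion D X Y Z x = cycSum D X Y Z x - cycBracket X Y Z x := by
  have e1 := dirDeriv_gam (hX.diff x) (hY.diff x) (Z x)
  have e2 := dirDeriv_gam (hY.diff x) (hZ.diff x) (X x)
  have e3 := dirDeriv_gam (hZ.diff x) (hX.diff x) (Y x)
  have d1 := hD X Y Z hX hY hZ x
  have d2 := hD Y Z X hY hZ hX x
  have d3 := hD Z X Y hZ hX hY x
  rw [gTorsion_eq, cycSum, cycBracket]
  simp only [gam_cbr]
  rw [gam_comm (X x)] at e1 d1
  rw [gam_comm (Y x)] at e2 d2
  rw [gam_comm (Z x)] at e3 d3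
  simp only [gam_comm (X x), gam_comm (Y x), gam_comm (Z x)] at *
  linarith

/-- The bracket is built from `∇⁰` so that the Gualtieri torsion of `∇⁰` is zero; the preceding
identity then gives the claim. -/
lemma cycSum_flatConn {X Y Z : VField m M} (hX : IsSmoothVF X) (hY : IsSmoothVF Y)
    (hZ : IsSmoothVF Z) (x : M) : cycSum (flatConn m M) X Y Z x = cycBracket X Y Z x := by
  have h := gTorsion_eq_cycSum_sub_cycBracket preservesGam_flatConn hX hY hZ x
  rw [gTorsion_eq, gam_cbr] at h
  simp only [flatConn_apply] at h
  linarith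

/-- The tensor `γ((D - ∇⁰)_u v, w)`. -/
def flatDiff (D : Conn m M) (x : M) (u v w : TangentSpace 𝓘(ℝ, DoubleModel m) x) : ℝ :=
  gam (CovariantDerivative.difference D (flatConn m M) x v u) w

lemma flatDiff_apply (D : Conn m M) {Y : VField m M} (hY : IsSmoothVF Y)
    (u w : TangentSpace 𝓘(ℝ, DoubleModel m) x) :
    flatDiff D x u (Y x) w = gam (D Y x u) w - gam (flatD Y x u) w := by
  have h : CovariantDerivative.difference D (flatConn m M) x (Y x) =
      D Y x - flatConn m M Y x :=
    IsCovariantDerivativeOn.difference_apply D.isCovariantDerivativeOnUniv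
      (flatConn m M).isCovariantDerivativeOnUniv trivial (hY.diff x)
  rw [flatDiff, h, sub_apply, gam_sub_left, flatConn_apply]

lemma isTrilinear_flatDiff (D : Conn m M) (x : M) : IsTrilinear (flatDiff D x) where
  fst _ _ := ⟨fun _ _ => by simp [flatDiff], fun _ _ => by simp [flatDiff]⟩
  snd _ _ := ⟨fun _ _ => by simp [flatDiff], fun _ _ => by simp [flatDiff]⟩
  thd _ _ := ⟨fun _ _ => by simp [flatDiff], fun _ _ => by simp [flatDiff]⟩

/-- The Gualtieri torsion, as a tensor. -/
def torsionTensor (D : Conn m M) (x : M) (u v w : TangentSpace 𝓘(ℝ, DoubleModel m) x) : ℝ :=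
  flatDiff D x u v w + flatDiff D x v w u + flatDiff D x w u v

lemma isTrilinear_torsionTensor (D : Conn m M) (x : M) : IsTrilinear (torsionTensor D x) where
  fst _ _ := ⟨fun _ _ => by simp [torsionTensor, flatDiff]; ring,
    fun _ _ => by simp [torsionTensor, flatDiff]; ring⟩
  snd _ _ := ⟨fun _ _ => by simp [torsionTensor, flatDiff]; ring,
    fun _ _ => by simp [torsionTensor, flatDiff]; ring⟩
  thd _ _ := ⟨fun _ _ => by simp [torsionTensor, flatDiff]; ring,
    fun _ _ => by simp [torsionTensor, flatDiff]; ring⟩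

lemma torsionTensor_cyc (D : Conn m M) (u v w : TangentSpace 𝓘(ℝ, DoubleModel m) x) :
    torsionTensor D x u v w = torsionTensor D x v w u := by
  simp only [torsionTensor]; ring

/-- The torsion is the cyclic sum of `D` minus that of `∇⁰`, in which only the difference tensor
survives. This makes the torsion pointwise. -/
lemma gTorsion_eq_torsionTensor {D : Conn m M} (hD : PreservesGam D) {X Y Z : VField m M}
    (hX : IsSmoothVF X) (hY : IsSmoothVF Y) (hZ : IsSmoothVF Z) (x : M) :
    gTorsion D X Y Z x = torsionTensor D x (X x) (Y x) (Z x) := by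
  rw [gTorsion_eq_cycSum_sub_cycBracket hD hX hY hZ, ← cycSum_flatConn hX hY hZ, torsionTensor,
    flatDiff_apply D hX, flatDiff_apply D hY, flatDiff_apply D hZ, cycSum, cycSum]
  simp only [flatConn_apply]
  ring

variable [T2Space M]

/-- Both connections preserve `γ`, so their difference takes values in the `γ`-skew endomorphisms.
-/
lemma flatDiff_skew {D : Conn m M} (hD : PreservesGam D)
    (u v w : TangentSpace 𝓘(ℝ, DoubleModel m) x) : flatDiff D x u w v = -flatDiff D x u v w := by
  obtain ⟨U, hU, rfl⟩ := exists_extend u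
  obtain ⟨V, hV, rfl⟩ := exists_extend v
  obtain ⟨W, hW, rfl⟩ := exists_extend w
  have h1 := dirDeriv_gam (hV.diff x) (hW.diff x) (U x)
  have h2 := hD V W U hV hW hU x
  rw [gam_comm (V x)] at h1 h2
  rw [flatDiff_apply D hW, flatDiff_apply D hV]
  linarith

/-- The cyclic sum of a tensor that is skew in two arguments is totally skew. -/
lemma torsionTensor_skew {D : Conn m M} (hD : PreservesGam D)
    (u v w : TangentSpace 𝓘(ℝ, DoubleModel m) x) :
    torsionTensor D x v u w = -torsionTensor D x u v w := by
  simp only [torsionTensor]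
  rw [flatDiff_skew hD v w u, flatDiff_skew hD u v w, flatDiff_skew hD w u v]
  ring

lemma torsionTensor_skew' {D : Conn m M} (hD : PreservesGam D)
    (u v w : TangentSpace 𝓘(ℝ, DoubleModel m) x) :
    torsionTensor D x u w v = -torsionTensor D x u v w := by
  rw [torsionTensor_cyc D u w v, torsionTensor_skew hD v w u, ← torsionTensor_cyc D u v w]

lemma Conn.same_of_gam {D D' : Conn m M}
    (h : ∀ X Y Z : VField m M, IsSmoothVF X → IsSmoothVF Y → IsSmoothVF Z → ∀ x,
      gam (D Y x (X x)) (Z x) = gam (D' Y x (X x)) (Z x)) : D.Same D' := by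
  intro Y hY x
  refine ContinuousLinearMap.ext fun u => eq_of_forall_gam fun z => ?_
  obtain ⟨U, hU, rfl⟩ := exists_extend u
  obtain ⟨Z, hZ, rfl⟩ := exists_extend z
  exact h U Y Z hU hY hZ x

omit [DoubleManifold m M] [T2Space M] in
-- A totally skew `Ψ` is its own alternation and a third of its cyclic sum, and the cyclic sum of
-- `Ψ` is the difference of those of the two connections.
lemma three_mul_alt3_covDef {D D₁ : Conn m M} (h : TotallySkew (covDef D D₁)) {X Y Z : VField m M}
    (hX : IsSmoothVF X) (hY : IsSmoothVF Y) (hZ : IsSmoothVF Z) (x : M) :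
    3 * alt3 (covDef D D₁) X Y Z x = 3 * covDef D D₁ X Y Z x ∧
      3 * covDef D D₁ X Y Z x = cycSum D X Y Z x - cycSum D₁ X Y Z x := by
  have h1 := h X Y Z hX hY hZ x
  have h2 := (h Y X Z hY hX hZ x).2
  have h3 := (h X Z Y hX hZ hY x).1
  have h4 := (h Z X Y hZ hX hY x).2
  have h5 : cycSum D X Y Z x - cycSum D₁ X Y Z x =
      covDef D D₁ X Y Z x + covDef D D₁ Y Z X x + covDef D D₁ Z X Y x := by
    simp only [cycSum, covDef, gam_sub_left]; ring
  rw [h5, alt3]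
  constructor <;> linarith [h1.1, h1.2]

lemma deformationEq_iff {D D₁ : Conn m M} (hD : PreservesGam D)
    (h : TotallySkew (covDef D D₁)) : DeformationEq D D₁ ↔ ZeroGTorsion D := by
  refine forall₃_congr fun X Y Z => forall₄_congr fun hX hY hZ x => ?_
  obtain ⟨h1, h2⟩ := three_mul_alt3_covDef h hX hY hZ x
  rw [h1, h2, gTorsion_eq_cycSum_sub_cycBracket hD hX hY hZ]
  constructor <;> intro h <;> linarith

/-- The connection `D + A`, for a tensor field `A`. -/
def Conn.addTensor (D : Conn m M)
    {A : Π x : M, TangentSpace 𝓘(ℝ, DoubleModel m) x → TangentSpace 𝓘(ℝ, DoubleModel m) x →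
      TangentSpace 𝓘(ℝ, DoubleModel m) x → ℝ} (hA : ∀ x, IsTrilinear (A x)) : Conn m M :=
  CovariantDerivative.addOneForm D fun x => LinearMap.toContinuousLinearMap <|
    LinearMap.toContinuousLinearMap.toLinearMap ∘ₗ LinearMap.mk₂ ℝ
      -- The one-form takes the differentiated vector `v` first and the direction `u` second,
      -- whereas `A` takes the direction first.
      (fun v u => sharpGam (A x u v))
      (fun _ _ _ => eq_of_forall_gam fun z => by
        simp only [gam_add_left, gam_sharpGam ((hA x).thd _ _), ((hA x).snd _ _).map_add])
      (fun _ _ _ => eq_of_forall_gam fun z => by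
        simp only [gam_smul_left, gam_sharpGam ((hA x).thd _ _), ((hA x).snd _ _).map_smul,
          smul_eq_mul])
      (fun _ _ _ => eq_of_forall_gam fun z => by
        simp only [gam_add_left, gam_sharpGam ((hA x).thd _ _), ((hA x).fst _ _).map_add])
      (fun _ _ _ => eq_of_forall_gam fun z => by
        simp only [gam_smul_left, gam_sharpGam ((hA x).thd _ _), ((hA x).fst _ _).map_smul,
          smul_eq_mul])

variable {A : Π x : M, TangentSpace 𝓘(ℝ, DoubleModel m) x →
  TangentSpace 𝓘(ℝ, DoubleModel m) x → TangentSpace 𝓘(ℝ, DoubleModel m) x → ℝ}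
  (hA : ∀ x, IsTrilinear (A x))

lemma gam_addTensor (D : Conn m M) (Y : VField m M) (x : M)
    (u w : TangentSpace 𝓘(ℝ, DoubleModel m) x) :
    gam (D.addTensor hA Y x u) w = gam (D Y x u) w + A x u (Y x) w := by
  rw [← gam_sharpGam ((hA x).thd u (Y x)), ← gam_add_left]
  rfl

lemma addTensor_smooth {D : Conn m M}
    (hD : CovariantDerivative.ContMDiffCovariantDerivative D ∞)
    (hs : ∀ X Y Z : VField m M, IsSmoothVF X → IsSmoothVF Y → IsSmoothVF Z →
      ContMDiff 𝓘(ℝ, DoubleModel m) 𝓘(ℝ, ℝ) ∞ fun y => A y (X y) (Y y) (Z y)) :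
    CovariantDerivative.ContMDiffCovariantDerivative (D.addTensor hA) ∞ := by
  refine conn_smooth_of_apply fun Y V hY hV => isSmoothVF_of_gam fun W hW => ?_
  simp only [gam_addTensor]
  exact (gam_contMDiff (conn_apply_smooth hD hY hV) hW).add (hs _ _ _ hV hY hW)

lemma flatDiff_contMDiff {D : Conn m M}
    (hD : CovariantDerivative.ContMDiffCovariantDerivative D ∞) {X Y Z : VField m M}
    (hX : IsSmoothVF X) (hY : IsSmoothVF Y) (hZ : IsSmoothVF Z) :
    ContMDiff 𝓘(ℝ, DoubleModel m) 𝓘(ℝ, ℝ) ∞ fun y => flatDiff D y (X y) (Y y) (Z y) := by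
  simp only [flatDiff_apply D hY]
  exact (gam_contMDiff (conn_apply_smooth hD hY hX) hZ).sub
    (gam_contMDiff (flatD_smooth hY hX) hZ)

lemma torsionTensor_contMDiff {D : Conn m M}
    (hD : CovariantDerivative.ContMDiffCovariantDerivative D ∞) {X Y Z : VField m M}
    (hX : IsSmoothVF X) (hY : IsSmoothVF Y) (hZ : IsSmoothVF Z) :
    ContMDiff 𝓘(ℝ, DoubleModel m) 𝓘(ℝ, ℝ) ∞ fun y => torsionTensor D y (X y) (Y y) (Z y) :=
  ((flatDiff_contMDiff hD hX hY hZ).add (flatDiff_contMDiff hD hY hZ hX)).add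
    (flatDiff_contMDiff hD hZ hX hY)

end Torsion

/-! ### Double-metric connections, the VTC connection and the equations on `L`. -/

namespace DoubleField

variable {m : ℕ} {M : Type*} [TopologicalSpace M] [ChartedSpace (DoubleModel m) M]
  [IsManifold 𝓘(ℝ, DoubleModel m) ∞ M] [DoubleManifold m M] [T2Space M] (φ : DoubleField m M)
  {x : M} {ε : ℝ}

lemma genMetric_eq_left (v w : TangentSpace 𝓘(ℝ, DoubleModel m) x) :
    φ.genMetric v w = gam v (φ.prS 1 w - φ.prS (-1) w) := by
  rw [genMetric, φ.gam_prS_left (.inl rfl), φ.gam_prS_left (.inr rfl), gam_sub_right,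
    φ.prS_eq_self (.inl rfl) (φ.prS_mem 1 w), φ.prS_eq_self (.inr rfl) (φ.prS_mem (-1) w)]

lemma genMetric_comm (v w : TangentSpace 𝓘(ℝ, DoubleModel m) x) :
    φ.genMetric v w = φ.genMetric w v := by
  simp only [genMetric, gam_comm]

lemma genMetric_of_mem (hε : ε = 1 ∨ ε = -1) (v : TangentSpace 𝓘(ℝ, DoubleModel m) x)
    {w : TangentSpace 𝓘(ℝ, DoubleModel m) x} (hw : w ∈ φ.bundleS ε x) :
    φ.genMetric v w = ε * gam v w := by
  have h1 := φ.prS_eq_self hε hw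
  have h2 := φ.prS_opp_eq_zero hε hw
  rw [genMetric_eq_left]
  rcases hε with rfl | rfl
  · simp [h1, h2]
  · rw [neg_neg] at h2
    simp [h1, h2]

variable {φ}

lemma IsDoubleMetric.preservesGam {D : Conn m M} (hD : φ.IsDoubleMetric D) : PreservesGam D :=
  hD.preserves_gam

/-- For `W` in `S_{-ε}` both `γ(Y, W)` and `ℋ(Y, W)` vanish. Differentiating gives `a + b = 0` and
`ε (b - a) = 0` with `a = γ(D Y, W)`, `b = γ(Y, D W)`; so `a = 0`, and `D` preserves `S_ε`. -/
lemma IsDoubleMetric.apply_mem {D : Conn m M} (hD : φ.IsDoubleMetric D) (hε : ε = 1 ∨ ε = -1)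
    {Y : VField m M} (hY : φ.IsSectionS ε Y) (x : M) (v : TangentSpace 𝓘(ℝ, DoubleModel m) x) :
    D Y x v ∈ φ.bundleS ε x := by
  have hε' : -ε = 1 ∨ -ε = -1 := by rcases hε with rfl | rfl <;> norm_num
  refine φ.mem_bundleS_of_gam hε fun w hw => ?_
  obtain ⟨W, hW, rfl⟩ := φ.exists_extend_bundleS hw
  obtain ⟨V, hV, rfl⟩ := exists_extend v
  have h1 := hD.preserves_gam Y W V hY.1 hW.1 hV x
  have h2 := hD.preserves_genMetric Y W V hY.1 hW.1 hV x
  have e1 : (fun y => gam (Y y) (W y)) = fun _ => 0 :=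
    funext fun y => φ.gam_bundleS_opp (hY.2 y) (hW.2 y)
  have e2 : (fun y => φ.genMetric (Y y) (W y)) = fun _ => 0 := funext fun y => by
    rw [φ.genMetric_of_mem hε' _ (hW.2 y), φ.gam_bundleS_opp (hY.2 y) (hW.2 y), mul_zero]
  rw [e1] at h1
  rw [e2, φ.genMetric_of_mem hε' _ (hW.2 x), φ.genMetric_comm (Y x),
    φ.genMetric_of_mem hε _ (hY.2 x)] at h2
  rw [dirDeriv, mvfderiv_const, zero_apply] at h1 h2
  rw [gam_comm (Y x)] at h1
  rcases hε with rfl | rfl <;> linarith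

/-- The endomorphism associated with `A u` is block diagonal along `S_+ ⊕ S_-`, hence commutes with
the projections; this is what preserving `ℋ` requires. -/
lemma trilinear_prS {A : TangentSpace 𝓘(ℝ, DoubleModel m) x → TangentSpace 𝓘(ℝ, DoubleModel m) x →
    TangentSpace 𝓘(ℝ, DoubleModel m) x → ℝ} (hA : IsTrilinear A)
    (hsk : ∀ u v w, A u w v = -A u v w)
    (hS : ∀ u, ∀ v ∈ φ.bundleS 1 x, ∀ w ∈ φ.bundleS (-1) x, A u v w = 0)
    (hε : ε = 1 ∨ ε = -1) (u v w : TangentSpace 𝓘(ℝ, DoubleModel m) x) :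
    A u v (φ.prS ε w) = A u (φ.prS ε v) w := by
  have hS' : ∀ a b, A u (φ.prS ε a) (φ.prS (-ε) b) = 0 ∧ A u (φ.prS (-ε) a) (φ.prS ε b) = 0 := by
    have h := fun a b => hS u _ (φ.prS_mem 1 a) _ (φ.prS_mem (-1) b)
    have h' := fun a b => hsk u (φ.prS 1 a) (φ.prS (-1) b)
    rcases hε with rfl | rfl
    · exact fun a b => ⟨h a b, by rw [h', h, neg_zero]⟩
    · rw [neg_neg]
      exact fun a b => ⟨by rw [h', h, neg_zero], h a b⟩
  conv_lhs => rw [← φ.prS_add_prS_neg hε v, (hA.snd u _).map_add, (hS' v w).2]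
  conv_rhs => rw [← φ.prS_add_prS_neg hε w, (hA.thd u _).map_add, (hS' v w).1]

lemma IsDoubleMetric.addTensor {D : Conn m M} (hD : φ.IsDoubleMetric D)
    {A : Π x : M, TangentSpace 𝓘(ℝ, DoubleModel m) x →
      TangentSpace 𝓘(ℝ, DoubleModel m) x → TangentSpace 𝓘(ℝ, DoubleModel m) x → ℝ}
    (hA : ∀ x, IsTrilinear (A x))
    (hs : ∀ X Y Z : VField m M, IsSmoothVF X → IsSmoothVF Y → IsSmoothVF Z →
      ContMDiff 𝓘(ℝ, DoubleModel m) 𝓘(ℝ, ℝ) ∞ fun y => A y (X y) (Y y) (Z y))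
    (hsk : ∀ x u v w, A x u w v = -A x u v w)
    (hS : ∀ x u, ∀ v ∈ φ.bundleS 1 x, ∀ w ∈ φ.bundleS (-1) x, A x u v w = 0) :
    φ.IsDoubleMetric (D.addTensor hA) where
  smooth := addTensor_smooth hA hD.smooth hs
  preserves_gam X Y Z hX hY hZ x := by
    rw [hD.preserves_gam X Y Z hX hY hZ, gam_comm (X x), gam_comm (X x), gam_addTensor,
      gam_addTensor, hsk x (Z x) (X x) (Y x)]
    ring
  preserves_genMetric X Y Z hX hY hZ x := by
    rw [hD.preserves_genMetric X Y Z hX hY hZ, φ.genMetric_comm (X x), φ.genMetric_comm (X x)]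
    simp only [genMetric_eq_left, gam_addTensor]
    have h1 := trilinear_prS (hA x) (hsk x) (hS x) (.inl rfl) (Z x) (X x) (Y x)
    have h2 := trilinear_prS (hA x) (hsk x) (hS x) (.inr rfl) (Z x) (X x) (Y x)
    have h3 := hsk x (Z x) (φ.prS 1 (X x)) (Y x)
    have h4 := hsk x (Z x) (φ.prS (-1) (X x)) (Y x)
    rw [((hA x).thd _ _).map_sub, ((hA x).thd _ _).map_sub]
    linarith

lemma IsCWT.torsionTensor_mixed {D : Conn m M} (hD : φ.IsCWT D) (hε : ε = 1 ∨ ε = -1)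
    {u v w : TangentSpace 𝓘(ℝ, DoubleModel m) x} (hu : u ∈ φ.bundleS (-ε) x)
    (hv : v ∈ φ.bundleS ε x) (hw : w ∈ φ.bundleS ε x) : torsionTensor D x u v w = 0 := by
  obtain ⟨U, hU, rfl⟩ := φ.exists_extend_bundleS hu
  obtain ⟨V, hV, rfl⟩ := φ.exists_extend_bundleS hv
  obtain ⟨W, hW, rfl⟩ := φ.exists_extend_bundleS hw
  rw [← gTorsion_eq_torsionTensor hD.doubleMetric.preservesGam hU.1 hV.1 hW.1]
  rcases hε with rfl | rfl
  · exact hD.mixed_plus U V W hU hV hW x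
  · rw [neg_neg] at hU
    exact hD.mixed_minus U V W hU hV hW x

/-- Splitting `u` along `S_+ ⊕ S_-` leaves two terms, each with exactly two arguments in one bundle;
a cyclic rotation makes each a mixed torsion. -/
lemma IsCWT.torsionTensor_eq_zero {D : Conn m M} (hD : φ.IsCWT D)
    (u : TangentSpace 𝓘(ℝ, DoubleModel m) x) {v w : TangentSpace 𝓘(ℝ, DoubleModel m) x}
    (hv : v ∈ φ.bundleS 1 x) (hw : w ∈ φ.bundleS (-1) x) : torsionTensor D x u v w = 0 := by
  rw [← φ.prS_add_prS u, ((isTrilinear_torsionTensor D x).fst _ _).map_add, ← torsionTensor_cyc,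
    hD.torsionTensor_mixed (.inl rfl) hw (φ.prS_mem _ _) hv, torsionTensor_cyc, zero_add]
  exact hD.torsionTensor_mixed (.inr rfl) (by rwa [neg_neg]) hw (φ.prS_mem _ _)

/-- Existence of the double-metric connection with zero Gualtieri torsion and totally skew
symmetric covariant deformation. -/
lemma IsCWT.exists_zeroGTorsion {D₁ : Conn m M} (h₁ : φ.IsCWT D₁) :
    ∃ D : Conn m M, φ.IsDoubleMetric D ∧ ZeroGTorsion D ∧ TotallySkew (covDef D D₁) := by
  have hm := h₁.doubleMetric
  have hg := hm.preservesGam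
  -- Adding a totally skew `A` changes the torsion by its cyclic sum `3 A`; hence the factor `-1/3`.
  have hA : ∀ x, IsTrilinear fun u v w => -(1 / 3) * torsionTensor D₁ x u v w := by
    intro x
    have h := isTrilinear_torsionTensor D₁ x
    exact
      { fst := fun v w => ⟨fun _ _ => by rw [(h.fst v w).map_add]; ring,
          fun _ _ => by rw [(h.fst v w).map_smul]; simp only [smul_eq_mul]; ring⟩
        snd := fun v w => ⟨fun _ _ => by rw [(h.snd v w).map_add]; ring,
          fun _ _ => by rw [(h.snd v w).map_smul]; simp only [smul_eq_mul]; ring⟩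
        thd := fun v w => ⟨fun _ _ => by rw [(h.thd v w).map_add]; ring,
          fun _ _ => by rw [(h.thd v w).map_smul]; simp only [smul_eq_mul]; ring⟩ }
  have hD : φ.IsDoubleMetric (D₁.addTensor hA) := by
    refine hm.addTensor hA (fun X Y Z hX hY hZ =>
      contMDiff_const.mul (torsionTensor_contMDiff hm.smooth hX hY hZ)) (fun x u v w => ?_)
      fun x u v hv w hw => ?_
    · rw [torsionTensor_skew' hg u v w]; ring
    · rw [h₁.torsionTensor_eq_zero u hv hw, mul_zero]
  have hcov : ∀ X Y Z x, covDef (D₁.addTensor hA) D₁ X Y Z x =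
      -(1 / 3) * torsionTensor D₁ x (X x) (Y x) (Z x) := by
    intro X Y Z x
    rw [covDef, gam_sub_left, gam_addTensor]
    ring
  refine ⟨D₁.addTensor hA, hD, fun X Y Z hX hY hZ x => ?_, fun X Y Z hX hY hZ x => ?_⟩
  · have h1 := gTorsion_eq_cycSum_sub_cycBracket hg hX hY hZ x
    rw [gTorsion_eq_torsionTensor hg hX hY hZ] at h1
    rw [gTorsion_eq_cycSum_sub_cycBracket hD.preservesGam hX hY hZ, cycSum]
    simp only [gam_addTensor]
    rw [cycSum] at h1
    rw [← torsionTensor_cyc D₁ (X x) (Y x) (Z x), torsionTensor_cyc D₁ (Z x) (X x) (Y x)]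
    linarith
  · rw [hcov, hcov, hcov, torsionTensor_skew hg, torsionTensor_skew' hg (X x) (Y x) (Z x)]
    constructor <;> ring

/-- Zero torsion gives `3 Ψ = cycBracket - cycSum D₁`, which involves `D₁` only. -/
lemma IsDoubleMetric.same_of_totallySkew {D D' D₁ : Conn m M} (hD : φ.IsDoubleMetric D)
    (hD' : φ.IsDoubleMetric D') (h : ZeroGTorsion D) (h' : ZeroGTorsion D')
    (hs : TotallySkew (covDef D D₁)) (hs' : TotallySkew (covDef D' D₁)) : D'.Same D := by
  refine Conn.same_of_gam fun X Y Z hX hY hZ x => ?_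
  have e1 := (three_mul_alt3_covDef hs hX hY hZ x).2
  have e2 := (three_mul_alt3_covDef hs' hX hY hZ x).2
  have e3 := gTorsion_eq_cycSum_sub_cycBracket hD.preservesGam hX hY hZ x
  have e4 := gTorsion_eq_cycSum_sub_cycBracket hD'.preservesGam hX hY hZ x
  rw [h X Y Z hX hY hZ] at e3
  rw [h' X Y Z hX hY hZ] at e4
  rw [covDef, gam_sub_left] at e1 e2
  linarith

lemma gam_iota_of_mem (hε : ε = 1 ∨ ε = -1) {v w : TangentSpace 𝓘(ℝ, DoubleModel m) x}
    (hv : v ∈ φ.bundleS ε x) (hw : w ∈ leafL x) :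
    gam v (φ.iota ε w) = 2 * ε * φ.g x (prL v) w := by
  rw [← φ.two_mul_g_pS hε v hw, ← φ.prL_prS, φ.prS_eq_self hε hv]

lemma dirDeriv_const_mul (c : ℝ) {f : M → ℝ}
    (hf : ContMDiff 𝓘(ℝ, DoubleModel m) 𝓘(ℝ, ℝ) ∞ f)
    (v : TangentSpace 𝓘(ℝ, DoubleModel m) x) :
    dirDeriv (fun y => c * f y) x v = c * dirDeriv f x v := by
  have hf' : MDifferentiableAt 𝓘(ℝ, DoubleModel m) 𝓘(ℝ, ℝ) f x :=
    (hf x).mdifferentiableAt (by simp)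
  rw [dirDeriv, dirDeriv, mvfderiv_fun_mul mdifferentiableAt_const hf', mvfderiv_const]
  simp

/-- Each product `γ` with a vector of `S_ε` becomes `2 ε g`, and the factor `½` in `ψ^±` leaves the
signs `ε`. That `D` preserves `S_ε` is what allows its terms to be written with `D^±`. -/
lemma IsDoubleMetric.leafExpr_eq {D : Conn m M} (hD : φ.IsDoubleMetric D)
    (hε : ε = 1 ∨ ε = -1) {X Y Z : VField m M} (hX : IsSectionL X) (hY : IsSectionL Y)
    (hZ : IsSectionL Z) (x : M) : φ.leafExpr ε D X Y Z x =
      (1 / 2) * (cycBracket (fun y => φ.iota ε (X y)) (fun y => φ.iota ε (Y y))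
        (fun y => φ.iota ε (Z y)) x - cycSum D (fun y => φ.iota ε (X y)) (fun y => φ.iota ε (Y y))
        (fun y => φ.iota ε (Z y)) x) := by
  have hX' := φ.isSectionS_iota ε hX
  have hY' := φ.isSectionS_iota ε hY
  have hZ' := φ.isSectionS_iota ε hZ
  rw [leafExpr, cycBracket, cycSum]
  simp only [restr, prL_prS]
  rw [gam_iota_of_mem hε (hD.apply_mem hε hY' x _) (hZ.2 x),
    gam_iota_of_mem hε (hD.apply_mem hε hZ' x _) (hX.2 x),
    gam_iota_of_mem hε (hD.apply_mem hε hX' x _) (hY.2 x),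
    ← φ.two_mul_g_pS hε _ (hX.2 x), ← φ.two_mul_g_pS hε _ (hY.2 x), ← φ.two_mul_g_pS hε _ (hZ.2 x)]
  simp only [φ.gam_iota_iota_same (hX.2 _) (hY.2 _), φ.gam_iota_iota_same (hY.2 _) (hZ.2 _),
    φ.gam_iota_iota_same (hZ.2 _) (hX.2 _)]
  rw [dirDeriv_const_mul _ (φ.g_contMDiff hX.1 hY.1), dirDeriv_const_mul _ (φ.g_contMDiff hY.1 hZ.1),
    dirDeriv_const_mul _ (φ.g_contMDiff hZ.1 hX.1)]
  ring

/-- After splitting along `S_+ ⊕ S_-`, two of the three arguments lie in the same bundle, and a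
cyclic rotation brings them to the last two places. -/
lemma trilinear_eq_zero {A : TangentSpace 𝓘(ℝ, DoubleModel m) x →
    TangentSpace 𝓘(ℝ, DoubleModel m) x → TangentSpace 𝓘(ℝ, DoubleModel m) x → ℝ}
    (hA : IsTrilinear A) (hc : ∀ u v w, A u v w = A v w u)
    (h : ∀ ε : ℝ, ε = 1 ∨ ε = -1 → ∀ u, ∀ v ∈ φ.bundleS ε x, ∀ w ∈ φ.bundleS ε x, A u v w = 0)
    (u v w : TangentSpace 𝓘(ℝ, DoubleModel m) x) : A u v w = 0 := by
  rw [← φ.prS_add_prS u, ← φ.prS_add_prS v, ← φ.prS_add_prS w]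
  have hp := h 1 (.inl rfl)
  have hq := h (-1) (.inr rfl)
  simp only [(hA.fst _ _).map_add, (hA.snd _ _).map_add, (hA.thd _ _).map_add]
  rw [hp _ _ (φ.prS_mem 1 v) _ (φ.prS_mem 1 w), hp _ _ (φ.prS_mem 1 v) _ (φ.prS_mem 1 w),
    hq _ _ (φ.prS_mem _ v) _ (φ.prS_mem _ w), hq _ _ (φ.prS_mem _ v) _ (φ.prS_mem _ w),
    ← hc (φ.prS (-1) w) (φ.prS 1 u), hp _ _ (φ.prS_mem 1 u) _ (φ.prS_mem 1 v),
    hc (φ.prS 1 u) (φ.prS (-1) v),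
    hp _ _ (φ.prS_mem 1 w) _ (φ.prS_mem 1 u),
    hc (φ.prS (-1) u) (φ.prS 1 v), hq _ _ (φ.prS_mem _ w) _ (φ.prS_mem _ u),
    ← hc (φ.prS 1 w) (φ.prS (-1) u), hq _ _ (φ.prS_mem _ u) _ (φ.prS_mem _ v)]
  ring

/-- The equations on `L` are half of `DeformationEq` evaluated on `ι_±` of sections. For the
converse, `DeformationEq` is zero torsion of `D`, checked separately on unmixed and mixed triples.
-/
lemma IsCWT.deformationEq_iff_leaf {D D₁ : Conn m M} (h₁ : φ.IsCWT D₁) (hD : φ.IsDoubleMetric D)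
    (hs : TotallySkew (covDef D D₁)) : DeformationEq D D₁ ↔ φ.LeafDeformationEq D D₁ := by
  have hm := h₁.doubleMetric
  have key : ∀ ε : ℝ, ε = 1 ∨ ε = -1 → ∀ X Y Z : VField m M,
      IsSectionL X → IsSectionL Y → IsSectionL Z → ∀ x,
      (3 * alt3 (fun X Y Z x => (1 / 2) * covDef D D₁ (fun y => φ.iota ε (X y))
        (fun y => φ.iota ε (Y y)) (fun y => φ.iota ε (Z y)) x) X Y Z x
          = φ.leafExpr ε D₁ X Y Z x ↔
        3 * alt3 (covDef D D₁) (fun y => φ.iota ε (X y)) (fun y => φ.iota ε (Y y))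
          (fun y => φ.iota ε (Z y)) x = cycBracket (fun y => φ.iota ε (X y))
            (fun y => φ.iota ε (Y y)) (fun y => φ.iota ε (Z y)) x -
          cycSum D₁ (fun y => φ.iota ε (X y)) (fun y => φ.iota ε (Y y))
            (fun y => φ.iota ε (Z y)) x) := by
    intro ε hε X Y Z hX hY hZ x
    rw [hm.leafExpr_eq hε hX hY hZ x]
    simp only [alt3]
    constructor <;> intro h <;> linarith
  constructor
  · intro h ε hε X Y Z hX hY hZ x
    exact (key ε hε X Y Z hX hY hZ x).2 (h _ _ _ (φ.isSmoothVF_iota ε hX.1)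
      (φ.isSmoothVF_iota ε hY.1) (φ.isSmoothVF_iota ε hZ.1) x)
  · intro h
    rw [deformationEq_iff hD.preservesGam hs]
    intro X Y Z hX hY hZ x
    rw [gTorsion_eq_torsionTensor hD.preservesGam hX hY hZ]
    refine trilinear_eq_zero (φ := φ) (isTrilinear_torsionTensor D x) (torsionTensor_cyc D)
      (fun ε hε u v hv w hw => ?_) _ _ _
    have hε' : -ε = 1 ∨ -ε = -1 := by rcases hε with rfl | rfl <;> norm_num
    rw [← φ.prS_add_prS_neg hε u, ((isTrilinear_torsionTensor D x).fst _ _).map_add]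
    have hsame : torsionTensor D x (φ.prS ε u) v w = 0 := by
      obtain ⟨v, hv, rfl⟩ := hv
      obtain ⟨w, hw, rfl⟩ := hw
      rw [prS_eq]
      obtain ⟨U, hU, hU'⟩ := exists_extend_leafL (φ.pS_mem ε u)
      obtain ⟨V, hV, rfl⟩ := exists_extend_leafL hv
      obtain ⟨W, hW, rfl⟩ := exists_extend_leafL hw
      rw [← hU']
      have hU1 := φ.isSmoothVF_iota ε hU.1
      have hV1 := φ.isSmoothVF_iota ε hV.1
      have hW1 := φ.isSmoothVF_iota ε hW.1
      have e1 := (key ε hε U V W hU hV hW x).1 (h ε hε U V W hU hV hW x)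
      obtain ⟨e2, e3⟩ := three_mul_alt3_covDef hs hU1 hV1 hW1 x
      have e4 := gTorsion_eq_cycSum_sub_cycBracket hD.preservesGam hU1 hV1 hW1 x
      rw [gTorsion_eq_torsionTensor hD.preservesGam hU1 hV1 hW1] at e4
      rw [e4]
      linarith
    -- Both connections preserve `S_ε`, so `Ψ(V, W, U) = 0` for `U` in `S_{-ε}`. By skewness `Ψ(U,
    -- V, W) = 0`; the torsion of `D` then equals the mixed torsion of `D₁`, which is zero.
    have hmixed : torsionTensor D x (φ.prS (-ε) u) v w = 0 := by
      have e0 := h₁.torsionTensor_mixed hε (φ.prS_mem (-ε) u) hv hw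
      obtain ⟨V, hV, rfl⟩ := φ.exists_extend_bundleS hv
      obtain ⟨W, hW, rfl⟩ := φ.exists_extend_bundleS hw
      obtain ⟨U, hU, hU'⟩ := φ.exists_extend_bundleS (φ.prS_mem (-ε) u)
      rw [← hU'] at e0 ⊢
      have e1 := gTorsion_eq_cycSum_sub_cycBracket hD.preservesGam hU.1 hV.1 hW.1 x
      have e2 := gTorsion_eq_cycSum_sub_cycBracket hm.preservesGam hU.1 hV.1 hW.1 x
      rw [gTorsion_eq_torsionTensor hD.preservesGam hU.1 hV.1 hW.1] at e1
      rw [gTorsion_eq_torsionTensor hm.preservesGam hU.1 hV.1 hW.1] at e2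
      have e3 := (three_mul_alt3_covDef hs hU.1 hV.1 hW.1 x).2
      have e4 := (hs U V W hU.1 hV.1 hW.1 x).1
      have e5 := (hs V U W hV.1 hU.1 hW.1 x).2
      have e6 : covDef D D₁ V W U x = 0 := by
        rw [covDef, gam_sub_left, φ.gam_bundleS_opp (hD.apply_mem hε hW x _) (hU.2 x),
          φ.gam_bundleS_opp (hm.apply_mem hε hW x _) (hU.2 x), sub_zero]
      linarith
    rw [hsame, hmixed, add_zero]

end DoubleField

/-! ### The Lie bracket and the foliations in terms of the flat connection. -/

section Bracket

variable {m : ℕ} {M : Type*} [TopologicalSpace M] [ChartedSpace (DoubleModel m) M]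
  [IsManifold 𝓘(ℝ, DoubleModel m) ∞ M] {x : M}

/-- Pulled back to the coordinate space by its own chart, a coordinate field is constant; brackets
of such fields therefore vanish. -/
lemma mpullbackWithin_constField (x : M) (c : DoubleModel m) :
    VectorField.mpullbackWithin 𝓘(ℝ, DoubleModel m) 𝓘(ℝ, DoubleModel m)
      (extChartAt 𝓘(ℝ, DoubleModel m) x).symm (constField x c)
      (Set.range 𝓘(ℝ, DoubleModel m)) =ᶠ[𝓝 (extChartAt 𝓘(ℝ, DoubleModel m) x x)]
      fun _ => c := by
  filter_upwards [extChartAt_target_mem_nhds (I := 𝓘(ℝ, DoubleModel m)) x] with z hz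
  have hs : (extChartAt 𝓘(ℝ, DoubleModel m) x).symm z ∈ (chartAt (DoubleModel m) x).source := by
    rw [← extChartAt_source 𝓘(ℝ, DoubleModel m)]
    exact (extChartAt 𝓘(ℝ, DoubleModel m) x).map_target hz
  rw [VectorField.mpullbackWithin_apply, constField, TangentBundle.symmL_trivializationAt hs,
    (extChartAt 𝓘(ℝ, DoubleModel m) x).right_inv hz]
  exact (isInvertible_mfderivWithin_extChartAt_symm hz).inverse_apply_self c

lemma mlieBracket_constField (x : M) (c d : DoubleModel m) :
    VectorField.mlieBracket 𝓘(ℝ, DoubleModel m) (constField x c) (constField x d) x = 0 := by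
  rw [VectorField.mlieBracket, VectorField.mlieBracketWithin_apply]
  have h : ∀ s, VectorField.lieBracketWithin ℝ
      (VectorField.mpullbackWithin 𝓘(ℝ, DoubleModel m) 𝓘(ℝ, DoubleModel m)
        (extChartAt 𝓘(ℝ, DoubleModel m) x).symm (constField x c)
        (Set.range 𝓘(ℝ, DoubleModel m)))
      (VectorField.mpullbackWithin 𝓘(ℝ, DoubleModel m) 𝓘(ℝ, DoubleModel m)
        (extChartAt 𝓘(ℝ, DoubleModel m) x).symm (constField x d)
        (Set.range 𝓘(ℝ, DoubleModel m))) s (extChartAt 𝓘(ℝ, DoubleModel m) x x) = 0 := by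
    intro s
    have h1 := mpullbackWithin_constField x c
    have h2 := mpullbackWithin_constField x d
    rw [(h1.filter_mono nhdsWithin_le_nhds).lieBracketWithin_vectorField_eq h1.self_of_nhds
      (h2.filter_mono nhdsWithin_le_nhds) h2.self_of_nhds]
    simp [VectorField.lieBracketWithin_eq]
  rw [h]
  exact map_zero _

variable [DoubleManifold m M] [T2Space M]

/-- The torsion is a tensor, so it suffices to test it on a flat frame, whose fields are parallel
and commute near `x`. -/
lemma torsion_flatConn (x : M) : CovariantDerivative.torsion (flatConn m M) x = 0 := by
  obtain ⟨b, hb⟩ := exists_isFlatFrame m x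
  have h : ∀ k l, CovariantDerivative.torsion (flatConn m M) x (b k x) (b l x) = 0 := by
    intro k l
    rw [CovariantDerivative.torsion_apply _ ((hb.smooth k).diff x) ((hb.smooth l).diff x),
      flatConn_apply, flatConn_apply, hb.flat.self_of_nhds, hb.flat.self_of_nhds,
      Filter.EventuallyEq.mlieBracket_vectorField_eq
        (hb.eq_constField.mono fun z hz => hz k) (hb.eq_constField.mono fun z hz => hz l),
      mlieBracket_constField]
    simp
  refine ContinuousLinearMap.ext fun u => ContinuousLinearMap.ext fun v => ?_
  rw [hb.expand.self_of_nhds u, hb.expand.self_of_nhds v]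
  simp only [map_sum, map_smul, sum_apply, smul_apply, h, smul_zero, Finset.sum_const_zero,
    zero_apply]

lemma mlieBracket_eq_flatD {X Y : VField m M} (hX : IsSmoothVF X) (hY : IsSmoothVF Y) (x : M) :
    VectorField.mlieBracket 𝓘(ℝ, DoubleModel m) X Y x =
      flatD Y x (X x) - flatD X x (Y x) := by
  have h := CovariantDerivative.torsion_apply (flatConn m M) (hX.diff x) (hY.diff x)
  rw [torsion_flatConn, zero_apply, zero_apply] at h
  exact (sub_eq_zero.1 h.symm).symm

/-- `L` is its own `γ`-orthogonal and has a parallel frame: differentiating `γ(Y, b) = 0` with `b`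
parallel in `L` gives `γ(∇⁰ Y, b) = 0`. -/
lemma flatD_mem_leafL {Y : VField m M} (hY : DoubleField.IsSectionL Y)
    (v : TangentSpace 𝓘(ℝ, DoubleModel m) x) : flatD Y x v ∈ leafL x := by
  obtain ⟨b, hb⟩ := exists_isFlatFrame m x
  rw [hb.expand.self_of_nhds (flatD Y x v), Fintype.sum_sum_type]
  have h : ∀ i, gam (flatD Y x v) (b (Sum.inl i) x) = 0 := by
    intro i
    have h1 := dirDeriv_gam (hY.1.diff x) ((hb.smooth (Sum.inl i)).diff x) v
    simp only [gam_leafL_leafL (hY.2 _) (hb.inl_mem i _)] at h1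
    rw [dirDeriv, mvfderiv_const, hb.flat.self_of_nhds, gam_zero_right] at h1
    simpa using h1.symm
  refine add_mem_leafL ((leafLSub x).sum_mem fun i _ => smul_mem_leafL _ (hb.inl_mem i x)) ?_
  simp only [Sum.swap_inr, h, zero_smul, Finset.sum_const_zero]
  rfl

lemma g_flatD_of_leafLt (φ : DoubleField m M) {Y : VField m M} (hY : IsSmoothVF Y)
    (hY' : ∀ y, Y y ∈ leafLt y) (v w : TangentSpace 𝓘(ℝ, DoubleModel m) x) :
    φ.g x (flatD Y x v) w = 0 := by
  obtain ⟨b, hb⟩ := exists_isFlatFrame m x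
  rw [hb.expand.self_of_nhds (flatD Y x v), Fintype.sum_sum_type]
  have h : ∀ i, gam (flatD Y x v) (b (Sum.inr i) x) = 0 := by
    intro i
    have h1 := dirDeriv_gam (hY.diff x) ((hb.smooth (Sum.inr i)).diff x) v
    simp only [gam_leafLt_leafLt (hY' _) (hb.inr_mem i _)] at h1
    rw [dirDeriv, mvfderiv_const, hb.flat.self_of_nhds, gam_zero_right] at h1
    simpa using h1.symm
  simp [h, map_sum, φ.g_leafLt x _ (hb.inr_mem _ x)]

/-- `ι_ε Y - Y` lies in `L̃`, which `∇⁰` preserves and `g` annihilates. Hence `D^±` can be compared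
with `∇⁰` directly on `L`. -/
lemma g_flatD_iota (φ : DoubleField m M) (ε : ℝ) {Y : VField m M} (hY : IsSmoothVF Y)
    (v w : TangentSpace 𝓘(ℝ, DoubleModel m) x) :
    φ.g x (flatD (fun y => φ.iota ε (Y y)) x v) w = φ.g x (flatD Y x v) w := by
  have h1 := (φ.isSmoothVF_iota ε hY).sub hY
  have h2 := g_flatD_of_leafLt φ h1 (fun y => φ.iota_sub_mem ε (Y y)) v w
  have h3 : (fun y => φ.iota ε (Y y)) = (fun y => φ.iota ε (Y y) - Y y) + Y := by
    funext y; simp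
  have h4 : flatConn m M (fun y => φ.iota ε (Y y)) x =
      flatConn m M (fun y => φ.iota ε (Y y) - Y y) x + flatConn m M Y x := by
    conv_lhs => rw [h3]
    exact (flatConn m M).isCovariantDerivativeOnUniv.add (h1.diff x) (hY.diff x)
  rw [← flatConn_apply, h4, add_apply, map_add, add_apply, flatConn_apply, h2, zero_add,
    flatConn_apply]

end Bracket

/-! ### A first double-metric connection. -/

section Base

variable {m : ℕ} {M : Type*} [TopologicalSpace M] [ChartedSpace (DoubleModel m) M]
  [IsManifold 𝓘(ℝ, DoubleModel m) ∞ M] [DoubleManifold m M] [T2Space M] {x : M}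

/-- The axioms of a covariant derivative concern fields that are merely differentiable at a point,
so smooth bundle endomorphisms must be known to preserve this as well. -/
lemma DiffVFAt.map {F : Π x : M, TangentSpace 𝓘(ℝ, DoubleModel m) x →
      TangentSpace 𝓘(ℝ, DoubleModel m) x}
    (hF : ∀ x, IsLinearMap ℝ (F x))
    (hs : ∀ X : VField m M, IsSmoothVF X → IsSmoothVF fun y => F y (X y))
    {Y : VField m M} (hY : DiffVFAt Y x) : DiffVFAt (fun y => F y (Y y)) x := by
  obtain ⟨b, hb⟩ := exists_isFlatFrame m x
  have h : DiffVFAt (fun y => ∑ k, gam (Y y) (b k.swap y) • F y (b k y)) x :=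
    MDifferentiableAt.sum_section fun k _ => MDifferentiableAt.smul_section
      (gam_mdifferentiableAt hY ((hb.smooth _).diff x)) ((hs _ (hb.smooth k)).diff x)
  refine h.congr_of_eventuallyEq ?_
  filter_upwards [hb.expand] with y hy
  have h1 : F y (Y y) = ∑ k, gam (Y y) (b k.swap y) • F y (b k y) := by
    conv_lhs => rw [hy (Y y)]
    change (hF y).mk' _ _ = _
    rw [map_sum]
    simp only [map_smul, IsLinearMap.mk'_apply]
  rw [h1]

namespace DoubleField

variable (φ : DoubleField m M)

/-- The projection onto `S_±`, as a continuous linear map. -/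
def prSL (ε : ℝ) (x : M) :
    TangentSpace 𝓘(ℝ, DoubleModel m) x →L[ℝ] TangentSpace 𝓘(ℝ, DoubleModel m) x :=
  LinearMap.toContinuousLinearMap ((φ.isLinearMap_prS ε).mk' _)

lemma prSL_apply (ε : ℝ) (v : TangentSpace 𝓘(ℝ, DoubleModel m) x) :
    φ.prSL ε x v = φ.prS ε v := rfl

lemma flatConn_prS_add (ε : ℝ) {Y Y' : VField m M} (hY : DiffVFAt Y x) (hY' : DiffVFAt Y' x) :
    flatConn m M (fun y => φ.prS ε ((Y + Y') y)) x =
      flatConn m M (fun y => φ.prS ε (Y y)) x + flatConn m M (fun y => φ.prS ε (Y' y)) x := by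
  have h : (fun y => φ.prS ε ((Y + Y') y)) =
      (fun y => φ.prS ε (Y y)) + fun y => φ.prS ε (Y' y) :=
    funext fun y => (φ.isLinearMap_prS ε).map_add _ _
  rw [h]
  exact (flatConn m M).isCovariantDerivativeOnUniv.add
    (hY.map (fun x => φ.isLinearMap_prS ε) fun X hX => (φ.isSectionS_prS ε hX).1)
    (hY'.map (fun x => φ.isLinearMap_prS ε) fun X hX => (φ.isSectionS_prS ε hX).1)

lemma flatConn_prS_smul (ε : ℝ) {Y : VField m M} {f : M → ℝ} (hY : DiffVFAt Y x)
    (hf : MDifferentiableAt 𝓘(ℝ, DoubleModel m) 𝓘(ℝ, ℝ) f x) :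
    flatConn m M (fun y => φ.prS ε ((f • Y) y)) x =
      f x • flatConn m M (fun y => φ.prS ε (Y y)) x +
        (mvfderiv 𝓘(ℝ, DoubleModel m) f x).smulRight (φ.prS ε (Y x)) := by
  have h : (fun y => φ.prS ε ((f • Y) y)) = f • fun y => φ.prS ε (Y y) :=
    funext fun y => (φ.isLinearMap_prS ε).map_smul _ _
  rw [h]
  exact (flatConn m M).isCovariantDerivativeOnUniv.leibniz
    (hY.map (fun x => φ.isLinearMap_prS ε) fun X hX => (φ.isSectionS_prS ε hX).1) hf

/-- The direct sum of the connections induced by `∇⁰` on `S_+` and `S_-`. -/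
def sumConn : Conn m M where
  toFun Y x := φ.prSL 1 x ∘L flatConn m M (fun y => φ.prS 1 (Y y)) x +
    φ.prSL (-1) x ∘L flatConn m M (fun y => φ.prS (-1) (Y y)) x
  isCovariantDerivativeOnUniv :=
    { add := by
        intro Y Y' x hY hY' _
        rw [φ.flatConn_prS_add 1 hY hY', φ.flatConn_prS_add (-1) hY hY']
        simp only [ContinuousLinearMap.comp_add]
        abel
      leibniz := by
        intro Y f x hY hf _
        rw [φ.flatConn_prS_smul 1 hY hf, φ.flatConn_prS_smul (-1) hY hf]
        refine ContinuousLinearMap.ext fun v => ?_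
        -- The Leibniz terms of the two summands are `df` times the two components of `Y x`, which
        -- add up to `Y x`.
        have h := φ.prS_add_prS (Y x)
        simp only [add_apply, ContinuousLinearMap.comp_apply, map_add, smul_apply, map_smul,
          ContinuousLinearMap.smulRight_apply, prSL_apply,
          φ.prS_eq_self (.inl rfl) (φ.prS_mem 1 _), φ.prS_eq_self (.inr rfl) (φ.prS_mem (-1) _)]
        rw [← h, smul_add, (φ.isLinearMap_prS 1).map_add, (φ.isLinearMap_prS (-1)).map_add,
          φ.prS_eq_self (.inl rfl) (φ.prS_mem 1 _), φ.prS_eq_self (.inr rfl) (φ.prS_mem (-1) _)]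
        have h2 : φ.prS 1 (φ.prS (-1) (Y x)) = 0 := by
          have := φ.prS_opp_eq_zero (.inr rfl) (φ.prS_mem (-1) (Y x))
          rwa [neg_neg] at this
        rw [φ.prS_opp_eq_zero (.inl rfl) (φ.prS_mem 1 _), h2]
        module }

lemma gam_sumConn (Y : VField m M) (v w : TangentSpace 𝓘(ℝ, DoubleModel m) x) :
    gam (φ.sumConn Y x v) w = gam (flatD (fun y => φ.prS 1 (Y y)) x v) (φ.prS 1 w) +
      gam (flatD (fun y => φ.prS (-1) (Y y)) x v) (φ.prS (-1) w) := by
  rw [← φ.gam_prS_left (.inl rfl), ← φ.gam_prS_left (.inr rfl), ← gam_add_left]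
  rfl

lemma dirDeriv_add {f f' : M → ℝ} (hf : ContMDiff 𝓘(ℝ, DoubleModel m) 𝓘(ℝ, ℝ) ∞ f)
    (hf' : ContMDiff 𝓘(ℝ, DoubleModel m) 𝓘(ℝ, ℝ) ∞ f')
    (v : TangentSpace 𝓘(ℝ, DoubleModel m) x) :
    dirDeriv (fun y => f y + f' y) x v = dirDeriv f x v + dirDeriv f' x v := by
  rw [dirDeriv, mvfderiv_fun_add ((hf x).mdifferentiableAt (by simp))
    ((hf' x).mdifferentiableAt (by simp)), add_apply]
  rfl

lemma dirDeriv_sub {f f' : M → ℝ} (hf : ContMDiff 𝓘(ℝ, DoubleModel m) 𝓘(ℝ, ℝ) ∞ f)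
    (hf' : ContMDiff 𝓘(ℝ, DoubleModel m) 𝓘(ℝ, ℝ) ∞ f')
    (v : TangentSpace 𝓘(ℝ, DoubleModel m) x) :
    dirDeriv (fun y => f y - f' y) x v = dirDeriv f x v - dirDeriv f' x v := by
  rw [dirDeriv, mvfderiv_fun_sub ((hf x).mdifferentiableAt (by simp))
    ((hf' x).mdifferentiableAt (by simp)), sub_apply]
  rfl

lemma gam_eq_prS_add_prS (v w : TangentSpace 𝓘(ℝ, DoubleModel m) x) :
    gam v w = gam (φ.prS 1 v) (φ.prS 1 w) + gam (φ.prS (-1) v) (φ.prS (-1) w) := by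
  rw [φ.gam_prS_left (.inl rfl), φ.gam_prS_left (.inr rfl),
    φ.prS_eq_self (.inl rfl) (φ.prS_mem 1 _), φ.prS_eq_self (.inr rfl) (φ.prS_mem (-1) _),
    ← gam_add_right, φ.prS_add_prS]

/-- Each projected connection preserves `γ` on its bundle, and `γ`, `ℋ` are the sum and the
difference of the two restrictions of `γ`. -/
lemma isDoubleMetric_sumConn : φ.IsDoubleMetric φ.sumConn where
  smooth := conn_smooth_of_apply fun Y V hY hV =>
    (φ.isSectionS_prS 1 (flatD_smooth (φ.isSectionS_prS 1 hY).1 hV)).1.add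
      (φ.isSectionS_prS (-1) (flatD_smooth (φ.isSectionS_prS (-1) hY).1 hV)).1
  preserves_gam X Y Z hX hY hZ x := by
    have hX1 := (φ.isSectionS_prS 1 hX).1
    have hX2 := (φ.isSectionS_prS (-1) hX).1
    have hY1 := (φ.isSectionS_prS 1 hY).1
    have hY2 := (φ.isSectionS_prS (-1) hY).1
    simp only [φ.gam_eq_prS_add_prS (X _) (Y _)]
    rw [dirDeriv_add (gam_contMDiff hX1 hY1) (gam_contMDiff hX2 hY2),
      dirDeriv_gam (hX1.diff x) (hY1.diff x), dirDeriv_gam (hX2.diff x) (hY2.diff x),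
      gam_comm (X x), gam_sumConn, gam_sumConn, gam_comm (φ.prS 1 (X x)),
      gam_comm (φ.prS (-1) (X x))]
    ring
  preserves_genMetric X Y Z hX hY hZ x := by
    have hX1 := (φ.isSectionS_prS 1 hX).1
    have hX2 := (φ.isSectionS_prS (-1) hX).1
    have hY1 := (φ.isSectionS_prS 1 hY).1
    have hY2 := (φ.isSectionS_prS (-1) hY).1
    have h1 : ∀ v : TangentSpace 𝓘(ℝ, DoubleModel m) x,
        φ.prS 1 (φ.prS 1 v - φ.prS (-1) v) = φ.prS 1 v := by
      intro v
      have := φ.prS_opp_eq_zero (.inr rfl) (φ.prS_mem (-1) v)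
      rw [neg_neg] at this
      rw [(φ.isLinearMap_prS 1).map_sub, φ.prS_eq_self (.inl rfl) (φ.prS_mem 1 _), this, sub_zero]
    have h2 : ∀ v : TangentSpace 𝓘(ℝ, DoubleModel m) x,
        φ.prS (-1) (φ.prS 1 v - φ.prS (-1) v) = -φ.prS (-1) v := by
      intro v
      rw [(φ.isLinearMap_prS (-1)).map_sub, φ.prS_eq_self (.inr rfl) (φ.prS_mem (-1) _),
        φ.prS_opp_eq_zero (.inl rfl) (φ.prS_mem 1 v), zero_sub]
    rw [φ.genMetric_comm (X x)]
    simp only [genMetric_eq_left, gam_sumConn, h1, h2]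
    simp only [← genMetric_eq_left, genMetric]
    rw [dirDeriv_sub (gam_contMDiff hX1 hY1) (gam_contMDiff hX2 hY2),
      dirDeriv_gam (hX1.diff x) (hY1.diff x), dirDeriv_gam (hX2.diff x) (hY2.diff x),
      gam_comm (φ.prS 1 (X x)), gam_comm (φ.prS (-1) (X x)), gam_neg_right, gam_neg_right]
    ring

end DoubleField

end Base

/-! ### Algebra of the contorsion. -/

section Trilinear

variable {E : Type*} [AddCommGroup E] [Module ℝ E] {A A' : E → E → E → ℝ}

lemma IsTrilinear.add (h : IsTrilinear A) (h' : IsTrilinear A') :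
    IsTrilinear fun u v w => A u v w + A' u v w where
  fst v w := ⟨fun _ _ => by rw [(h.fst v w).map_add, (h'.fst v w).map_add]; ring,
    fun _ _ => by
      rw [(h.fst v w).map_smul, (h'.fst v w).map_smul, smul_eq_mul, smul_eq_mul, smul_eq_mul]
      ring⟩
  snd u w := ⟨fun _ _ => by rw [(h.snd u w).map_add, (h'.snd u w).map_add]; ring,
    fun _ _ => by
      rw [(h.snd u w).map_smul, (h'.snd u w).map_smul, smul_eq_mul, smul_eq_mul, smul_eq_mul]
      ring⟩
  thd u v := ⟨fun _ _ => by rw [(h.thd u v).map_add, (h'.thd u v).map_add]; ring,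
    fun _ _ => by
      rw [(h.thd u v).map_smul, (h'.thd u v).map_smul, smul_eq_mul, smul_eq_mul, smul_eq_mul]
      ring⟩

lemma IsTrilinear.const_mul (c : ℝ) (h : IsTrilinear A) :
    IsTrilinear fun u v w => c * A u v w where
  fst v w := ⟨fun _ _ => by rw [(h.fst v w).map_add]; ring,
    fun _ _ => by rw [(h.fst v w).map_smul, smul_eq_mul, smul_eq_mul]; ring⟩
  snd u w := ⟨fun _ _ => by rw [(h.snd u w).map_add]; ring,
    fun _ _ => by rw [(h.snd u w).map_smul, smul_eq_mul, smul_eq_mul]; ring⟩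
  thd u v := ⟨fun _ _ => by rw [(h.thd u v).map_add]; ring,
    fun _ _ => by rw [(h.thd u v).map_smul, smul_eq_mul, smul_eq_mul]; ring⟩

lemma IsTrilinear.neg (h : IsTrilinear A) : IsTrilinear fun u v w => -A u v w := by
  simpa only [neg_one_mul] using h.const_mul (-1)

lemma IsTrilinear.sub (h : IsTrilinear A) (h' : IsTrilinear A') :
    IsTrilinear fun u v w => A u v w - A' u v w := by
  simpa only [sub_eq_add_neg] using h.add h'.neg

lemma IsTrilinear.rotate (h : IsTrilinear A) : IsTrilinear fun u v w => A v w u :=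
  ⟨fun v w => h.thd v w, fun u w => h.fst w u, fun u v => h.snd v u⟩

lemma IsTrilinear.swap (h : IsTrilinear A) : IsTrilinear fun u v w => A v u w :=
  ⟨fun v w => h.snd v w, fun u w => h.fst u w, fun u v => h.thd v u⟩

lemma IsTrilinear.comp (h : IsTrilinear A) {f g k : E → E} (hf : IsLinearMap ℝ f)
    (hg : IsLinearMap ℝ g) (hk : IsLinearMap ℝ k) :
    IsTrilinear fun u v w => A (f u) (g v) (k w) where
  fst v w := ⟨fun _ _ => by rw [hf.map_add, (h.fst _ _).map_add],
    fun _ _ => by rw [hf.map_smul, (h.fst _ _).map_smul]⟩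
  snd u w := ⟨fun _ _ => by rw [hg.map_add, (h.snd _ _).map_add],
    fun _ _ => by rw [hg.map_smul, (h.snd _ _).map_smul]⟩
  thd u v := ⟨fun _ _ => by rw [hk.map_add, (h.thd _ _).map_add],
    fun _ _ => by rw [hk.map_smul, (h.thd _ _).map_smul]⟩

/-- The tensor `K`, skew symmetric in its last two arguments, such that `A + K` is symmetric in
its first two arguments. -/
def contorsion (A : E → E → E → ℝ) (u v w : E) : ℝ :=
  -(1 / 2) * ((A u v w - A v u w) - (A v w u - A w v u) + (A w u v - A u w v))

lemma IsTrilinear.contorsion (h : IsTrilinear A) : IsTrilinear (contorsion A) :=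
  (((h.sub h.swap).sub (h.sub h.swap).rotate).add (h.sub h.swap).rotate.rotate).const_mul _

lemma contorsion_skew (A : E → E → E → ℝ) (u v w : E) :
    contorsion A u w v = -contorsion A u v w := by
  simp only [contorsion]; ring

lemma add_contorsion_symm (A : E → E → E → ℝ) (u v w : E) :
    A u v w + contorsion A u v w = A v u w + contorsion A v u w := by
  simp only [contorsion]; ring

/-- A tensor that is symmetric in its first and skew symmetric in its last two arguments is
zero. -/
lemma eq_zero_of_symm_of_skew {F : Set E}
    (hs : ∀ u ∈ F, ∀ v ∈ F, ∀ w ∈ F, A u v w = A v u w)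
    (hk : ∀ u ∈ F, ∀ v ∈ F, ∀ w ∈ F, A u w v = -A u v w) {u v w : E} (hu : u ∈ F) (hv : v ∈ F)
    (hw : w ∈ F) : A u v w = 0 := by
  -- Alternating the two symmetries: `A u v w = A v u w = -A v w u = -A w v u = A w u v = A u w v =
  -- -A u v w`.
  linarith [hs u hu v hv w hw, hk v hv u hu w hw, hs v hv w hw u hu, hk w hw u hu v hv,
    hs w hw u hu v hv, hk u hu v hv w hw]

end Trilinear

/-! ### The decomposition `TM = S_± ⊕ L` when `g + B` is non degenerate. -/

section Splitting

variable {m : ℕ} {M : Type*} [TopologicalSpace M] [ChartedSpace (DoubleModel m) M]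
  [IsManifold 𝓘(ℝ, DoubleModel m) ∞ M] {x : M} {δ : ℝ}

lemma mem_leafL_of_gam {v : TangentSpace 𝓘(ℝ, DoubleModel m) x}
    (h : ∀ w ∈ leafL x, gam v w = 0) : v ∈ leafL x :=
  funext fun i => by rw [← gam_dX, h _ rfl, Pi.zero_apply]

namespace DoubleField

variable (φ : DoubleField m M)

/-- The bilinear form `B + δ g` on `L`. -/
def leafForm (δ : ℝ) (x : M) : LinearMap.BilinForm ℝ (leafLSub (m := m) x) :=
  LinearMap.mk₂ ℝ (fun v w => φ.B x v w + δ * φ.g x v w)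
    (fun _ _ _ => by simp; ring) (fun _ _ _ => by simp; ring)
    (fun _ _ _ => by simp; ring) (fun _ _ _ => by simp; ring)

lemma leafForm_apply (v w : leafLSub (m := m) x) :
    φ.leafForm δ x v w = φ.B x v w + δ * φ.g x v w := rfl

variable {φ}

/-- `B - g` is minus the transpose of `B + g`, and in finite dimension a form that is non degenerate
on one side is so on the other. -/
lemma SumNondegenerate.leafForm_injective (h : φ.SumNondegenerate) (hδ : δ = 1 ∨ δ = -1)
    (x : M) : Function.Injective (φ.leafForm δ x) := by
  have h1 : Function.Injective (φ.leafForm 1 x) := by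
    rw [← LinearMap.ker_eq_bot, LinearMap.ker_eq_bot']
    intro v hv
    refine Subtype.ext (h x v v.2 fun w hw => ?_)
    have := LinearMap.congr_fun hv ⟨w, hw⟩
    rw [leafForm_apply] at this
    simp only [LinearMap.zero_apply] at this
    linarith
  rcases hδ with rfl | rfl
  · exact h1
  · have h2 : (φ.leafForm (-1) x) = -(φ.leafForm 1 x).flip := by
      refine LinearMap.ext₂ fun v w => ?_
      change φ.B x v w + -1 * φ.g x v w = -(φ.B x w v + 1 * φ.g x w v)
      rw [φ.skew_B x v, φ.symm_g x v]
      ring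
    have h3 : Function.Surjective (φ.leafForm 1 x) :=
      (LinearMap.injective_iff_surjective_of_finrank_eq_finrank
        Subspace.dual_finrank_eq.symm).1 h1
    rw [← LinearMap.ker_eq_bot, LinearMap.ker_eq_bot']
    intro v hv
    refine (Module.forall_dual_apply_eq_zero_iff ℝ v).1 fun f => ?_
    obtain ⟨w, rfl⟩ := h3 f
    rw [h2] at hv
    simpa using LinearMap.congr_fun hv w

variable (φ) in
/-- The bilinear form `B + δ g` is `γ(ι v, w)` on `L`. -/
lemma gam_iota_leafL (δ : ℝ) {v w : TangentSpace 𝓘(ℝ, DoubleModel m) x} (hv : v ∈ leafL x)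
    (hw : w ∈ leafL x) : gam (φ.iota δ v) w = φ.B x v w + δ * φ.g x v w := by
  rw [gam_iota_left, gam_leafL_leafL hv hw, zero_add]

lemma SumNondegenerate.eq_zero (h : φ.SumNondegenerate) (hδ : δ = 1 ∨ δ = -1)
    {v : TangentSpace 𝓘(ℝ, DoubleModel m) x} (hv : v ∈ leafL x)
    (hv' : ∀ w ∈ leafL x, φ.B x v w + δ * φ.g x v w = 0) : v = 0 := by
  have h1 : φ.leafForm δ x ⟨v, hv⟩ = φ.leafForm δ x 0 :=
    LinearMap.ext fun w => by rw [map_zero]; exact hv' w w.2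
  exact congrArg Subtype.val (h.leafForm_injective hδ x h1)

/-- `v - ι_δ p` lies in `L` iff it is `γ`-orthogonal to `L`, that is, iff `(B + δ g)(p, ·) = γ(v,
·)` on `L`. -/
lemma SumNondegenerate.exists_split (h : φ.SumNondegenerate) (hδ : δ = 1 ∨ δ = -1)
    (v : TangentSpace 𝓘(ℝ, DoubleModel m) x) :
    ∃ p ∈ leafL x, v - φ.iota δ p ∈ leafL x := by
  have h3 : Function.Surjective (φ.leafForm δ x) :=
    (LinearMap.injective_iff_surjective_of_finrank_eq_finrank
      Subspace.dual_finrank_eq.symm).1 (h.leafForm_injective hδ x)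
  have hl : IsLinearMap ℝ fun w : leafLSub (m := m) x => gam v w :=
    ⟨fun _ _ => by simp, fun _ _ => by simp⟩
  obtain ⟨p, hp⟩ := h3 (hl.mk' _)
  refine ⟨p, p.2, mem_leafL_of_gam fun w hw => ?_⟩
  have := LinearMap.congr_fun hp ⟨w, hw⟩
  rw [leafForm_apply] at this
  rw [gam_sub_left, φ.gam_iota_leafL δ p.2 hw, this]
  exact sub_self _

variable (φ) in
open Classical in
/-- The component `p` in the decomposition `v = ι p + q` along `TM = S_± ⊕ L`. -/
def splitS (δ : ℝ) (v : TangentSpace 𝓘(ℝ, DoubleModel m) x) :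
    TangentSpace 𝓘(ℝ, DoubleModel m) x :=
  -- Under `SumNondegenerate` and `δ = ±1` the default value `0` never occurs.
  if h : ∃ p ∈ leafL x, v - φ.iota δ p ∈ leafL x then h.choose else 0

variable (φ) in
/-- The component `q` in the decomposition `v = ι p + q` along `TM = S_± ⊕ L`. -/
def splitL (δ : ℝ) (v : TangentSpace 𝓘(ℝ, DoubleModel m) x) :
    TangentSpace 𝓘(ℝ, DoubleModel m) x :=
  v - φ.iota δ (φ.splitS δ v)

variable (φ) in
lemma iota_splitS_add_splitL (δ : ℝ) (v : TangentSpace 𝓘(ℝ, DoubleModel m) x) :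
    φ.iota δ (φ.splitS δ v) + φ.splitL δ v = v :=
  add_sub_cancel _ _

namespace SumNondegenerate

lemma splitS_mem (h : φ.SumNondegenerate) (hδ : δ = 1 ∨ δ = -1)
    (v : TangentSpace 𝓘(ℝ, DoubleModel m) x) : φ.splitS δ v ∈ leafL x := by
  rw [splitS, dif_pos (h.exists_split hδ v)]
  exact (h.exists_split hδ v).choose_spec.1

lemma splitL_mem (h : φ.SumNondegenerate) (hδ : δ = 1 ∨ δ = -1)
    (v : TangentSpace 𝓘(ℝ, DoubleModel m) x) : φ.splitL δ v ∈ leafL x := by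
  rw [splitL, splitS, dif_pos (h.exists_split hδ v)]
  exact (h.exists_split hδ v).choose_spec.2

lemma form_splitS (h : φ.SumNondegenerate) (hδ : δ = 1 ∨ δ = -1)
    (v : TangentSpace 𝓘(ℝ, DoubleModel m) x) {w : TangentSpace 𝓘(ℝ, DoubleModel m) x}
    (hw : w ∈ leafL x) :
    φ.B x (φ.splitS δ v) w + δ * φ.g x (φ.splitS δ v) w = gam v w := by
  have h1 := gam_leafL_leafL (h.splitL_mem hδ v) hw
  rw [splitL, gam_sub_left, φ.gam_iota_leafL δ (h.splitS_mem hδ v) hw] at h1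
  linarith

lemma splitS_eq (h : φ.SumNondegenerate) (hδ : δ = 1 ∨ δ = -1)
    {v p : TangentSpace 𝓘(ℝ, DoubleModel m) x} (hp : p ∈ leafL x)
    (hv : ∀ w ∈ leafL x, gam v w = φ.B x p w + δ * φ.g x p w) : φ.splitS δ v = p := by
  refine sub_eq_zero.1 (h.eq_zero hδ (sub_mem_leafL (h.splitS_mem hδ v) hp) fun w hw => ?_)
  have h1 := h.form_splitS hδ v hw
  rw [hv w hw] at h1
  simp only [map_sub, sub_apply]
  linarith

lemma isLinearMap_splitS (h : φ.SumNondegenerate) (hδ : δ = 1 ∨ δ = -1) :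
    IsLinearMap ℝ (φ.splitS δ : TangentSpace 𝓘(ℝ, DoubleModel m) x → _) where
  map_add v w := h.splitS_eq hδ (add_mem_leafL (h.splitS_mem hδ v) (h.splitS_mem hδ w))
    fun z hz => by
      rw [gam_add_left, ← h.form_splitS hδ v hz, ← h.form_splitS hδ w hz]
      simp only [map_add, add_apply]
      ring
  map_smul c v := h.splitS_eq hδ (smul_mem_leafL c (h.splitS_mem hδ v))
    fun z hz => by
      rw [gam_smul_left, ← h.form_splitS hδ v hz]
      simp only [map_smul, smul_apply, smul_eq_mul]
      ring

lemma isLinearMap_splitL (h : φ.SumNondegenerate) (hδ : δ = 1 ∨ δ = -1) :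
    IsLinearMap ℝ (φ.splitL δ : TangentSpace 𝓘(ℝ, DoubleModel m) x → _) where
  map_add v w := by
    simp only [splitL, (h.isLinearMap_splitS hδ).map_add, (φ.isLinearMap_iota δ).map_add]
    abel
  map_smul c v := by
    simp only [splitL, (h.isLinearMap_splitS hδ).map_smul, (φ.isLinearMap_iota δ).map_smul,
      smul_sub]

lemma splitS_iota (h : φ.SumNondegenerate) (hδ : δ = 1 ∨ δ = -1)
    {v : TangentSpace 𝓘(ℝ, DoubleModel m) x} (hv : v ∈ leafL x) :
    φ.splitS δ (φ.iota δ v) = v :=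
  h.splitS_eq hδ hv fun _ hw => φ.gam_iota_leafL δ hv hw

lemma splitL_iota (h : φ.SumNondegenerate) (hδ : δ = 1 ∨ δ = -1)
    {v : TangentSpace 𝓘(ℝ, DoubleModel m) x} (hv : v ∈ leafL x) :
    φ.splitL δ (φ.iota δ v) = 0 := by
  rw [splitL, h.splitS_iota hδ hv, sub_self]

lemma splitS_of_mem (h : φ.SumNondegenerate) (hδ : δ = 1 ∨ δ = -1)
    {v : TangentSpace 𝓘(ℝ, DoubleModel m) x} (hv : v ∈ leafL x) : φ.splitS δ v = 0 :=
  h.splitS_eq hδ (leafLSub x).zero_mem fun w hw => by simp [gam_leafL_leafL hv hw]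

lemma splitL_of_mem (h : φ.SumNondegenerate) (hδ : δ = 1 ∨ δ = -1)
    {v : TangentSpace 𝓘(ℝ, DoubleModel m) x} (hv : v ∈ leafL x) : φ.splitL δ v = v := by
  rw [splitL, h.splitS_of_mem hδ hv, (φ.isLinearMap_iota δ).map_zero, sub_zero]

variable [DoubleManifold m M] [T2Space M]

lemma isSectionL_splitS (h : φ.SumNondegenerate) (hδ : δ = 1 ∨ δ = -1) {X : VField m M}
    (hX : IsSmoothVF X) : IsSectionL fun y => φ.splitS δ (X y) := by
  refine ⟨isSmoothVF_of_leafForm (β := fun x v w => φ.B x v w + δ * φ.g x v w)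
    (fun x w => ⟨fun _ _ => by simp; ring, fun _ _ => by simp; ring⟩)
    (fun x w => ⟨fun _ _ => by simp; ring, fun _ _ => by simp; ring⟩)
    (fun X Y hX hY => (φ.B_contMDiff hX.1 hY.1).add
      (contMDiff_const.mul (φ.g_contMDiff hX.1 hY.1)))
    (fun x v hv => h.eq_zero hδ hv) (fun y => h.splitS_mem hδ _)
    fun Z hZ => ?_, fun y => h.splitS_mem hδ _⟩
  simp only [h.form_splitS hδ _ (hZ.2 _)]
  exact gam_contMDiff hX hZ.1

lemma isSectionL_splitL (h : φ.SumNondegenerate) (hδ : δ = 1 ∨ δ = -1) {X : VField m M}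
    (hX : IsSmoothVF X) : IsSectionL fun y => φ.splitL δ (X y) :=
  ⟨hX.sub (φ.isSmoothVF_iota δ (h.isSectionL_splitS hδ hX).1), fun _ => h.splitL_mem hδ _⟩

end SumNondegenerate

end DoubleField

end Splitting

/-! ### Existence and uniqueness of the CWT connection. -/

namespace DoubleField

variable {m : ℕ} {M : Type*} [TopologicalSpace M] [ChartedSpace (DoubleModel m) M]
  [IsManifold 𝓘(ℝ, DoubleModel m) ∞ M] [DoubleManifold m M] [T2Space M] {φ : DoubleField m M}
  {x : M} {ε : ℝ} {D D' : Conn m M}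

variable (φ) in
/-- The tensor `g((D^± - ∇⁰)_u v, w)` of the connection `D^±` on `L`. -/
def leafDiff (ε : ℝ) (D : Conn m M) (x : M) (u v w : TangentSpace 𝓘(ℝ, DoubleModel m) x) : ℝ :=
  φ.g x (CovariantDerivative.difference D (flatConn m M) x (φ.iota ε v) u) w

variable (φ) in
lemma isTrilinear_leafDiff (ε : ℝ) (D : Conn m M) (x : M) : IsTrilinear (φ.leafDiff ε D x) where
  fst _ _ := ⟨fun _ _ => by simp [leafDiff], fun _ _ => by simp [leafDiff]⟩
  snd _ _ := ⟨fun _ _ => by simp [leafDiff, (φ.isLinearMap_iota ε).map_add],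
    fun _ _ => by simp [leafDiff, (φ.isLinearMap_iota ε).map_smul]⟩
  thd _ _ := ⟨fun _ _ => by simp [leafDiff], fun _ _ => by simp [leafDiff]⟩

lemma leafDiff_apply (D : Conn m M) {Y : VField m M} (hY : IsSmoothVF Y)
    (u w : TangentSpace 𝓘(ℝ, DoubleModel m) x) :
    φ.leafDiff ε D x u (Y x) w = φ.g x (φ.restr ε D Y x u) w - φ.g x (flatD Y x u) w := by
  have hY' := φ.isSmoothVF_iota ε hY
  have h : CovariantDerivative.difference D (flatConn m M) x (φ.iota ε (Y x)) =
      D (fun y => φ.iota ε (Y y)) x - flatConn m M (fun y => φ.iota ε (Y y)) x :=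
    IsCovariantDerivativeOn.difference_apply D.isCovariantDerivativeOnUniv
      (flatConn m M).isCovariantDerivativeOnUniv trivial (hY'.diff x)
  rw [leafDiff, h, sub_apply, map_sub, sub_apply, flatConn_apply, g_flatD_iota φ ε hY, restr,
    g_prL_left]

lemma leafDiff_contMDiff (hD : CovariantDerivative.ContMDiffCovariantDerivative D ∞)
    {X Y Z : VField m M} (hX : IsSmoothVF X) (hY : IsSmoothVF Y) (hZ : IsSmoothVF Z) :
    ContMDiff 𝓘(ℝ, DoubleModel m) 𝓘(ℝ, ℝ) ∞ fun y => φ.leafDiff ε D y (X y) (Y y) (Z y) := by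
  simp only [leafDiff_apply D hY, restr, g_prL_left]
  exact (φ.g_contMDiff (conn_apply_smooth hD (φ.isSmoothVF_iota ε hY) hX) hZ).sub
    (φ.g_contMDiff (flatD_smooth hY hX) hZ)

/-- Partial connections along `L` are torsion free iff their difference with `∇⁰` is symmetric. -/
lemma restr_torsion_iff {X Y : VField m M} (hX : IsSectionL X) (hY : IsSectionL Y) (x : M) :
    φ.restr ε D Y x (X x) - φ.restr ε D X x (Y x) =
        VectorField.mlieBracket 𝓘(ℝ, DoubleModel m) X Y x ↔
      ∀ w ∈ leafL x, φ.leafDiff ε D x (X x) (Y x) w = φ.leafDiff ε D x (Y x) (X x) w := by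
  rw [mlieBracket_eq_flatD hX.1 hY.1]
  constructor
  · intro h w _
    have h1 := congrArg (fun v => φ.g x v w) h
    simp only [map_sub, sub_apply] at h1
    rw [leafDiff_apply D hY.1, leafDiff_apply D hX.1]
    linarith
  · intro h
    refine φ.eq_of_forall_g (sub_mem_leafL (prL_mem _) (prL_mem _))
      (sub_mem_leafL (flatD_mem_leafL hY _) (flatD_mem_leafL hX _)) fun w hw => ?_
    have h1 := h w hw
    rw [leafDiff_apply D hY.1, leafDiff_apply D hX.1] at h1
    simp only [map_sub, sub_apply]
    linarith

/-- The tensors `γ((D - ∇⁰)_u v, w)` and `g((D^± - ∇⁰)_u v, w)` vary in the same way with `D`. -/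
lemma IsDoubleMetric.flatDiff_sub_iota (hD : φ.IsDoubleMetric D) (hD' : φ.IsDoubleMetric D')
    (hε : ε = 1 ∨ ε = -1) (u : TangentSpace 𝓘(ℝ, DoubleModel m) x)
    {v w : TangentSpace 𝓘(ℝ, DoubleModel m) x} (hv : v ∈ leafL x) (hw : w ∈ leafL x) :
    flatDiff D x u (φ.iota ε v) (φ.iota ε w) - flatDiff D' x u (φ.iota ε v) (φ.iota ε w) =
      2 * ε * (φ.leafDiff ε D x u v w - φ.leafDiff ε D' x u v w) := by
  obtain ⟨V, hV, rfl⟩ := exists_extend_leafL hv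
  have hV' := φ.isSectionS_iota ε hV
  rw [leafDiff_apply D hV.1, leafDiff_apply D' hV.1,
    flatDiff_apply D (Y := fun y => φ.iota ε (V y)) hV'.1,
    flatDiff_apply D' (Y := fun y => φ.iota ε (V y)) hV'.1,
    gam_iota_of_mem hε (hD.apply_mem hε hV' x u) hw,
    gam_iota_of_mem hε (hD'.apply_mem hε hV' x u) hw, restr, restr]
  ring

lemma flatDiff_addTensor {A : Π x : M, TangentSpace 𝓘(ℝ, DoubleModel m) x →
      TangentSpace 𝓘(ℝ, DoubleModel m) x → TangentSpace 𝓘(ℝ, DoubleModel m) x → ℝ}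
    (hA : ∀ x, IsTrilinear (A x)) (D : Conn m M) (u v w : TangentSpace 𝓘(ℝ, DoubleModel m) x) :
    flatDiff (D.addTensor hA) x u v w = flatDiff D x u v w + A x u v w := by
  obtain ⟨V, hV, rfl⟩ := exists_extend v
  rw [flatDiff_apply _ hV, flatDiff_apply _ hV, gam_addTensor]
  ring

/-- Double-metric connections preserve `S_ε`, so they contribute nothing here and the off-diagonal
blocks depend on `∇⁰` alone. -/
lemma IsDoubleMetric.flatDiff_opp (hD : φ.IsDoubleMetric D) (hD' : φ.IsDoubleMetric D')
    (hε : ε = 1 ∨ ε = -1) (u : TangentSpace 𝓘(ℝ, DoubleModel m) x)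
    {v w : TangentSpace 𝓘(ℝ, DoubleModel m) x} (hv : v ∈ φ.bundleS ε x)
    (hw : w ∈ φ.bundleS (-ε) x) : flatDiff D x u v w = flatDiff D' x u v w := by
  obtain ⟨V, hV, rfl⟩ := φ.exists_extend_bundleS hv
  rw [flatDiff_apply D hV.1, flatDiff_apply D' hV.1, φ.gam_bundleS_opp (hD.apply_mem hε hV x u) hw,
    φ.gam_bundleS_opp (hD'.apply_mem hε hV x u) hw]

/-- The connection on `L` determined by a double-metric connection preserves `g`. -/
lemma IsDoubleMetric.dirDeriv_g (hD : φ.IsDoubleMetric D) (hε : ε = 1 ∨ ε = -1)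
    {X Y Z : VField m M} (hX : IsSectionL X) (hY : IsSectionL Y) (hZ : IsSmoothVF Z) (x : M) :
    dirDeriv (fun y => φ.g y (X y) (Y y)) x (Z x) =
      φ.g x (φ.restr ε D X x (Z x)) (Y x) + φ.g x (X x) (φ.restr ε D Y x (Z x)) := by
  have hX' := φ.isSectionS_iota ε hX
  have hY' := φ.isSectionS_iota ε hY
  have h := hD.preserves_gam _ _ Z hX'.1 hY'.1 hZ x
  simp only [φ.gam_iota_iota_same (hX.2 _) (hY.2 _)] at h
  rw [dirDeriv_const_mul _ (φ.g_contMDiff hX.1 hY.1), gam_comm (φ.iota ε (X x)),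
    gam_iota_of_mem hε (hD.apply_mem hε hX' x _) (hY.2 x),
    gam_iota_of_mem hε (hD.apply_mem hε hY' x _) (hX.2 x), ← mul_add] at h
  rw [φ.symm_g x (X x)]
  refine mul_left_cancel₀ ?_ h
  rcases hε with rfl | rfl <;> norm_num

/-- Compatibility with `g` is automatic, by `dirDeriv_g`; only the torsion condition remains. -/
lemma IsDoubleMetric.isLeviCivitaL_iff (hD : φ.IsDoubleMetric D) (hε : ε = 1 ∨ ε = -1) :
    φ.IsLeviCivitaL (φ.restr ε D) ↔ ∀ x, ∀ u ∈ leafL x, ∀ v ∈ leafL x, ∀ w ∈ leafL x,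
      φ.leafDiff ε D x u v w = φ.leafDiff ε D x v u w := by
  constructor
  · intro h x u hu v hv
    obtain ⟨U, hU, rfl⟩ := exists_extend_leafL hu
    obtain ⟨V, hV, rfl⟩ := exists_extend_leafL hv
    exact (restr_torsion_iff hU hV x).1 (h.2 U V hU hV x)
  · exact fun h => ⟨fun X Y Z hX hY hZ x => hD.dirDeriv_g hε hX hY hZ.1 x,
      fun X Y hX hY x => (restr_torsion_iff hX hY x).2 (h x _ (hX.2 x) _ (hY.2 x))⟩

/-- Turns the CWT conditions into linear algebra at each point, so that they can be solved for a
correcting tensor. -/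
lemma isCWT_iff : φ.IsCWT D ↔ φ.IsDoubleMetric D ∧ ∀ ε : ℝ, ε = 1 ∨ ε = -1 → ∀ x,
    (∀ u ∈ φ.bundleS (-ε) x, ∀ v ∈ φ.bundleS ε x, ∀ w ∈ φ.bundleS ε x,
      torsionTensor D x u v w = 0) ∧
    ∀ u ∈ leafL x, ∀ v ∈ leafL x, ∀ w ∈ leafL x,
      φ.leafDiff ε D x u v w = φ.leafDiff ε D x v u w := by
  constructor
  · intro h
    refine ⟨h.doubleMetric, fun ε hε x => ⟨fun u hu v hv w hw => h.torsionTensor_mixed hε hu hv hw,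
      ?_⟩⟩
    rcases hε with rfl | rfl
    · exact (h.doubleMetric.isLeviCivitaL_iff (.inl rfl)).1 h.leviCivita_plus x
    · exact (h.doubleMetric.isLeviCivitaL_iff (.inr rfl)).1 h.leviCivita_minus x
  · rintro ⟨hD, h⟩
    refine ⟨hD, fun X Y Z hX hY hZ x => ?_, fun X Y Z hX hY hZ x => ?_,
      (hD.isLeviCivitaL_iff (.inl rfl)).2 fun x => (h 1 (.inl rfl) x).2,
      (hD.isLeviCivitaL_iff (.inr rfl)).2 fun x => (h (-1) (.inr rfl) x).2⟩
    · rw [gTorsion_eq_torsionTensor hD.preservesGam hX.1 hY.1 hZ.1]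
      exact (h 1 (.inl rfl) x).1 _ (hX.2 x) _ (hY.2 x) _ (hZ.2 x)
    · rw [gTorsion_eq_torsionTensor hD.preservesGam hX.1 hY.1 hZ.1]
      exact (h (-1) (.inr rfl) x).1 _ (by rw [neg_neg]; exact hX.2 x) _ (hY.2 x) _ (hZ.2 x)

variable (φ) in
/-- The tensor, on `S_±`, that has to be added to a double-metric connection to make it a CWT
connection. -/
def cwtTensor (ε : ℝ) (D : Conn m M) (x : M)
    (u v w : TangentSpace 𝓘(ℝ, DoubleModel m) x) : ℝ :=
  -- The direction `u` is split along `S_{-ε} ⊕ L`. The `L`-part removes the torsion of `D^±` by the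
  -- contorsion, with `2 ε` converting `g` to `γ` on `S_ε`; the `S_{-ε}`-part cancels the mixed
  -- torsion.
  2 * ε * contorsion (φ.leafDiff ε D x) (φ.splitL (-ε) u) (φ.pS ε v) (φ.pS ε w) -
    torsionTensor D x (φ.iota (-ε) (φ.splitS (-ε) u)) (φ.prS ε v) (φ.prS ε w)

lemma neg_eq_one_or {ε : ℝ} (hε : ε = 1 ∨ ε = -1) : -ε = 1 ∨ -ε = -1 := by
  rcases hε with rfl | rfl <;> norm_num

lemma SumNondegenerate.isTrilinear_cwtTensor (h : φ.SumNondegenerate) (hε : ε = 1 ∨ ε = -1)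
    (D : Conn m M) (x : M) : IsTrilinear (φ.cwtTensor ε D x) := by
  have hε' := neg_eq_one_or hε
  have hi : IsLinearMap ℝ fun u : TangentSpace 𝓘(ℝ, DoubleModel m) x =>
      φ.iota (-ε) (φ.splitS (-ε) u) :=
    (((φ.isLinearMap_iota (-ε)).mk' _).comp ((h.isLinearMap_splitS hε').mk' _)).isLinear
  exact (((φ.isTrilinear_leafDiff ε D x).contorsion.comp (h.isLinearMap_splitL hε')
    (φ.isLinearMap_pS ε) (φ.isLinearMap_pS ε)).const_mul _).sub
    ((isTrilinear_torsionTensor D x).comp hi (φ.isLinearMap_prS ε) (φ.isLinearMap_prS ε))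

lemma SumNondegenerate.cwtTensor_contMDiff (h : φ.SumNondegenerate) (hε : ε = 1 ∨ ε = -1)
    (hD : CovariantDerivative.ContMDiffCovariantDerivative D ∞) {X Y Z : VField m M}
    (hX : IsSmoothVF X) (hY : IsSmoothVF Y) (hZ : IsSmoothVF Z) :
    ContMDiff 𝓘(ℝ, DoubleModel m) 𝓘(ℝ, ℝ) ∞ fun y => φ.cwtTensor ε D y (X y) (Y y) (Z y) := by
  have hε' := neg_eq_one_or hε
  have hq := (h.isSectionL_splitL hε' hX).1
  have hp := φ.isSmoothVF_iota (-ε) (h.isSectionL_splitS hε' hX).1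
  have hY' := (φ.isSectionL_pS ε hY).1
  have hZ' := (φ.isSectionL_pS ε hZ).1
  refine ContMDiff.sub (contMDiff_const.mul (contMDiff_const.mul
    (((ContMDiff.sub ?_ ?_).sub (ContMDiff.sub ?_ ?_)).add (ContMDiff.sub ?_ ?_)))) ?_
  all_goals first
    | exact leafDiff_contMDiff hD hq hY' hZ'
    | exact leafDiff_contMDiff hD hY' hq hZ'
    | exact leafDiff_contMDiff hD hY' hZ' hq
    | exact leafDiff_contMDiff hD hZ' hY' hq
    | exact leafDiff_contMDiff hD hZ' hq hY'
    | exact leafDiff_contMDiff hD hq hZ' hY'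
    | exact torsionTensor_contMDiff hD hp (φ.isSectionS_prS ε hY).1 (φ.isSectionS_prS ε hZ).1

lemma cwtTensor_skew (hD : PreservesGam D) (u v w : TangentSpace 𝓘(ℝ, DoubleModel m) x) :
    φ.cwtTensor ε D x u w v = -φ.cwtTensor ε D x u v w := by
  rw [cwtTensor, cwtTensor, contorsion_skew, torsionTensor_skew' hD _ (φ.prS ε v)]
  ring

lemma cwtTensor_opp (hε : ε = 1 ∨ ε = -1)
    (D : Conn m M) (u w : TangentSpace 𝓘(ℝ, DoubleModel m) x)
    {v : TangentSpace 𝓘(ℝ, DoubleModel m) x} (hv : v ∈ φ.bundleS ε x) :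
    φ.cwtTensor (-ε) D x u v w = 0 := by
  have h1 : φ.pS (-ε) v = 0 := by
    obtain ⟨v, hv, rfl⟩ := hv
    exact φ.pS_iota_opp hε hv
  rw [cwtTensor, h1, φ.prS_opp_eq_zero hε hv,
    ((isTrilinear_torsionTensor D x).snd _ _).map_zero,
    ((φ.isTrilinear_leafDiff (-ε) D x).contorsion.snd _ _).map_zero, mul_zero, sub_zero]

lemma SumNondegenerate.cwtTensor_of_mem_leafL (h : φ.SumNondegenerate) (hε : ε = 1 ∨ ε = -1)
    {u v w : TangentSpace 𝓘(ℝ, DoubleModel m) x} (hu : u ∈ leafL x) (hv : v ∈ leafL x)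
    (hw : w ∈ leafL x) : φ.cwtTensor ε D x u (φ.iota ε v) (φ.iota ε w) =
      2 * ε * contorsion (φ.leafDiff ε D x) u v w := by
  have hε' := neg_eq_one_or hε
  rw [cwtTensor, h.splitS_of_mem hε' hu, h.splitL_of_mem hε' hu, φ.pS_iota hε hv, φ.pS_iota hε hw,
    (φ.isLinearMap_iota _).map_zero, ((isTrilinear_torsionTensor D x).fst _ _).map_zero, sub_zero]

lemma SumNondegenerate.cwtTensor_of_mem_bundleS (h : φ.SumNondegenerate) (hε : ε = 1 ∨ ε = -1)
    {u v w : TangentSpace 𝓘(ℝ, DoubleModel m) x} (hu : u ∈ φ.bundleS (-ε) x)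
    (hv : v ∈ φ.bundleS ε x) (hw : w ∈ φ.bundleS ε x) :
    φ.cwtTensor ε D x u v w = -torsionTensor D x u v w := by
  have hε' := neg_eq_one_or hε
  obtain ⟨u, hu, rfl⟩ := hu
  rw [cwtTensor, h.splitS_iota hε' hu, h.splitL_iota hε' hu, φ.prS_eq_self hε hv,
    φ.prS_eq_self hε hw, ((φ.isTrilinear_leafDiff ε D x).contorsion.fst _ _).map_zero, mul_zero,
    zero_sub]

/-- Existence of the CWT connection. -/
lemma SumNondegenerate.exists_isCWT (h : φ.SumNondegenerate) : ∃ D : Conn m M, φ.IsCWT D := by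
  have hD := φ.isDoubleMetric_sumConn
  -- The correction applies to any double-metric connection.
  generalize φ.sumConn = D at hD
  have hA : ∀ x, IsTrilinear fun u v w => φ.cwtTensor 1 D x u v w + φ.cwtTensor (-1) D x u v w :=
    fun x => (h.isTrilinear_cwtTensor (.inl rfl) D x).add (h.isTrilinear_cwtTensor (.inr rfl) D x)
  have hA' : ∀ ε : ℝ, ε = 1 ∨ ε = -1 → ∀ x u w, ∀ v ∈ φ.bundleS ε x,
      φ.cwtTensor 1 D x u v w + φ.cwtTensor (-1) D x u v w = φ.cwtTensor ε D x u v w := by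
    rintro ε (rfl | rfl) x u w v hv
    · rw [cwtTensor_opp (.inl rfl) D u w hv, add_zero]
    · have h1 := cwtTensor_opp (.inr rfl) D u w hv
      rw [neg_neg] at h1
      rw [h1, zero_add]
  have hE : φ.IsDoubleMetric (D.addTensor hA) := by
    refine hD.addTensor hA (fun X Y Z hX hY hZ =>
      (h.cwtTensor_contMDiff (.inl rfl) hD.smooth hX hY hZ).add
        (h.cwtTensor_contMDiff (.inr rfl) hD.smooth hX hY hZ)) (fun x u v w => ?_)
      fun x u v hv w hw => ?_
    · rw [cwtTensor_skew hD.preservesGam u v w, cwtTensor_skew hD.preservesGam u v w]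
      ring
    · have h1 := cwtTensor_opp (.inr rfl) D u v hw
      rw [neg_neg] at h1
      rw [hA' 1 (.inl rfl) x u w v hv, cwtTensor_skew hD.preservesGam u w v, h1, neg_zero]
  refine ⟨_, isCWT_iff.2 ⟨hE, fun ε hε x => ⟨fun u hu v hv w hw => ?_,
    fun u hu v hv w hw => ?_⟩⟩⟩
  · have hε' := neg_eq_one_or hε
    have h1 := cwtTensor_opp hε' D v w hu
    rw [neg_neg] at h1
    have h2 := cwtTensor_opp hε D w u hv
    -- In the cyclic sum of the added tensor only the term with direction `u` survives, the other
    -- two pairing `S_ε` with `S_{-ε}`; it is minus the torsion of `D`.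
    simp only [torsionTensor, flatDiff_addTensor]
    rw [hA' ε hε x u w v hv, hA' ε hε x v u w hw, hA' (-ε) hε' x w v u hu,
      h.cwtTensor_of_mem_bundleS hε hu hv hw, cwtTensor_skew hD.preservesGam v u w, h1,
      cwtTensor_skew hD.preservesGam w v u, h2, torsionTensor]
    ring
  · have key : ∀ u ∈ leafL x, ∀ v ∈ leafL x, ∀ w ∈ leafL x,
        φ.leafDiff ε (D.addTensor hA) x u v w =
          φ.leafDiff ε D x u v w + contorsion (φ.leafDiff ε D x) u v w := by
      intro u hu v hv w hw
      have h1 := hE.flatDiff_sub_iota hD hε u hv hw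
      rw [flatDiff_addTensor, add_sub_cancel_left, hA' ε hε x u _ _ (φ.iota_mem ε hv),
        h.cwtTensor_of_mem_leafL hε hu hv hw] at h1
      have h2 : (2 * ε : ℝ) ≠ 0 := by rcases hε with rfl | rfl <;> norm_num
      linarith [mul_left_cancel₀ h2 h1]
    rw [key u hu v hv w hw, key v hv u hu w hw, add_contorsion_symm]

/-- Uniqueness of the CWT connection. -/
lemma SumNondegenerate.same_of_isCWT (h : φ.SumNondegenerate) (hD : φ.IsCWT D)
    (hD' : φ.IsCWT D') : D.Same D' := by
  rw [isCWT_iff] at hD hD'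
  obtain ⟨hm, hc⟩ := hD
  obtain ⟨hm', hc'⟩ := hD'
  suffices hE : ∀ ε : ℝ, ε = 1 ∨ ε = -1 → ∀ (x : M) (u : TangentSpace 𝓘(ℝ, DoubleModel m) x),
      ∀ v ∈ φ.bundleS ε x, ∀ w, flatDiff D x u v w = flatDiff D' x u v w by
    refine Conn.same_of_gam fun X Y Z hX hY hZ x => ?_
    have h1 := hE 1 (.inl rfl) x (X x) _ (φ.prS_mem 1 (Y x)) (Z x)
    have h2 := hE (-1) (.inr rfl) x (X x) _ (φ.prS_mem (-1) (Y x)) (Z x)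
    have h3 : flatDiff D x (X x) (Y x) (Z x) = flatDiff D' x (X x) (Y x) (Z x) := by
      rw [← φ.prS_add_prS (Y x), ((isTrilinear_flatDiff D x).snd _ _).map_add,
        ((isTrilinear_flatDiff D' x).snd _ _).map_add, h1, h2]
    rw [flatDiff_apply D hY, flatDiff_apply D' hY] at h3
    linarith
  intro ε hε x u v hv w
  have hε' := neg_eq_one_or hε
  -- The `S_{-ε}`-component of `w` falls under `flatDiff_opp`, so `w` may be taken in `S_ε`; the
  -- direction `u` is then split along `S_{-ε} ⊕ L`.
  rw [← φ.prS_add_prS_neg hε w, ((isTrilinear_flatDiff D x).thd _ _).map_add,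
    ((isTrilinear_flatDiff D' x).thd _ _).map_add,
    hm.flatDiff_opp hm' hε u hv (φ.prS_mem (-ε) w)]
  congr 1
  obtain ⟨w, hw⟩ : ∃ w', w' = φ.prS ε w := ⟨_, rfl⟩
  rw [← hw]
  replace hw : w ∈ φ.bundleS ε x := hw ▸ φ.prS_mem ε _
  rw [← φ.iota_splitS_add_splitL (-ε) u, ((isTrilinear_flatDiff D x).fst _ _).map_add,
    ((isTrilinear_flatDiff D' x).fst _ _).map_add]
  have hp := h.splitS_mem hε' u
  have hq := h.splitL_mem hε' u
  congr 1
  -- Direction in `S_{-ε}`: two of the three terms of the mixed torsion are off-diagonal and common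
  -- to `D` and `D'`, so its vanishing fixes the third.
  · have hu := φ.iota_mem (-ε) hp
    have h1 := (hc ε hε x).1 _ hu v hv w hw
    have h2 := (hc' ε hε x).1 _ hu v hv w hw
    rw [torsionTensor, hm.flatDiff_opp hm' hε v hw hu,
      flatDiff_skew hm.preservesGam w v, hm.flatDiff_opp hm' hε w hv hu] at h1
    rw [torsionTensor, flatDiff_skew hm'.preservesGam w v] at h2
    linarith
  -- Direction in `L`: the difference is symmetric in its first two arguments by the torsion
  -- condition and skew in its last two by compatibility with `γ`, the classical uniqueness of the
  -- Levi-Civita connection.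
  · obtain ⟨v, hv, rfl⟩ := hv
    obtain ⟨w, hw, rfl⟩ := hw
    have h0 : ∀ u ∈ leafL x, ∀ v ∈ leafL x, ∀ w ∈ leafL x,
        flatDiff D x u (φ.iota ε v) (φ.iota ε w) - flatDiff D' x u (φ.iota ε v) (φ.iota ε w) = 0 := by
      intro u hu v hv w hw
      refine eq_zero_of_symm_of_skew (F := leafL x)
        (A := fun u v w => flatDiff D x u (φ.iota ε v) (φ.iota ε w) -
          flatDiff D' x u (φ.iota ε v) (φ.iota ε w)) (fun u hu v hv w hw => ?_)
        (fun u hu v hv w hw => ?_) hu hv hw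
      · simp only [hm.flatDiff_sub_iota hm' hε _ hv hw, hm.flatDiff_sub_iota hm' hε _ hu hw,
          (hc ε hε x).2 u hu v hv w hw, (hc' ε hε x).2 u hu v hv w hw]
      · simp only [flatDiff_skew hm.preservesGam u (φ.iota ε v),
          flatDiff_skew hm'.preservesGam u (φ.iota ε v)]
        ring
    exact sub_eq_zero.1 (h0 _ hq v hv w hw)

end DoubleField

end DoubleManifold

end

open DoubleManifold in
theorem proposition5p4 {m : ℕ} {M : Type*} [TopologicalSpace M] [T2Space M]
    [ChartedSpace (DoubleModel m) M] [IsManifold 𝓘(ℝ, DoubleModel m) ∞ M] [DoubleManifold m M]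
    (φ : DoubleField m M) :
    -- the CWT connection exists and is unique as soon as `g + B` is non degenerate on `L`
    (φ.SumNondegenerate →
      ∃ D₁ : Conn m M, φ.IsCWT D₁ ∧ ∀ D : Conn m M, φ.IsCWT D → D.Same D₁) ∧
    -- characterization of zero Gualtieri torsion
    (∀ D : Conn m M, φ.IsDoubleMetric D →
      (ZeroGTorsion D ↔ ∀ X Y Z : VField m M, IsSmoothVF X → IsSmoothVF Y → IsSmoothVF Z →
        ∀ x, cycSum D X Y Z x = cycBracket X Y Z x)) ∧
    ∀ D₁ : Conn m M, φ.IsCWT D₁ →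
      -- the VTC connection
      (∃ D : Conn m M,
        (φ.IsDoubleMetric D ∧ ZeroGTorsion D ∧ TotallySkew (covDef D D₁) ∧
          DeformationEq D D₁) ∧
        ∀ D' : Conn m M, φ.IsDoubleMetric D' → ZeroGTorsion D' → TotallySkew (covDef D' D₁) →
          D'.Same D) ∧
      -- the two forms of the equation of the covariant deformation are equivalent
      (∀ D : Conn m M, φ.IsDoubleMetric D → TotallySkew (covDef D D₁) →
        (DeformationEq D D₁ ↔ φ.LeafDeformationEq D D₁)) := by
  refine ⟨fun h => ?_, fun D hD => ?_, fun D₁ h₁ => ⟨?_, fun D hD hs =>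
    h₁.deformationEq_iff_leaf hD hs⟩⟩
  · obtain ⟨D₁, h₁⟩ := h.exists_isCWT
    exact ⟨D₁, h₁, fun D hD => h.same_of_isCWT hD h₁⟩
  · refine forall₃_congr fun X Y Z => forall₄_congr fun hX hY hZ x => ?_
    rw [gTorsion_eq_cycSum_sub_cycBracket hD.preservesGam hX hY hZ, sub_eq_zero]
  · obtain ⟨D, hD, h0, hs⟩ := h₁.exists_zeroGTorsion
    exact ⟨D, ⟨hD, h0, hs, (deformationEq_iff hD.preservesGam hs).2 h0⟩,
      fun D' hD' h0' hs' => hD.same_of_totallySkew hD' h0 h0' hs hs'⟩
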